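/- **Model.** One item is for sale to $n$ bidders. Bidder $i$ has a private type $\theta_i$ in a measurable space $\Theta_i$; the type profile is drawn from a common, possibly correlated, prior $\mathcal P$. Conditionally on the types the values $v_1,\dots,v_n\in\mathbb R$ are independent, $v_i\sim F_{\theta_i}$. Bidder $i$ learns $v_i$ only by paying an inspection cost $c_i(\theta_i)\ge 0$, and obtaining the item requires inspecting it. Utility is $u_i=A_iv_i-I_ic_i(\theta_i)-t_i$, where $A_i$ and $I_i$ indicate that $i$ obtains, resp. inspects, the item and $t_i$ is her payment. The strike price $\sigma_i=\sigma_i(\theta_i)$ is the unique solution of $\mathbb E_{\theta_i}[(v_i-\sigma_i)^+]=c_i(\theta_i)$ if $c_i(\theta_i)>0$, and $\sigma_i=+\infty$ if $c_i(\theta_i)=0$; the covered call value is $\kappa_i=\min\{\sigma_i,v_i\}$. The covered counterpart $\theta_i^\circ$ of the type $\theta_i$ is a type with zero inspection cost whose value is distributed like $\kappa_i$ given $\theta_i$; $\mathcal P^\circ$ is the law of $(\theta_1^\circ,\dots,\theta_n^\circ)$ for $(\theta_1,\dots,\theta_n)\sim\mathcal P$. Assume that $\mathbb E[v_i^+]<\infty$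 for all $i$ and that for all $i$ and almost every $\theta_i$ the law $F_{\theta_i}$ has no atom at $\sigma_i(\theta_i)$. **Auction.** In the Dutch auction a clock falls continuously from $\infty$ to $0$; while the item is unclaimed, any bidder may inspect privately and instantaneously, and may claim the item at the current clock value, which ends the auction. Bidders who want to act at the same clock value move one after the other, in an order drawn at random from a fixed distribution on the orders of the bidders, independently of everything else; each of them may inspect and then claim, and the first claim ends the auction. A strategy says at which clock value (if ever) to inspect, depending measurably on the bidder's type and on a private random number, uniform on $[0,1]$ and independent of everything else, and at which clock value (if ever), not before inspecting, to claim, depending measurably also on her value. Equilibria are Bayes–Nash equilibria. Two equilibria of the same auction are functionally equivalent if for almost every realization of types, values, private random numbers and tie-breaking order they award the item to the same bidder (if any) at the same price and the set of bidders who pay a non-zero inspection cost is the same. **Theorem.** There is a mapping from the equilibria of the Dutch auction with types distributed according to $\mathcal P$ to the equilibria of the Dutch auction with types distributed according to $\mathcal P^\circ$ (bidders can learn their values $\kappa_i$ free of charge) that preserves the expected utility of every bidder and the expected revenue of the auctioneer, and that induces a bijection between the functional equivalence classes of equilibria of the two auctions. -/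

import Mathlib

open MeasureTheory ProbabilityTheory
open scoped ENNReal NNReal unitInterval

/-- Priority orders of the bidders (used to break ties) form a finite set; every subset is an
event. -/
instance instMeasurableSpacePriority (n : ℕ) : MeasurableSpace (Equiv.Perm (Fin n)) := ⊤

/-- The single-item model with costly single-stage inspection. Bidder `i` has a private type in
`Θ i`; the types are drawn from the common prior `prior` (possibly correlated). A bidder `i` of type
`t` has a value with law `value i t`, and pays `cost i t ≥ 0` if she inspects. -/
structure Environment {n : ℕ} (Θ : Fin n → Type*) [∀ i, MeasurableSpace (Θ i)] where
  prior : Measure (∀ i, Θ i)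
  prior_prob : IsProbabilityMeasure prior
  value : ∀ i, Kernel (Θ i) ℝ
  value_markov : ∀ i, IsMarkovKernel (value i)
  cost : ∀ i, Θ i → ℝ≥0
  cost_measurable : ∀ i, Measurable (cost i)

attribute [instance] Environment.prior_prob Environment.value_markov

namespace Environment

variable {n : ℕ} {Θ : Fin n → Type*} [∀ i, MeasurableSpace (Θ i)]

/-- `𝔼_t[(v - s)⁺]`: the fair value of a call option with strike `s` on the value of bidder `i` of
type `t`. -/
noncomputable def callValue (E : Environment Θ) (i : Fin n) (t : Θ i) (s : ℝ) : ℝ≥0∞ :=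
  ∫⁻ v, ENNReal.ofReal (v - s) ∂(E.value i t)

/-- The strike price `σ_i`: the highest price at which inspecting is still advantageous. If the cost
is positive this is the unique solution `s` of `𝔼_t[(v - s)⁺] = c` (see `strike_spec`); if the cost
is zero it is `+∞`, so that the covered call value is the value itself. -/
noncomputable def strike (E : Environment Θ) (i : Fin n) (t : Θ i) : EReal :=
  sSup ((fun s : ℝ => (s : EReal)) '' {s : ℝ | (E.cost i t : ℝ≥0∞) ≤ E.callValue i t s})

/-- The covered call value `κ_i = min {σ_i, v_i}`. -/
noncomputable def coveredCall (E : Environment Θ) (i : Fin n) (t : Θ i) (v : ℝ) : ℝ :=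
  (min (E.strike i t) (v : EReal)).toReal

section facts

variable (E : Environment Θ) (i : Fin n)

theorem callValue_antitone (t : Θ i) : Antitone (E.callValue i t) := fun a b hab =>
  lintegral_mono fun v => ENNReal.ofReal_le_ofReal (by linarith)

theorem callValue_le_add (t : Θ i) (a b : ℝ) :
    E.callValue i t a ≤ E.callValue i t b + ENNReal.ofReal (b - a) := by
  have h : E.callValue i t a
      ≤ ∫⁻ v, (ENNReal.ofReal (v - b) + ENNReal.ofReal (b - a)) ∂(E.value i t) := by
    refine lintegral_mono fun v => ?_
    have hv : v - a = (v - b) + (b - a) := by ring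
    rw [hv]
    exact ENNReal.ofReal_add_le
  refine h.trans (le_of_eq ?_)
  rw [lintegral_add_right _ measurable_const]
  simp [callValue]

theorem exists_le_callValue (t : Θ i) (c : ℝ≥0) : ∃ s : ℝ, (c : ℝ≥0∞) ≤ E.callValue i t s := by
  have hsup : ⨆ m : ℕ, E.callValue i t (-(m : ℝ)) = ∞ := by
    unfold callValue
    rw [← lintegral_iSup (fun m => by fun_prop)]
    · have : ∀ v : ℝ, ⨆ m : ℕ, ENNReal.ofReal (v - -(m : ℝ)) = ∞ := by
        intro v
        refine iSup_eq_top.2 fun b hb => ?_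
        obtain ⟨m, hm⟩ := exists_nat_gt (b.toReal - v)
        refine ⟨m, ?_⟩
        rw [← ENNReal.ofReal_toReal hb.ne]
        exact (ENNReal.ofReal_lt_ofReal_iff_of_nonneg ENNReal.toReal_nonneg).2 (by linarith)
      simp only [this]
      simp
    · intro a b hab v
      have : (a : ℝ) ≤ b := by exact_mod_cast hab
      exact ENNReal.ofReal_le_ofReal (by linarith)
  obtain ⟨m, hm⟩ := iSup_eq_top.1 hsup c (by simp)
  exact ⟨_, hm.le⟩

/-- With a positive cost and `𝔼_t[v⁺] < ∞`, the strike price is a real number and is the unique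
solution of `𝔼_t[(v - s)⁺] = c`. -/
theorem strike_spec (t : Θ i) (hc : 0 < E.cost i t)
    (hv : ∫⁻ v, ENNReal.ofReal v ∂(E.value i t) < ∞) (s : ℝ) :
    E.callValue i t s = E.cost i t ↔ E.strike i t = s := by
  have h0 : E.callValue i t 0 < ∞ := by simpa [callValue] using hv
  have hfin : ∀ s, E.callValue i t s ≠ ∞ := fun s =>
    ((E.callValue_le_add i t s 0).trans_lt
      (ENNReal.add_lt_top.2 ⟨h0, ENNReal.ofReal_lt_top⟩)).ne
  have hstrict : ∀ a b, a < b → E.callValue i t b ≠ 0 → E.callValue i t b < E.callValue i t a := by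
    intro a b hab hb
    refine lt_of_le_of_ne (E.callValue_antitone i t hab.le) fun heq => hb ?_
    have hae : (fun v : ℝ => ENNReal.ofReal (v - b)) =ᵐ[E.value i t]
        fun v : ℝ => ENNReal.ofReal (v - a) := by
      refine ae_eq_of_ae_le_of_lintegral_le ?_ (hfin b) (by fun_prop) heq.ge
      exact Filter.Eventually.of_forall fun v => ENNReal.ofReal_le_ofReal (by linarith)
    unfold callValue
    rw [lintegral_eq_zero_iff (by fun_prop)]
    filter_upwards [hae] with v hv
    by_contra hne
    have hpos : 0 < v - b := by
      by_contra hle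
      exact hne (ENNReal.ofReal_of_nonpos (not_lt.1 hle))
    rw [ENNReal.ofReal_eq_ofReal_iff hpos.le (by linarith)] at hv
    linarith
  have hcont : Continuous fun s => (E.callValue i t s).toReal := by
    refine (LipschitzWith.of_le_add fun a b => ?_ : LipschitzWith 1 _).continuous
    have h := ENNReal.toReal_mono
      (ENNReal.add_ne_top.2 ⟨hfin b, ENNReal.ofReal_ne_top⟩) (E.callValue_le_add i t a b)
    rw [ENNReal.toReal_add (hfin b) ENNReal.ofReal_ne_top] at h
    refine h.trans (add_le_add_right ?_ _)
    rw [ENNReal.toReal_ofReal', Real.dist_eq]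
    exact max_le (by rw [abs_sub_comm]; exact le_abs_self _) (abs_nonneg _)
  obtain ⟨s₁, hs₁⟩ := E.exists_le_callValue i t (E.cost i t)
  obtain ⟨s₂, hs₂⟩ : ∃ s : ℝ, E.callValue i t s < E.cost i t := by
    have hinf : ⨅ m : ℕ, E.callValue i t (m : ℝ) = 0 := by
      unfold callValue
      rw [← lintegral_iInf (fun m => by fun_prop)]
      · have : ∀ v : ℝ, ⨅ m : ℕ, ENNReal.ofReal (v - (m : ℝ)) = 0 := by
          intro v
          obtain ⟨m, hm⟩ := exists_nat_gt v
          refine le_antisymm ((iInf_le _ m).trans ?_) zero_le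
          rw [ENNReal.ofReal_of_nonpos (by linarith)]
        simp [this]
      · intro a b hab v
        have : (a : ℝ) ≤ b := by exact_mod_cast hab
        exact ENNReal.ofReal_le_ofReal (by linarith)
      · exact hfin _
    obtain ⟨m, hm⟩ := iInf_lt_iff.1 (hinf.trans_lt (by simpa using hc) :
      ⨅ m : ℕ, E.callValue i t (m : ℝ) < (E.cost i t : ℝ≥0∞))
    exact ⟨_, hm⟩
  have h12 : s₁ ≤ s₂ := by
    by_contra h
    exact absurd (hs₁.trans (E.callValue_antitone i t (not_le.1 h).le)) (not_le.2 hs₂)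
  obtain ⟨z, -, hz⟩ : ((E.cost i t : ℝ≥0) : ℝ) ∈
      (fun s => (E.callValue i t s).toReal) '' Set.Icc s₁ s₂ := by
    refine intermediate_value_Icc' h12 hcont.continuousOn ⟨?_, ?_⟩
    · simpa using ENNReal.toReal_mono ENNReal.coe_ne_top hs₂.le
    · simpa using ENNReal.toReal_mono (hfin s₁) hs₁
  have hz' : E.callValue i t z = E.cost i t := by
    rw [← ENNReal.ofReal_toReal (hfin z)]
    simp only at hz
    rw [hz, ENNReal.ofReal_coe_nnreal]
  have hcne : (E.cost i t : ℝ≥0∞) ≠ 0 := by simpa using hc.ne'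
  have hstrike : E.strike i t = z := by
    refine le_antisymm (sSup_le ?_) (le_sSup ⟨z, hz'.ge, rfl⟩)
    rintro _ ⟨s, hs, rfl⟩
    by_contra h
    have hlt : z < s := by simpa using h
    have hs' : (E.cost i t : ℝ≥0∞) ≤ E.callValue i t s := hs
    have := hstrict z s hlt (fun h0 => hcne (le_antisymm (h0 ▸ hs') zero_le))
    rw [hz'] at this
    exact absurd hs' (not_le.2 this)
  rw [hstrike]
  constructor
  · intro hs
    rcases lt_trichotomy z s with h | h | h
    · have := hstrict z s h (hs ▸ hcne)
      rw [hs, hz'] at this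
      exact absurd this (lt_irrefl _)
    · rw [h]
    · have := hstrict s z h (hz' ▸ hcne)
      rw [hs, hz'] at this
      exact absurd this (lt_irrefl _)
  · intro h
    have : z = s := by exact_mod_cast h
    rw [← this, hz']

theorem measurable_callValue (s : ℝ) : Measurable fun t => E.callValue i t s := by
  unfold callValue
  exact Measurable.lintegral_kernel (by fun_prop)

theorem measurable_strike : Measurable (E.strike i) := by
  refine measurable_of_Ioi fun x => ?_
  have : E.strike i ⁻¹' Set.Ioi x = ⋃ q : ℚ, ⋃ _ : x < ((q : ℝ) : EReal),
      {t | (E.cost i t : ℝ≥0∞) ≤ E.callValue i t q} := by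
    ext t
    simp only [Set.mem_preimage, Set.mem_Ioi, strike, lt_sSup_iff, Set.mem_image, Set.mem_ofPred_eq,
      Set.mem_iUnion, exists_prop]
    constructor
    · rintro ⟨_, ⟨s, hs, rfl⟩, hx⟩
      obtain ⟨q, hq1, hq2⟩ := EReal.lt_iff_exists_rat_btwn.1 hx
      have hqs : (q : ℝ) < s := by exact_mod_cast hq2
      exact ⟨q, hq1, hs.trans (E.callValue_antitone i t hqs.le)⟩
    · rintro ⟨q, hq1, hq2⟩
      exact ⟨_, ⟨_, hq2, rfl⟩, hq1⟩
  rw [this]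
  refine MeasurableSet.iUnion fun q => MeasurableSet.iUnion fun _ => ?_
  exact measurableSet_le (E.cost_measurable i).coe_nnreal_ennreal (E.measurable_callValue i q)

theorem measurable_coveredCall : Measurable fun p : Θ i × ℝ => E.coveredCall i p.1 p.2 := by
  unfold coveredCall
  exact (((E.measurable_strike i).comp measurable_fst).min
    measurable_snd.coe_real_ereal).ereal_toReal

end facts

/-- The environment of the covered counterparts: the types are (copies of) the original types with
the same joint law, inspection is free, and the value of bidder `i` of type `t` is distributed like
her covered call value `κ_i = min {σ_i, v_i}`. -/
noncomputable def covered (E : Environment Θ) : Environment Θ where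
  prior := E.prior
  prior_prob := E.prior_prob
  value i := ((Kernel.id ×ₖ E.value i).map fun p => E.coveredCall i p.1 p.2)
  value_markov i := Kernel.IsMarkovKernel.map _ (E.measurable_coveredCall i)
  cost _ _ := 0
  cost_measurable _ := measurable_const

theorem covered_value_apply (E : Environment Θ) (i : Fin n) (t : Θ i) :
    E.covered.value i t = (E.value i t).map (E.coveredCall i t) := by
  have hm := E.measurable_coveredCall i
  have h1 : Measurable (Prod.mk t : ℝ → Θ i × ℝ) := measurable_prodMk_left
  rw [covered, Kernel.map_apply _ hm, Kernel.prod_apply, Kernel.id_apply, Measure.dirac_prod,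
    Measure.map_map hm h1]
  rfl

/-- Given the type profile, the values are independent, with laws `value i (θ i)`. -/
noncomputable def valueProfile (E : Environment Θ) : Kernel (∀ i, Θ i) (Fin n → ℝ) where
  toFun θ := Measure.pi fun i => E.value i (θ i)
  measurable' := by
    refine Measurable.measure_of_isPiSystem_of_isProbabilityMeasure generateFrom_pi.symm
      isPiSystem_pi ?_
    rintro _ ⟨s, hs, rfl⟩
    simp only [Measure.pi_pi]
    refine Finset.measurable_prod _ fun i _ => ?_
    exact ((E.value i).measurable_coe (hs i (Set.mem_univ i))).comp (measurable_pi_apply i)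

/-- Sample points: types, values, private randomization devices, priority order. -/
abbrev Sample {n : ℕ} (Θ : Fin n → Type*) : Type _ :=
  ((∀ i, Θ i) × (Fin n → ℝ)) × ((Fin n → I) × Equiv.Perm (Fin n))

/-- The law of the sample point: types are drawn from the prior and values from the value
distributions; independently of these, each bidder privately draws a uniform random number from
`[0, 1]`, all independent, and the priority order is drawn from `ρ`. -/
noncomputable def law (E : Environment Θ) (ρ : Measure (Equiv.Perm (Fin n))) :
    Measure (Sample Θ) :=
  (E.prior ⊗ₘ E.valueProfile).prod ((Measure.pi fun _ : Fin n => (volume : Measure I)).prod ρ)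

end Environment

/-- A (possibly randomized) strategy in the Dutch auction of a bidder with type space `T`. Clock
values are elements of `[0, ∞]`, and `⊥` stands for "never". While the item is unclaimed, the only
thing that a bidder can observe besides the clock is her own type, her private random number, and
her value once she has inspected. Hence a strategy consists of the clock value `inspectAt` at which
she inspects, a function of the type and the random number (`⊤`: at the start), and the clock value
`claimAt` at which she claims, a function of the type, the random number and the value. She can
claim only from the moment of inspection on, as obtaining the item requires inspecting it. -/
structure DutchStrategy (T : Type*) [MeasurableSpace T] where
  inspectAt : T × I → EReal
  claimAt : (T × I) × ℝ → EReal
  inspectAt_measurable : Measurable inspectAt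
  claimAt_measurable : Measurable claimAt
  inspectAt_range : ∀ x, inspectAt x = ⊥ ∨ 0 ≤ inspectAt x
  claimAt_range : ∀ x v, claimAt (x, v) = ⊥ ∨ 0 ≤ claimAt (x, v)
  claimAt_ne_top : ∀ x v, claimAt (x, v) ≠ ⊤
  claimAt_le : ∀ x v, claimAt (x, v) ≤ inspectAt x

namespace Environment

variable {n : ℕ} {Θ : Fin n → Type*} [∀ i, MeasurableSpace (Θ i)]

/-- Profiles of strategies. -/
abbrev Profile {n : ℕ} (Θ : Fin n → Type*) [∀ i, MeasurableSpace (Θ i)] : Type _ :=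
  ∀ i, DutchStrategy (Θ i)

/-- The clock values at which the bidders plan to claim, at a sample point. -/
def claims (s : Profile Θ) (ω : Sample Θ) (i : Fin n) : EReal :=
  (s i).claimAt ((ω.1.1 i, ω.2.1 i), ω.1.2 i)

/-- With planned claims `a` and priority order `π`, bidder `i` gets to act at clock value `x`: no
other bidder claims the item at a higher clock value, or at clock value `x` with a higher priority
(a smaller `π`). Bidders who are to act at the same clock value move in the priority order, each
inspecting and then claiming if she wishes, and the auction ends with the first claim. -/
def Reaches (a : Fin n → EReal) (π : Equiv.Perm (Fin n)) (i : Fin n) (x : EReal) : Prop :=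
  x ≠ ⊥ ∧ ∀ j, j ≠ i → a j < x ∨ (a j = x ∧ π i < π j)

/-- Bidder `i` obtains the item. -/
def Wins (s : Profile Θ) (ω : Sample Θ) (i : Fin n) : Prop :=
  Reaches (claims s ω) ω.2.2 i (claims s ω i)

/-- Bidder `i` inspects. -/
def Inspects (s : Profile Θ) (ω : Sample Θ) (i : Fin n) : Prop :=
  Reaches (claims s ω) ω.2.2 i ((s i).inspectAt (ω.1.1 i, ω.2.1 i))

open Classical in
/-- The payment of bidder `i`: the clock value of her claim if she obtains the item, else `0`. -/
noncomputable def payment (s : Profile Θ) (ω : Sample Θ) (i : Fin n) : ℝ :=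
  if Wins s ω i then (claims s ω i).toReal else 0

open Classical in
/-- The utility `u_i = A_i v_i - I_i c_i - t_i` at a sample point. -/
noncomputable def utility (E : Environment Θ) (s : Profile Θ) (ω : Sample Θ) (i : Fin n) : ℝ :=
  (if Wins s ω i then ω.1.2 i else 0)
    - (if Inspects s ω i then (E.cost i (ω.1.1 i) : ℝ) else 0) - payment s ω i

/-- Expected utility, `𝔼[u_i⁺] - 𝔼[u_i⁻]`. -/
noncomputable def expUtility (E : Environment Θ) (ρ : Measure (Equiv.Perm (Fin n)))
    (s : Profile Θ) (i : Fin n) : EReal :=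
  ((∫⁻ ω, ENNReal.ofReal (E.utility s ω i) ∂(E.law ρ) : ℝ≥0∞) : EReal)
    - ((∫⁻ ω, ENNReal.ofReal (-(E.utility s ω i)) ∂(E.law ρ) : ℝ≥0∞) : EReal)

/-- Expected revenue of the auctioneer. -/
noncomputable def expRevenue (E : Environment Θ) (ρ : Measure (Equiv.Perm (Fin n)))
    (s : Profile Θ) : ℝ≥0∞ :=
  ∫⁻ ω, ENNReal.ofReal (∑ i, payment s ω i) ∂(E.law ρ)

/-- (Bayes–Nash) equilibria of the Dutch auction. -/
def IsEquilibrium (E : Environment Θ) (ρ : Measure (Equiv.Perm (Fin n))) (s : Profile Θ) : Prop :=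
  ∀ (i : Fin n) (d : DutchStrategy (Θ i)),
    E.expUtility ρ (Function.update s i d) i ≤ E.expUtility ρ s i

/-- The type of equilibria. -/
abbrev Equilibrium (E : Environment Θ) (ρ : Measure (Equiv.Perm (Fin n))) : Type _ :=
  {s : Profile Θ // E.IsEquilibrium ρ s}

/-- The outcomes of two strategy profiles at a sample point are functionally equivalent: the same
bidder (if any) gets the item, at the same price, and the same bidders pay a non-zero inspection
cost. -/
def SameOutcome (E : Environment Θ) (s s' : Profile Θ) (ω : Sample Θ) : Prop :=
  ∀ i, (Wins s ω i ↔ Wins s' ω i) ∧ payment s ω i = payment s' ω i ∧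
    ((Inspects s ω i ∧ E.cost i (ω.1.1 i) ≠ 0) ↔ (Inspects s' ω i ∧ E.cost i (ω.1.1 i) ≠ 0))

/-- Functional equivalence of equilibria: functionally equivalent outcomes at almost every sample
point. -/
def functionalEquivalence (E : Environment Θ) (ρ : Measure (Equiv.Perm (Fin n))) :
    Setoid (E.Equilibrium ρ) where
  r s s' := ∀ᵐ ω ∂(E.law ρ), E.SameOutcome s.1 s'.1 ω
  iseqv :=
    { refl := fun _ => Filter.Eventually.of_forall fun _ _ => ⟨Iff.rfl, rfl, Iff.rfl⟩
      symm := fun h => h.mono fun _ hω i => ⟨(hω i).1.symm, (hω i).2.1.symm, (hω i).2.2.symm⟩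
      trans := fun h h' => by
        filter_upwards [h, h'] with ω h1 h2 i
        exact ⟨(h1 i).1.trans (h2 i).1, (h1 i).2.1.trans (h2 i).2.1,
          (h1 i).2.2.trans (h2 i).2.2⟩ }

end Environment

/-! Fix a bidder, her type and the behaviour of her rivals. Whether she inspects is settled before
her value is known, so given her type this event is independent of the value. The excess `v - κ` of
the value over the covered call value has conditional mean equal to the inspection cost. In
expectation, paying the cost is thus the same as giving up the excess at every inspection. Her
expected utility is therefore the expected net covered call value of what she wins, minus the
expected excess at inspections without a win (`FiniteValue.integral_utility`). The second term is
nonnegative, and it vanishes exactly if, after inspecting, she almost surely obtains the item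
whenever its value exceeds the strike price (`Unexposed`).

Given her type, the rivals matter only through the probability `p x` of getting to act at clock
value `x`; a claim at `x` is worth `p x * (κ - x)`. Optimal claims for higher `κ` win at least as
often. Inspecting at the clock value at which she would claim with `κ` equal to the strike price
therefore removes the exposure at no loss. Consequently a profile is an equilibrium if and only if
claims almost surely maximize `p x * (κ - x)` and everybody is unexposed
(`IsEquilibrium.interimOptimal_and_unexposed`, `isEquilibrium_of_interimOptimal`). With covered
counterparts exposure is impossible and the first condition is the whole equilibrium condition. For
claims that depend on the value only through `κ`, it is the same condition in both auctions
(`Lifts.interimOptimal_iff`).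

It remains to bring equilibrium claims into that form. At types and random numbers where a bidder
wins with positive probability they already have it almost surely: above the strike price all claims
are reached equally often and are optimal for the same `κ`, hence have the same price
(`InterimOptimal.constantAboveStrike`), and values at the strike price are null because there are no
atoms. Claims that almost surely lose cannot simply be dropped, since they affect what rivals gain
by deviating. They are replaced by claims that depend on the random number only and have the same
conditional law given the type (`exists_quantile`). The joint law of types, claims and priority
order is then unchanged, so all optimization problems are unchanged, and almost surely so are the
winner and the price.

In the other direction, the claims of an equilibrium with covered counterparts, evaluated at `κ`,
are constant above the strike price and can be treated in the same way
(`exists_equilibrium_of_covered`). Finally, winner and price determine who pays for an inspection: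
with a positive cost the value exceeds the strike price with positive probability, an inspecting
bidder then wins, and inspecting does not depend on the value
(`Unexposed.ae_inspects_of_sameWinner`). -/

namespace Environment

variable {n : ℕ} {Θ : Fin n → Type*} [∀ i, MeasurableSpace (Θ i)]

/-! ### Who acts at which clock value -/

theorem Reaches.mono {a : Fin n → EReal} {π : Equiv.Perm (Fin n)} {i : Fin n} {x y : EReal}
    (h : Reaches a π i x) (hxy : x ≤ y) : Reaches a π i y := by
  refine ⟨fun hy => h.1 (le_bot_iff.1 (hy ▸ hxy)), fun j hj => ?_⟩
  rcases h.2 j hj with h1 | ⟨h1, h2⟩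
  · exact Or.inl (h1.trans_le hxy)
  · rcases hxy.lt_or_eq with h3 | h3
    · exact Or.inl (h1.trans_lt h3)
    · exact Or.inr ⟨h1.trans h3, h2⟩

theorem reaches_congr {a a' : Fin n → EReal} {π : Equiv.Perm (Fin n)} {i : Fin n} {x : EReal}
    (h : ∀ j, j ≠ i → a j = a' j) : Reaches a π i x ↔ Reaches a' π i x := by
  unfold Reaches
  refine and_congr_right fun _ => forall_congr' fun j => forall_congr' fun hj => ?_
  rw [h j hj]

theorem reaches_update {a : Fin n → EReal} {π : Equiv.Perm (Fin n)} {i : Fin n} {x y : EReal} :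
    Reaches (Function.update a i y) π i x ↔ Reaches a π i x :=
  reaches_congr fun _ hj => Function.update_of_ne hj _ _

theorem not_reaches_bot {a : Fin n → EReal} {π : Equiv.Perm (Fin n)} {i : Fin n} :
    ¬ Reaches a π i ⊥ := fun h => h.1 rfl

theorem reaches_unique {a : Fin n → EReal} {π : Equiv.Perm (Fin n)} {i j : Fin n}
    (hi : Reaches a π i (a i)) (hj : Reaches a π j (a j)) : i = j := by
  by_contra hne
  rcases hi.2 j (Ne.symm hne) with h | ⟨h, h'⟩ <;> rcases hj.2 i hne with k | ⟨k, k'⟩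
  · exact lt_asymm h k
  · exact h.ne k.symm
  · exact k.ne h.symm
  · exact lt_asymm h' k'

theorem exists_reaches {a : Fin n → EReal} (π : Equiv.Perm (Fin n)) (h : ∃ i, a i ≠ ⊥) :
    ∃ i, Reaches a π i (a i) := by
  obtain ⟨i₀, hi₀⟩ := h
  -- The winner maximizes the claim and, among equal claims, has the smallest priority number.
  obtain ⟨k, -, hk⟩ := Finset.exists_max_image Finset.univ
    (fun i => toLex (a i, OrderDual.toDual (π i))) ⟨i₀, Finset.mem_univ _⟩
  have hk' : ∀ j, a j < a k ∨ (a j = a k ∧ π k ≤ π j) := fun j => by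
    have := hk j (Finset.mem_univ j)
    rw [Prod.Lex.toLex_le_toLex] at this
    simpa using this
  refine ⟨k, fun h => ?_, fun j hj => ?_⟩
  · rcases hk' i₀ with h1 | ⟨h1, -⟩
    · rw [h] at h1; exact not_lt_bot h1
    · exact hi₀ (h1.trans h)
  · rcases hk' j with h1 | ⟨h1, h2⟩
    · exact Or.inl h1
    · exact Or.inr ⟨h1, lt_of_le_of_ne h2 fun h3 => hj (π.injective h3).symm⟩

/-- Changing claims that lose into other claims that would also lose changes neither the winner nor
her claim. -/
theorem reaches_self_congr {a a' : Fin n → EReal} {π : Equiv.Perm (Fin n)}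
    (h : ∀ i, a i = a' i ∨ (¬ Reaches a π i (a i) ∧ ¬ Reaches a π i (a' i))) (i : Fin n) :
    (Reaches a π i (a i) ↔ Reaches a' π i (a' i)) ∧ (Reaches a π i (a i) → a i = a' i) := by
  have key : ∀ k, Reaches a π k (a k) → Reaches a' π k (a' k) := by
    intro k hk
    have hak : a k = a' k := (h k).resolve_right fun h' => h'.1 hk
    refine ⟨hak ▸ hk.1, fun j hj => ?_⟩
    rcases h j with hj' | ⟨-, hj'⟩
    · rw [← hak, ← hj']; exact hk.2 j hj
    · rw [← hak]
      -- If the new claim of `j` beat the claim of `k`, it would beat all the other old claims too,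
      -- since these lose to `k`. It would then be reached against `a`, contrary to `hj'`.
      by_contra hcon
      push Not at hcon
      obtain ⟨h1, h2⟩ := hcon
      refine hj' ⟨fun hb => hk.1 (le_bot_iff.1 (hb ▸ h1)), fun l hl => ?_⟩
      rcases h1.lt_or_eq with h3 | h3
      · left
        by_cases hlk : l = k
        · rw [hlk]; exact h3
        · rcases hk.2 l hlk with h4 | ⟨h4, -⟩
          · exact h4.trans h3
          · rw [h4]; exact h3
      · have h5 : π j < π k := lt_of_le_of_ne (h2 h3.symm) fun h6 => hj (π.injective h6)
        by_cases hlk : l = k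
        · exact Or.inr ⟨by rw [hlk, h3], by rw [hlk]; exact h5⟩
        · rcases hk.2 l hlk with h4 | ⟨h4, h6⟩
          · exact Or.inl (h3 ▸ h4)
          · exact Or.inr ⟨h4.trans h3, h5.trans h6⟩
  refine ⟨⟨key i, fun hi => ?_⟩, fun hi => (h i).resolve_right fun h' => h'.1 hi⟩
  -- For the converse, the winner under `a` also wins under `a'`, and winners are unique. If nobody
  -- claims under `a`, every claim would be reached against `a`, so `a'` contains none.
  by_cases hne : ∃ j, a j ≠ ⊥
  · obtain ⟨k, hk⟩ := exists_reaches π hne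
    rwa [reaches_unique hi (key k hk)]
  · push Not at hne
    exfalso
    rcases h i with h1 | ⟨-, h1⟩
    · exact hi.1 (h1 ▸ hne i)
    · exact h1 ⟨hi.1, fun j _ => Or.inl (by rw [hne j]; exact bot_lt_iff_ne_bot.2 hi.1)⟩

theorem measurableSet_reaches (i : Fin n) :
    MeasurableSet {y : ((Fin n → EReal) × Equiv.Perm (Fin n)) × EReal |
      Reaches y.1.1 y.1.2 i y.2} := by
  have hx : Measurable fun y : ((Fin n → EReal) × Equiv.Perm (Fin n)) × EReal => y.2 :=
    measurable_snd
  have ha : ∀ j, Measurable fun y : ((Fin n → EReal) × Equiv.Perm (Fin n)) × EReal => y.1.1 j :=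
    fun j => (measurable_pi_apply j).comp (measurable_fst.comp measurable_fst)
  have hπ : Measurable fun y : ((Fin n → EReal) × Equiv.Perm (Fin n)) × EReal => y.1.2 :=
    measurable_snd.comp measurable_fst
  unfold Reaches
  simp only [Set.ofPred_and, Set.ofPred_forall, Set.ofPred_or]
  refine MeasurableSet.inter ?_ (MeasurableSet.iInter fun j => MeasurableSet.iInter fun _ =>
    (measurableSet_lt (ha j) hx).union ((measurableSet_eq_fun (ha j) hx).inter ?_))
  · exact (measurableSet_eq_fun hx measurable_const).compl
  · exact hπ (t := {π | π i < π j}) trivial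

/-! ### Covered call values -/

section covered

variable (E : Environment Θ) (i : Fin n)

theorem strike_ne_bot (t : Θ i) : E.strike i t ≠ ⊥ := by
  obtain ⟨s, hs⟩ := E.exists_le_callValue i t (E.cost i t)
  exact fun h => EReal.coe_ne_bot s (le_bot_iff.1 (h ▸ le_sSup ⟨s, hs, rfl⟩))

theorem strike_eq_top {t : Θ i} (h : E.cost i t = 0) : E.strike i t = ⊤ := by
  refine EReal.eq_top_iff_forall_lt _ |>.2 fun y => ?_
  have : ((y + 1 : ℝ) : EReal) ≤ E.strike i t := le_sSup ⟨y + 1, by simp [h], rfl⟩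
  exact lt_of_lt_of_le (by exact_mod_cast lt_add_one y) this

theorem coe_coveredCall (t : Θ i) (v : ℝ) :
    (E.coveredCall i t v : EReal) = min (E.strike i t) v := by
  refine EReal.coe_toReal ?_ ?_
  · exact ((min_le_right _ _).trans_lt (EReal.coe_lt_top v)).ne
  · exact (lt_min (bot_lt_iff_ne_bot.2 (E.strike_ne_bot i t)) (EReal.bot_lt_coe v)).ne'

theorem coveredCall_le (t : Θ i) (v : ℝ) : E.coveredCall i t v ≤ v := by
  have := E.coe_coveredCall i t v
  exact EReal.coe_le_coe_iff.1 (this.trans_le (min_le_right _ _))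

theorem coveredCall_lt_iff (t : Θ i) (v : ℝ) : E.coveredCall i t v < v ↔ E.strike i t < v := by
  rw [← EReal.coe_lt_coe_iff, E.coe_coveredCall, min_lt_iff]
  simp

theorem coveredCall_of_le {t : Θ i} {v : ℝ} (h : (v : EReal) ≤ E.strike i t) :
    E.coveredCall i t v = v := by
  rw [← EReal.coe_eq_coe_iff, E.coe_coveredCall, min_eq_right h]

theorem coveredCall_of_cost_eq_zero {t : Θ i} (h : E.cost i t = 0) (v : ℝ) :
    E.coveredCall i t v = v :=
  E.coveredCall_of_le i (by rw [E.strike_eq_top i h]; exact le_top)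

theorem covered_coveredCall (t : Θ i) (v : ℝ) : E.covered.coveredCall i t v = v :=
  E.covered.coveredCall_of_cost_eq_zero i rfl v

/-- With `𝔼_t[v⁺] < ∞`, a positive inspection cost makes the strike price a real number. -/
theorem exists_strike_eq_coe {t : Θ i} (hc : 0 < E.cost i t)
    (hv : ∫⁻ v, ENNReal.ofReal v ∂(E.value i t) < ∞) :
    ∃ s : ℝ, E.strike i t = s ∧ E.callValue i t s = E.cost i t := by
  have htop : E.strike i t ≠ ⊤ := by
    intro htop
    have hall : ∀ s : ℝ, (E.cost i t : ℝ≥0∞) ≤ E.callValue i t s := by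
      intro s
      have : (s : EReal) < E.strike i t := htop ▸ EReal.coe_lt_top s
      obtain ⟨_, ⟨r, hr, rfl⟩, hsr⟩ := lt_sSup_iff.1 this
      exact le_trans (show (E.cost i t : ℝ≥0∞) ≤ E.callValue i t r from hr)
        (E.callValue_antitone i t (EReal.coe_le_coe_iff.1 hsr.le))
    -- Dominated by `v⁺`, the call values tend to zero as the strike grows, so they cannot all be at
    -- least a positive cost.
    have hlim : Filter.Tendsto (fun m : ℕ => E.callValue i t m) Filter.atTop (nhds 0) := by
      have h0 : (0 : ℝ≥0∞) = ∫⁻ _, 0 ∂(E.value i t) := by simp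
      rw [h0]
      refine tendsto_lintegral_of_dominated_convergence (fun v => ENNReal.ofReal v)
        (fun m => by fun_prop) (fun m => Filter.Eventually.of_forall fun v =>
          ENNReal.ofReal_le_ofReal (by simp)) hv.ne (Filter.Eventually.of_forall fun v => ?_)
      refine tendsto_const_nhds.congr' ?_
      filter_upwards [Filter.eventually_ge_atTop ⌈v⌉₊] with m hm
      refine (ENNReal.ofReal_of_nonpos ?_).symm
      have := (Nat.le_ceil v).trans (Nat.cast_le.2 hm)
      linarith
    have := ge_of_tendsto' hlim fun m => hall m
    simp at this
    exact hc.ne' this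
  refine ⟨(E.strike i t).toReal, (EReal.coe_toReal htop (E.strike_ne_bot i t)).symm, ?_⟩
  exact (E.strike_spec i t hc hv _).2 (EReal.coe_toReal htop (E.strike_ne_bot i t)).symm

/-- The fair price of the gain of the value over the covered call value is the inspection cost. -/
theorem lintegral_sub_coveredCall {t : Θ i} (hv : ∫⁻ v, ENNReal.ofReal v ∂(E.value i t) < ∞) :
    ∫⁻ v, ENNReal.ofReal (v - E.coveredCall i t v) ∂(E.value i t) = E.cost i t := by
  rcases eq_or_ne (E.cost i t) 0 with h | h
  · simp [E.coveredCall_of_cost_eq_zero i h, h]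
  · obtain ⟨s, hs, hs'⟩ := E.exists_strike_eq_coe i (pos_iff_ne_zero.2 h) hv
    rw [← hs']
    refine lintegral_congr fun v => ?_
    have hk : E.coveredCall i t v = min s v := by
      rw [← EReal.coe_eq_coe_iff, E.coe_coveredCall, hs, ← EReal.coe_strictMono.monotone.map_min]
    rw [hk]
    rcases le_total s v with h1 | h1
    · rw [min_eq_left h1]
    · rw [min_eq_right h1, ENNReal.ofReal_of_nonpos (by linarith),
        ENNReal.ofReal_of_nonpos (by linarith)]

/-- Otherwise the excess over the covered call value would vanish almost surely, but its mean is the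
positive cost. This is what turns almost sure statements about values above the strike price into
statements about the type. -/
theorem value_strike_lt_ne_zero {t : Θ i} (hc : E.cost i t ≠ 0)
    (hv : ∫⁻ v, ENNReal.ofReal v ∂(E.value i t) < ∞) :
    E.value i t {v | E.strike i t < (v : EReal)} ≠ 0 := by
  intro h0
  have h1 : ∀ᵐ v ∂(E.value i t), ENNReal.ofReal (v - E.coveredCall i t v) = 0 := by
    rw [measure_eq_zero_iff_ae_notMem] at h0
    filter_upwards [h0] with v h
    refine ENNReal.ofReal_of_nonpos ?_
    have := (E.coveredCall_lt_iff i t v).not.2 h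
    linarith
  have h2 := E.lintegral_sub_coveredCall i hv
  rw [lintegral_congr_ae h1, lintegral_zero] at h2
  exact hc (by exact_mod_cast h2.symm)

end covered

end Environment

/-! ### Sample points and redrawing the private data of one bidder -/

namespace Environment

variable {n : ℕ} {Θ : Fin n → Type*}

/-- The sample point with type profile `θ`, random numbers and values `y`, priority order `π`. -/
def toSample (θ : ∀ i, Θ i) (y : Fin n → I × ℝ) (π : Equiv.Perm (Fin n)) : Sample Θ :=
  ((θ, fun j => (y j).2), (fun j => (y j).1, π))

theorem toSample_update (θ : ∀ i, Θ i) (y : Fin n → I × ℝ) (π : Equiv.Perm (Fin n)) (i : Fin n)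
    (z : I × ℝ) : toSample θ (Function.update y i z) π =
      ((θ, Function.update (toSample θ y π).1.2 i z.2),
        (Function.update (toSample θ y π).2.1 i z.1, π)) := by
  unfold toSample
  congr 3 <;> funext j <;> by_cases hj : j = i
  · subst hj; simp
  · simp [hj]
  · subst hj; simp
  · simp [hj]

/-- Both integrands have the same marginal in coordinate `i`: the one on the left is already
averaged over it. -/
theorem lintegral_pi_update {X : Fin n → Type*} [∀ i, MeasurableSpace (X i)]
    (μ : ∀ i, Measure (X i)) [∀ i, IsProbabilityMeasure (μ i)] (i : Fin n)
    {f : (∀ i, X i) → ℝ≥0∞} (hf : Measurable f) :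
    ∫⁻ x, ∫⁻ z, f (Function.update x i z) ∂(μ i) ∂(Measure.pi μ) = ∫⁻ x, f x ∂(Measure.pi μ) := by
  have hg : Measurable fun x => ∫⁻ z, f (Function.update x i z) ∂(μ i) := by
    refine Measurable.lintegral_prod_right' (f := fun p : (∀ i, X i) × X i =>
      f (Function.update p.1 i p.2)) (hf.comp ?_)
    exact measurable_update'
  refine lintegral_eq_of_lmarginal_eq {i} hg hf ?_
  rw [lmarginal_singleton, lmarginal_singleton]
  funext x
  simp

variable [∀ i, MeasurableSpace (Θ i)]

/-! ### The law of the sample point -/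

section law

variable (E : Environment Θ) (ρ : Measure (Equiv.Perm (Fin n)))

instance : IsMarkovKernel E.valueProfile :=
  ⟨fun θ => by unfold valueProfile; simp only [Kernel.coe_mk]; infer_instance⟩

instance [IsProbabilityMeasure ρ] : IsProbabilityMeasure (E.law ρ) := by unfold law; infer_instance

/-- The law of the private random number and the value of a bidder of type `t`. -/
noncomputable def privateLaw (i : Fin n) (t : Θ i) : Measure (I × ℝ) :=
  (volume : Measure I).prod (E.value i t)

instance (i : Fin n) (t : Θ i) : IsProbabilityMeasure (E.privateLaw i t) := by
  unfold privateLaw; infer_instance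

/-- Regroups random numbers and values by bidder: given types and priority order, the pairs of
different bidders are independent. All later independence arguments use this form. -/
theorem lintegral_law {h : Sample Θ → ℝ≥0∞} (hh : Measurable h) :
    ∫⁻ ω, h ω ∂(E.law ρ) = ∫⁻ θ, ∫⁻ π, ∫⁻ y, h (toSample θ y π)
      ∂(Measure.pi fun j => E.privateLaw j (θ j)) ∂ρ ∂E.prior := by
  unfold law
  rw [lintegral_prod _ hh.aemeasurable, Measure.lintegral_compProd (hh.lintegral_prod_right')]
  refine lintegral_congr fun θ => ?_
  have hθ : Measurable fun z : (Fin n → ℝ) × ((Fin n → I) × Equiv.Perm (Fin n)) =>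
      h ((θ, z.1), z.2) := by fun_prop
  calc ∫⁻ v, ∫⁻ z, h ((θ, v), z)
          ∂((Measure.pi fun _ : Fin n => (volume : Measure I)).prod ρ) ∂(E.valueProfile θ)
      = ∫⁻ v, ∫⁻ π, ∫⁻ r, h ((θ, v), (r, π)) ∂(Measure.pi fun _ : Fin n => (volume : Measure I))
          ∂ρ ∂(E.valueProfile θ) := by
        refine lintegral_congr fun v => ?_
        exact lintegral_prod_symm _ (hh.comp measurable_prodMk_left).aemeasurable
    _ = ∫⁻ π, ∫⁻ v, ∫⁻ r, h ((θ, v), (r, π)) ∂(Measure.pi fun _ : Fin n => (volume : Measure I))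
          ∂(E.valueProfile θ) ∂ρ := by
        refine lintegral_lintegral_swap (Measurable.aemeasurable ?_)
        refine Measurable.lintegral_prod_right' (f := fun z : ((Fin n → ℝ) × Equiv.Perm (Fin n)) ×
          (Fin n → I) => h ((θ, z.1.1), (z.2, z.1.2))) ?_
        fun_prop
    _ = _ := by
        refine lintegral_congr fun π => ?_
        have hπ : Measurable fun z : (Fin n → I) × (Fin n → ℝ) => h ((θ, z.2), (z.1, π)) := by
          fun_prop
        rw [lintegral_lintegral_swap (by fun_prop)]
        have hmp := measurePreserving_arrowProdEquivProdArrow I ℝ (Fin n)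
          (fun _ => (volume : Measure I)) (fun j => E.value j (θ j))
        have := hmp.lintegral_comp hπ
        refine Eq.trans ?_ this.symm
        rw [lintegral_prod _ hπ.aemeasurable]
        rfl

/-- Redrawing the private random number and the value of a bidder does not change the law of the
sample point. -/
theorem lintegral_law_resample (i : Fin n) {h : Sample Θ → ℝ≥0∞} (hh : Measurable h) :
    ∫⁻ ω, h ω ∂(E.law ρ) = ∫⁻ ω, ∫⁻ r, ∫⁻ v, h ((ω.1.1, Function.update ω.1.2 i v),
      (Function.update ω.2.1 i r, ω.2.2)) ∂(E.value i (ω.1.1 i)) ∂(volume : Measure I)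
        ∂(E.law ρ) := by
  have hm : Measurable fun p : (Sample Θ × I) × ℝ =>
      h ((p.1.1.1.1, Function.update p.1.1.1.2 i p.2),
        (Function.update p.1.1.2.1 i p.1.2, p.1.1.2.2)) := by
    refine hh.comp (Measurable.prodMk (Measurable.prodMk (by fun_prop) ?_)
      (Measurable.prodMk ?_ (by fun_prop)))
    · exact measurable_update'.comp (Measurable.prodMk (g := fun p : (Sample Θ × I) × ℝ => p.2)
        (f := fun p : (Sample Θ × I) × ℝ => p.1.1.1.2) (by fun_prop) (by fun_prop))
    · exact measurable_update'.comp (Measurable.prodMk (g := fun p : (Sample Θ × I) × ℝ => p.1.2)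
        (f := fun p : (Sample Θ × I) × ℝ => p.1.1.2.1) (by fun_prop) (by fun_prop))
  have hk : Measurable fun p : Sample Θ × I => ∫⁻ v, h ((p.1.1.1, Function.update p.1.1.2 i v),
      (Function.update p.1.2.1 i p.2, p.1.2.2)) ∂(E.value i (p.1.1.1 i)) :=
    hm.lintegral_kernel_prod_right' (κ := (E.value i).comap
      (fun p : Sample Θ × I => p.1.1.1 i) (by fun_prop))
  rw [lintegral_law E ρ hh, lintegral_law E ρ hk.lintegral_prod_right']
  refine lintegral_congr fun θ => lintegral_congr fun π => ?_
  have hf : Measurable fun y => h (toSample θ y π) := by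
    unfold toSample; fun_prop
  rw [← lintegral_pi_update _ i hf]
  refine lintegral_congr fun y => ?_
  simp only [toSample_update]
  unfold privateLaw
  rw [lintegral_prod _ (Measurable.aemeasurable ?_)]
  · rfl
  · exact hm.comp (g := fun p : (Sample Θ × I) × ℝ =>
      h ((p.1.1.1.1, Function.update p.1.1.1.2 i p.2),
        (Function.update p.1.1.2.1 i p.1.2, p.1.1.2.2)))
      (f := fun z : I × ℝ => ((toSample θ y π, z.1), z.2)) (by fun_prop)

/-- The joint law of the type, the private random number and the value of a bidder. -/
noncomputable def interimLaw (i : Fin n) : Measure ((Θ i × I) × ℝ) :=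
  ((E.prior.map fun θ => θ i).prod (volume : Measure I)) ⊗ₘ (Kernel.prodMkRight I (E.value i))

instance (i : Fin n) : IsProbabilityMeasure (E.prior.map fun θ => θ i) :=
  Measure.isProbabilityMeasure_map (measurable_pi_apply i).aemeasurable

instance (i : Fin n) : IsProbabilityMeasure (E.interimLaw i) := by
  unfold interimLaw; infer_instance

theorem lintegral_interimLaw (i : Fin n) {f : (Θ i × I) × ℝ → ℝ≥0∞} (hf : Measurable f) :
    ∫⁻ y, f y ∂(E.interimLaw i) = ∫⁻ t, ∫⁻ r, ∫⁻ v, f ((t, r), v) ∂(E.value i t)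
      ∂(volume : Measure I) ∂(E.prior.map fun θ => θ i) := by
  unfold interimLaw
  rw [Measure.lintegral_compProd hf, lintegral_prod]
  · rfl
  · exact (hf.lintegral_kernel_prod_right' (κ := Kernel.prodMkRight I (E.value i))).aemeasurable

/-- The type, the random number and the value of a bidder at a sample point. -/
def privateInfo (i : Fin n) (ω : Sample Θ) : (Θ i × I) × ℝ := ((ω.1.1 i, ω.2.1 i), ω.1.2 i)

end law

end Environment

namespace Environment

variable {n : ℕ} {Θ : Fin n → Type*} [∀ i, MeasurableSpace (Θ i)]

/-! ### The claims of the rivals, as seen by a bidder who knows her type -/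

section rivals

theorem measurable_privateInfo (i : Fin n) : Measurable (privateInfo (Θ := Θ) i) := by
  unfold privateInfo; fun_prop

theorem measurable_claims (s : Profile Θ) : Measurable (claims s) :=
  measurable_pi_lambda _ fun i => (s i).claimAt_measurable.comp (measurable_privateInfo i)

theorem claims_apply (s : Profile Θ) (ω : Sample Θ) (i : Fin n) :
    claims s ω i = (s i).claimAt (privateInfo i ω) := rfl

/-- The claims and the priority order at a sample point. -/
def claimsOrder (s : Profile Θ) (ω : Sample Θ) : (Fin n → EReal) × Equiv.Perm (Fin n) :=
  (claims s ω, ω.2.2)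

theorem measurable_claimsOrder (s : Profile Θ) : Measurable (claimsOrder s) :=
  (measurable_claims s).prodMk (by fun_prop)

variable (E : Environment Θ) (ρ : Measure (Equiv.Perm (Fin n)))

/-- The joint law of the types, the claims and the priority order. -/
noncomputable def claimLaw (s : Profile Θ) :
    Measure ((∀ i, Θ i) × ((Fin n → EReal) × Equiv.Perm (Fin n))) :=
  (E.law ρ).map fun ω => (ω.1.1, claimsOrder s ω)

theorem measurable_types_claimsOrder (s : Profile Θ) :
    Measurable fun ω : Sample Θ => (ω.1.1, claimsOrder s ω) :=
  Measurable.prodMk (by fun_prop) (measurable_claimsOrder s)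

/-- The law of the claim of a bidder of type `t`. -/
noncomputable def bidLaw (i : Fin n) (d : DutchStrategy (Θ i)) (t : Θ i) : Measure EReal :=
  (E.privateLaw i t).map fun y => d.claimAt ((t, y.1), y.2)

theorem measurable_claimAt_section {i : Fin n} (d : DutchStrategy (Θ i)) (t : Θ i) :
    Measurable fun y : I × ℝ => d.claimAt ((t, y.1), y.2) :=
  d.claimAt_measurable.comp (by fun_prop)

/-- The joint law of the types, the claims and the priority order depends on the strategies only
through the laws of the claims given the types. -/
theorem claimLaw_congr {E' : Environment Θ} (hE : E'.prior = E.prior) {s s' : Profile Θ}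
    (h : ∀ i, ∀ᵐ t ∂(E.prior.map fun θ => θ i), E'.bidLaw i (s' i) t = E.bidLaw i (s i) t) :
    E'.claimLaw ρ s' = E.claimLaw ρ s := by
  -- For fixed types the claims of different bidders are independent, so their joint conditional law
  -- is the product of the bid laws.
  have key : ∀ (E : Environment Θ) (s : Profile Θ)
      (f : (∀ i, Θ i) × ((Fin n → EReal) × Equiv.Perm (Fin n)) → ℝ≥0∞), Measurable f →
      ∫⁻ x, f x ∂(E.claimLaw ρ s) = ∫⁻ θ, ∫⁻ π, ∫⁻ a, f (θ, (a, π))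
        ∂(Measure.pi fun j => E.bidLaw j (s j) (θ j)) ∂ρ ∂E.prior := by
    intro E s f hf
    unfold claimLaw
    rw [lintegral_map hf (measurable_types_claimsOrder s),
      lintegral_law E ρ (h := fun ω => f (ω.1.1, claimsOrder s ω))
        (hf.comp (measurable_types_claimsOrder s))]
    refine lintegral_congr fun θ => lintegral_congr fun π => ?_
    have hm : ∀ j, Measurable fun y : I × ℝ => (s j).claimAt ((θ j, y.1), y.2) :=
      fun j => measurable_claimAt_section _ _
    have hpi := Measure.pi_map_pi (μ := fun j => E.privateLaw j (θ j))
      (f := fun j (y : I × ℝ) => (s j).claimAt ((θ j, y.1), y.2))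
      (hμ := fun j => by
        have := Measure.isProbabilityMeasure_map (μ := E.privateLaw j (θ j)) (hm j).aemeasurable
        infer_instance)
      (fun j => (hm j).aemeasurable)
    unfold bidLaw
    rw [← hpi, lintegral_map (by fun_prop : Measurable fun a => f (θ, (a, π)))
      (by exact measurable_pi_lambda _ fun j => (hm j).comp (measurable_pi_apply j))]
    rfl
  refine Measure.ext_of_lintegral _ fun f hf => ?_
  rw [key E' s' f hf, key E s f hf, hE]
  refine lintegral_congr_ae ?_
  have h' : ∀ᵐ θ ∂E.prior, ∀ i, E'.bidLaw i (s' i) (θ i) = E.bidLaw i (s i) (θ i) :=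
    ae_all_iff.2 fun i => ae_of_ae_map (measurable_pi_apply i).aemeasurable (h i)
  filter_upwards [h'] with θ hθ
  simp only [hθ]

variable [IsProbabilityMeasure ρ]

instance (s : Profile Θ) : IsProbabilityMeasure (E.claimLaw ρ s) :=
  Measure.isProbabilityMeasure_map (measurable_types_claimsOrder s).aemeasurable

instance : DiscreteMeasurableSpace (Equiv.Perm (Fin n)) := ⟨fun _ => trivial⟩

/-- The conditional law of the claims and the priority order given the type of bidder `i`. -/
noncomputable def rivalKernel (s : Profile Θ) (i : Fin n) :
    Kernel (Θ i) ((Fin n → EReal) × Equiv.Perm (Fin n)) :=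
  condDistrib (fun x : (∀ i, Θ i) × ((Fin n → EReal) × Equiv.Perm (Fin n)) => x.2)
    (fun x => x.1 i) (E.claimLaw ρ s)

instance (s : Profile Θ) (i : Fin n) : IsMarkovKernel (E.rivalKernel ρ s i) := by
  unfold rivalKernel; infer_instance

theorem map_type_claimLaw (s : Profile Θ) (i : Fin n) :
    (E.claimLaw ρ s).map (fun x => x.1 i) = E.prior.map fun θ => θ i := by
  have h : (E.law ρ).map (fun ω => ω.1.1) = E.prior := by
    unfold law
    have h1 : Measure.map Prod.fst (E.prior ⊗ₘ E.valueProfile) = E.prior :=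
      Measure.fst_compProd _ _
    have h2 : Measure.map Prod.fst ((E.prior ⊗ₘ E.valueProfile).prod
      ((Measure.pi fun _ : Fin n => (volume : Measure I)).prod ρ)) =
        E.prior ⊗ₘ E.valueProfile := Measure.fst_prod
    rw [show (fun ω : Sample Θ => ω.1.1) = Prod.fst ∘ Prod.fst from rfl,
      ← Measure.map_map measurable_fst measurable_fst, h2, h1]
  unfold claimLaw
  rw [Measure.map_map (by fun_prop) (measurable_types_claimsOrder s), ← h,
    Measure.map_map (by fun_prop) (by fun_prop)]
  rfl

/-- Disintegration: given her type, the random number and the value of bidder `i` are independent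
of the claims of her rivals. -/
theorem lintegral_law_eq (s : Profile Θ) (i : Fin n)
    {g : ((Θ i × I) × ℝ) × ((Fin n → EReal) × Equiv.Perm (Fin n)) → ℝ≥0∞} (hg : Measurable g)
    (hgi : ∀ y a π x, g (y, (Function.update a i x, π)) = g (y, (a, π))) :
    ∫⁻ ω, g (privateInfo i ω, claimsOrder s ω) ∂(E.law ρ) =
      ∫⁻ y, ∫⁻ q, g (y, q) ∂(E.rivalKernel ρ s i y.1.1) ∂(E.interimLaw i) := by
  have hF : Measurable fun p : ((Θ i × ((Fin n → EReal) × Equiv.Perm (Fin n))) × I) × ℝ =>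
      g (((p.1.1.1, p.1.2), p.2), p.1.1.2) := by fun_prop
  have hF2 : Measurable fun p : (Θ i × ((Fin n → EReal) × Equiv.Perm (Fin n))) × I =>
      ∫⁻ v, g (((p.1.1, p.2), v), p.1.2) ∂(E.value i p.1.1) :=
    hF.lintegral_kernel_prod_right' (κ := (E.value i).comap
      (fun p : (Θ i × ((Fin n → EReal) × Equiv.Perm (Fin n))) × I => p.1.1) (by fun_prop))
  have hφ : Measurable fun p : Θ i × ((Fin n → EReal) × Equiv.Perm (Fin n)) =>
      ∫⁻ r, ∫⁻ v, g (((p.1, r), v), p.2) ∂(E.value i p.1) ∂(volume : Measure I) :=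
    hF2.lintegral_prod_right'
  have hgo : Measurable fun ω : Sample Θ => g (privateInfo i ω, claimsOrder s ω) :=
    hg.comp ((measurable_privateInfo i).prodMk (measurable_claimsOrder s))
  calc ∫⁻ ω, g (privateInfo i ω, claimsOrder s ω) ∂(E.law ρ)
      = ∫⁻ ω, ∫⁻ r, ∫⁻ v, g (((ω.1.1 i, r), v), claimsOrder s ω) ∂(E.value i (ω.1.1 i))
          ∂(volume : Measure I) ∂(E.law ρ) := by
        rw [lintegral_law_resample E ρ i hgo]
        refine lintegral_congr fun ω => lintegral_congr fun r => lintegral_congr fun v => ?_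
        have h1 : claimsOrder s ((ω.1.1, Function.update ω.1.2 i v),
            (Function.update ω.2.1 i r, ω.2.2)) =
            (Function.update (claims s ω) i ((s i).claimAt ((ω.1.1 i, r), v)), ω.2.2) := by
          unfold claimsOrder
          congr 1
          funext j
          by_cases hj : j = i
          · subst hj; simp [claims]
          · simp [claims, hj]
        have h2 : privateInfo i ((ω.1.1, Function.update ω.1.2 i v),
            (Function.update ω.2.1 i r, ω.2.2)) = ((ω.1.1 i, r), v) := by
          simp [privateInfo]
        -- Redrawing her random number and value alters only her own entry among the claims, and `g`
        -- ignores that entry.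
        rw [h1, h2, hgi]
        rfl
    _ = ∫⁻ p, ∫⁻ r, ∫⁻ v, g (((p.1, r), v), p.2) ∂(E.value i p.1) ∂(volume : Measure I)
          ∂((E.claimLaw ρ s).map fun x => (x.1 i, x.2)) := by
        unfold claimLaw
        rw [Measure.map_map (by fun_prop) (measurable_types_claimsOrder s), lintegral_map hφ
          ((by fun_prop : Measurable fun x : (∀ i, Θ i) × ((Fin n → EReal) × Equiv.Perm (Fin n))
            => (x.1 i, x.2)).comp (measurable_types_claimsOrder s))]
        rfl
    _ = ∫⁻ t, ∫⁻ q, ∫⁻ r, ∫⁻ v, g (((t, r), v), q) ∂(E.value i t) ∂(volume : Measure I)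
          ∂(E.rivalKernel ρ s i t) ∂(E.prior.map fun θ => θ i) := by
        rw [← compProd_map_condDistrib measurable_snd.aemeasurable, map_type_claimLaw,
          Measure.lintegral_compProd hφ]
        rfl
    _ = ∫⁻ t, ∫⁻ r, ∫⁻ v, ∫⁻ q, g (((t, r), v), q) ∂(E.rivalKernel ρ s i t) ∂(E.value i t)
          ∂(volume : Measure I) ∂(E.prior.map fun θ => θ i) := by
        refine lintegral_congr fun t => ?_
        have hgt : Measurable fun p : (((Fin n → EReal) × Equiv.Perm (Fin n)) × I) × ℝ =>
          g (((t, p.1.2), p.2), p.1.1) := by fun_prop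
        rw [lintegral_lintegral_swap (hgt.lintegral_prod_right').aemeasurable]
        refine lintegral_congr fun r => ?_
        rw [lintegral_lintegral_swap]
        exact Measurable.aemeasurable (by fun_prop)
    _ = _ := by
        rw [lintegral_interimLaw]
        exact hg.lintegral_kernel_prod_right' (κ := (E.rivalKernel ρ s i).comap
          (fun p : (Θ i × I) × ℝ => p.1.1) (by fun_prop))

/-- The interim laws are the laws of the private information. -/
theorem map_privateInfo_law (i : Fin n) : (E.law ρ).map (privateInfo i) = E.interimLaw i := by
  refine Measure.ext_of_lintegral _ fun f hf => ?_
  rw [lintegral_map hf (measurable_privateInfo i)]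
  -- Any profile serves, because the integrand does not involve the claims.
  have s : Profile Θ := fun j => ⟨fun _ => ⊥, fun _ => ⊥, measurable_const, measurable_const,
    fun _ => Or.inl rfl, fun _ _ => Or.inl rfl, fun _ _ => bot_ne_top, fun _ _ => le_rfl⟩
  have := lintegral_law_eq E ρ s i (g := fun z => f z.1) (by fun_prop) (fun _ _ _ _ => rfl)
  simpa using this

/-! ### The probability of acting at a clock value -/

/-- The probability that bidder `i` of type `t` gets to act at clock value `x`. -/
noncomputable def reachProb (s : Profile Θ) (i : Fin n) (t : Θ i) (x : EReal) : ℝ :=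
  (E.rivalKernel ρ s i t).real {q | Reaches q.1 q.2 i x}

/-- A bidder's optimization problem sees the rivals only through the joint law of types, claims and
priority order. Hence it can be carried over between profiles, and between the two environments,
whenever this law is the same. -/
theorem reachProb_congr {E' : Environment Θ} {s s' : Profile Θ}
    (h : E'.claimLaw ρ s' = E.claimLaw ρ s) : E'.reachProb ρ s' = E.reachProb ρ s := by
  funext i t x
  unfold reachProb rivalKernel
  simp only [h]

theorem measurableSet_reaches_section (i : Fin n) (x : EReal) :
    MeasurableSet {q : (Fin n → EReal) × Equiv.Perm (Fin n) | Reaches q.1 q.2 i x} :=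
  (measurableSet_reaches i).preimage
    (f := fun q : (Fin n → EReal) × Equiv.Perm (Fin n) => (q, x)) (by fun_prop)

theorem measurable_reachProb (s : Profile Θ) (i : Fin n) :
    Measurable fun y : Θ i × EReal => E.reachProb ρ s i y.1 y.2 := by
  unfold reachProb Measure.real
  refine Measurable.ennreal_toReal ?_
  have hS : MeasurableSet {z : (Θ i × EReal) × ((Fin n → EReal) × Equiv.Perm (Fin n)) |
      Reaches z.2.1 z.2.2 i z.1.2} :=
    (measurableSet_reaches i).preimage
      (f := fun z : (Θ i × EReal) × ((Fin n → EReal) × Equiv.Perm (Fin n)) => (z.2, z.1.2))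
      (by fun_prop)
  exact Kernel.measurable_kernel_prodMk_left (κ := (E.rivalKernel ρ s i).comap
    (fun p : Θ i × EReal => p.1) (by fun_prop)) hS

variable (s : Profile Θ) (i : Fin n) (t : Θ i)

theorem reachProb_nonneg (x : EReal) : 0 ≤ E.reachProb ρ s i t x := measureReal_nonneg

theorem reachProb_le_one (x : EReal) : E.reachProb ρ s i t x ≤ 1 := measureReal_le_one

theorem reachProb_mono : Monotone (E.reachProb ρ s i t) := fun _ _ hxy =>
  measureReal_mono fun _ hq => Reaches.mono hq hxy

@[simp] theorem reachProb_bot : E.reachProb ρ s i t ⊥ = 0 := by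
  simp [reachProb, not_reaches_bot]

theorem ofReal_reachProb (x : EReal) : ENNReal.ofReal (E.reachProb ρ s i t x) =
    E.rivalKernel ρ s i t {q | Reaches q.1 q.2 i x} := by
  simp [reachProb]

/-- The interim expected gain of bidder `i` of type `t` from claiming at `x` an item that is worth
`k` to her. -/
noncomputable def gain (x : EReal) (k : ℝ) : ℝ :=
  E.reachProb ρ s i t x * (k - x.toReal)

theorem gain_congr {E' : Environment Θ} {s s' : Profile Θ}
    (h : E'.claimLaw ρ s' = E.claimLaw ρ s) : E'.gain ρ s' = E.gain ρ s := by
  funext i t x k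
  unfold gain
  rw [reachProb_congr E ρ h]

@[simp] theorem gain_bot (k : ℝ) : E.gain ρ s i t ⊥ k = 0 := by simp [gain]

theorem measurable_gain :
    Measurable fun y : (Θ i × EReal) × ℝ => E.gain ρ s i y.1.1 y.1.2 y.2 := by
  unfold gain
  refine Measurable.mul ((E.measurable_reachProb ρ s i).comp measurable_fst)
    (measurable_snd.sub ?_)
  exact (measurable_snd.comp measurable_fst).ereal_toReal

end rivals

end Environment

/-! ### Integrals with values in the extended reals -/

section ExtendedIntegral

variable {α : Type*} [MeasurableSpace α] {μ : Measure α} {f : α → ℝ}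

theorem lintegral_sub_lintegral_eq_integral (hf : Integrable f μ) :
    ((∫⁻ x, ENNReal.ofReal (f x) ∂μ : ℝ≥0∞) : EReal)
      - ((∫⁻ x, ENNReal.ofReal (-(f x)) ∂μ : ℝ≥0∞) : EReal) = ((∫ x, f x ∂μ : ℝ) : EReal) := by
  have h1 : ∫⁻ x, ENNReal.ofReal (f x) ∂μ ≠ ∞ := hf.lintegral_lt_top.ne
  have h2 : ∫⁻ x, ENNReal.ofReal (-(f x)) ∂μ ≠ ∞ := hf.neg.lintegral_lt_top.ne
  rw [integral_eq_lintegral_pos_part_sub_lintegral_neg_part hf, EReal.coe_sub,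
    EReal.coe_ennreal_toReal h1, EReal.coe_ennreal_toReal h2]

/-- With a finite positive part, an infinite negative part would make the difference `⊥`. So a
utility that is not `-∞` is an honest integral. -/
theorem integrable_of_lintegral_sub_lintegral_ne_bot (hm : Measurable f)
    (hf : ∫⁻ x, ENNReal.ofReal (f x) ∂μ ≠ ∞)
    (h : ((∫⁻ x, ENNReal.ofReal (f x) ∂μ : ℝ≥0∞) : EReal)
      - ((∫⁻ x, ENNReal.ofReal (-(f x)) ∂μ : ℝ≥0∞) : EReal) ≠ ⊥) : Integrable f μ := by
  have h2 : ∫⁻ x, ENNReal.ofReal (-(f x)) ∂μ ≠ ∞ := by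
    intro h2
    rw [h2, EReal.coe_ennreal_top, EReal.sub_top] at h
    exact h rfl
  refine ⟨hm.aestronglyMeasurable, ?_⟩
  have : ∀ x, ‖f x‖ₑ = ENNReal.ofReal (f x) + ENNReal.ofReal (-(f x)) := by
    intro x
    rw [← ofReal_norm, Real.norm_eq_abs]
    rcases le_total 0 (f x) with h0 | h0
    · rw [abs_of_nonneg h0, ENNReal.ofReal_of_nonpos (by linarith : -(f x) ≤ 0), add_zero]
    · rw [abs_of_nonpos h0, ENNReal.ofReal_of_nonpos h0, zero_add]
  unfold HasFiniteIntegral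
  simp only [this]
  rw [lintegral_add_left hm.ennreal_ofReal]
  exact ENNReal.add_lt_top.2 ⟨hf.lt_top, h2.lt_top⟩

end ExtendedIntegral

namespace Environment

variable {n : ℕ} {Θ : Fin n → Type*} [∀ i, MeasurableSpace (Θ i)]

/-! ### Utilities and covered gains -/

section deviations

variable (E : Environment Θ) (i : Fin n) (d : DutchStrategy (Θ i))

/-- The private information of bidder `i` together with the claims and the priority order. -/
abbrev View {n : ℕ} (Θ : Fin n → Type*) (i : Fin n) : Type _ :=
  ((Θ i × I) × ℝ) × ((Fin n → EReal) × Equiv.Perm (Fin n))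

/-- The views at which bidder `i` obtains the item with the strategy `d`. -/
def winSet : Set (View Θ i) := {z | Reaches z.2.1 z.2.2 i (d.claimAt z.1)}

/-- The views at which bidder `i` inspects with the strategy `d`. -/
def inspectSet : Set (View Θ i) := {z | Reaches z.2.1 z.2.2 i (d.inspectAt z.1.1)}

theorem measurableSet_winSet : MeasurableSet (winSet i d) :=
  (measurableSet_reaches i).preimage (f := fun z : View Θ i => (z.2, d.claimAt z.1))
    (measurable_snd.prodMk (d.claimAt_measurable.comp measurable_fst))

theorem measurableSet_inspectSet : MeasurableSet (inspectSet i d) :=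
  (measurableSet_reaches i).preimage (f := fun z : View Θ i => (z.2, d.inspectAt z.1.1))
    (measurable_snd.prodMk (d.inspectAt_measurable.comp (measurable_fst.comp measurable_fst)))

theorem winSet_subset_inspectSet : winSet i d ⊆ inspectSet i d :=
  fun z hz => Reaches.mono hz (d.claimAt_le z.1.1 z.1.2)

/-- The net value of the item for the winner. -/
noncomputable def winValue : View Θ i → ℝ :=
  (winSet i d).indicator fun z => z.1.2 - (d.claimAt z.1).toReal

/-- The inspection cost that is paid. -/
noncomputable def costPaid : View Θ i → ℝ :=
  (inspectSet i d).indicator fun z => (E.cost i z.1.1.1 : ℝ)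

/-- The net covered call value of the item for the winner. -/
noncomputable def coveredWinValue : View Θ i → ℝ :=
  (winSet i d).indicator fun z => E.coveredCall i z.1.1.1 z.1.2 - (d.claimAt z.1).toReal

/-- The amount by which the value exceeds the covered call value. -/
noncomputable def excess (z : View Θ i) : ℝ := z.1.2 - E.coveredCall i z.1.1.1 z.1.2

theorem excess_nonneg (z : View Θ i) : 0 ≤ E.excess i z := by
  have := E.coveredCall_le i z.1.1.1 z.1.2
  unfold excess; linarith

theorem measurable_claim_toReal : Measurable fun z : View Θ i => (d.claimAt z.1).toReal :=
  (d.claimAt_measurable.comp measurable_fst).ereal_toReal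

theorem measurable_coveredCall_view :
    Measurable fun z : View Θ i => E.coveredCall i z.1.1.1 z.1.2 :=
  (E.measurable_coveredCall i).comp (f := fun z : View Θ i => (z.1.1.1, z.1.2)) (by fun_prop)

theorem measurable_excess : Measurable (E.excess i) := by
  unfold excess
  exact (by fun_prop : Measurable fun z : View Θ i => z.1.2).sub (E.measurable_coveredCall_view i)

theorem measurable_winValue : Measurable (winValue i d) :=
  ((by fun_prop : Measurable fun z : View Θ i => z.1.2).sub
    (measurable_claim_toReal i d)).indicator (measurableSet_winSet i d)

theorem measurable_coveredWinValue : Measurable (E.coveredWinValue i d) :=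
  ((E.measurable_coveredCall_view i).sub
    (measurable_claim_toReal i d)).indicator (measurableSet_winSet i d)

theorem measurable_costPaid : Measurable (E.costPaid i d) := by
  refine Measurable.indicator ?_ (measurableSet_inspectSet i d)
  exact (E.cost_measurable i).coe_nnreal_real.comp (f := fun z : View Θ i => z.1.1.1) (by fun_prop)

theorem claimAt_toReal_nonneg (y : (Θ i × I) × ℝ) : 0 ≤ (d.claimAt y).toReal := by
  rcases d.claimAt_range y.1 y.2 with h | h
  · simp [h]
  · exact EReal.toReal_nonneg h

theorem winValue_le (z : View Θ i) : winValue i d z ≤ max z.1.2 0 := by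
  unfold winValue
  by_cases h : z ∈ winSet i d
  · rw [Set.indicator_of_mem h]
    have := claimAt_toReal_nonneg i d z.1
    exact le_max_of_le_left (by linarith)
  · rw [Set.indicator_of_notMem h]; exact le_max_right _ _

theorem costPaid_nonneg (z : View Θ i) : 0 ≤ E.costPaid i d z :=
  Set.indicator_nonneg (fun _ _ => NNReal.coe_nonneg _) z

theorem wins_update_iff (s : Profile Θ) (ω : Sample Θ) :
    Wins (Function.update s i d) ω i ↔ (privateInfo i ω, claimsOrder s ω) ∈ winSet i d := by
  unfold Wins
  rw [claims_apply, Function.update_self]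
  refine reaches_congr fun j hj => ?_
  simp [claims, claimsOrder, hj]

theorem inspects_update_iff (s : Profile Θ) (ω : Sample Θ) :
    Inspects (Function.update s i d) ω i ↔
      (privateInfo i ω, claimsOrder s ω) ∈ inspectSet i d := by
  unfold Inspects
  rw [Function.update_self]
  refine reaches_congr fun j hj => ?_
  simp [claims, claimsOrder, hj]

/-- The rivals' claims are not affected by the deviation, so the deviator's utility is a function of
her view in the profile `s`. All deviations can thus be compared under the single law `viewLaw`. -/
theorem utility_update (s : Profile Θ) (ω : Sample Θ) :
    E.utility (Function.update s i d) ω i = winValue i d (privateInfo i ω, claimsOrder s ω)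
      - E.costPaid i d (privateInfo i ω, claimsOrder s ω) := by
  have hW := wins_update_iff i d s ω
  have hI := inspects_update_iff i d s ω
  have hc : claims (Function.update s i d) ω i = d.claimAt (privateInfo i ω) := by
    rw [claims_apply, Function.update_self]
  unfold utility payment
  rw [hc]
  by_cases h1 : (privateInfo i ω, claimsOrder s ω) ∈ winSet i d <;>
  by_cases h2 : (privateInfo i ω, claimsOrder s ω) ∈ inspectSet i d
  <;> [rw [if_pos (hW.2 h1), if_pos (hI.2 h2), if_pos (hW.2 h1)];
   rw [if_pos (hW.2 h1), if_neg (hI.not.2 h2), if_pos (hW.2 h1)];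
   rw [if_neg (hW.not.2 h1), if_pos (hI.2 h2), if_neg (hW.not.2 h1)];
   rw [if_neg (hW.not.2 h1), if_neg (hI.not.2 h2), if_neg (hW.not.2 h1)]]
  <;> simp [winValue, costPaid, h1, h2]
  · simp only [privateInfo]
    ring
  · rfl
  · rfl

/-- Her own entry among the planned claims is irrelevant for whether she gets to act. This and its
companions provide the invariance that `lintegral_law_eq` asks for. -/
theorem winSet_update_iff (y : (Θ i × I) × ℝ) (a : Fin n → EReal) (π : Equiv.Perm (Fin n))
    (x : EReal) : (y, (Function.update a i x, π)) ∈ winSet i d ↔ (y, (a, π)) ∈ winSet i d :=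
  reaches_update

theorem inspectSet_update_iff (y : (Θ i × I) × ℝ) (a : Fin n → EReal) (π : Equiv.Perm (Fin n))
    (x : EReal) : (y, (Function.update a i x, π)) ∈ inspectSet i d ↔ (y, (a, π)) ∈ inspectSet i d :=
  reaches_update

theorem winValue_update (y : (Θ i × I) × ℝ) (a : Fin n → EReal) (π : Equiv.Perm (Fin n))
    (x : EReal) : winValue i d (y, (Function.update a i x, π)) = winValue i d (y, (a, π)) := by
  have h := winSet_update_iff i d y a π x
  by_cases hz : (y, (a, π)) ∈ winSet i d
  · simp [winValue, h, hz]
  · simp [winValue, h, hz]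

theorem costPaid_update (y : (Θ i × I) × ℝ) (a : Fin n → EReal) (π : Equiv.Perm (Fin n))
    (x : EReal) : E.costPaid i d (y, (Function.update a i x, π)) = E.costPaid i d (y, (a, π)) := by
  have h := inspectSet_update_iff i d y a π x
  by_cases hz : (y, (a, π)) ∈ inspectSet i d
  · simp [costPaid, h, hz]
  · simp [costPaid, h, hz]

variable (ρ : Measure (Equiv.Perm (Fin n))) [IsProbabilityMeasure ρ] (s : Profile Θ)

/-- The law of the view of bidder `i`, with her own claim redrawn. -/
noncomputable def viewLaw : Measure (View Θ i) :=
  E.interimLaw i ⊗ₘ (E.rivalKernel ρ s i).comap (fun y : (Θ i × I) × ℝ => y.1.1) (by fun_prop)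

theorem lintegral_viewLaw {g : View Θ i → ℝ≥0∞} (hg : Measurable g) :
    ∫⁻ z, g z ∂(E.viewLaw i ρ s) =
      ∫⁻ y, ∫⁻ q, g (y, q) ∂(E.rivalKernel ρ s i y.1.1) ∂(E.interimLaw i) := by
  unfold viewLaw
  rw [Measure.lintegral_compProd hg]
  rfl

theorem lintegral_law_eq_viewLaw {g : View Θ i → ℝ≥0∞} (hg : Measurable g)
    (hgi : ∀ y a π x, g (y, (Function.update a i x, π)) = g (y, (a, π))) :
    ∫⁻ ω, g (privateInfo i ω, claimsOrder s ω) ∂(E.law ρ) = ∫⁻ z, g z ∂(E.viewLaw i ρ s) := by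
  rw [lintegral_law_eq E ρ s i hg hgi, lintegral_viewLaw E i ρ s hg]

theorem expUtility_update : E.expUtility ρ (Function.update s i d) i =
    ((∫⁻ z, ENNReal.ofReal (winValue i d z - E.costPaid i d z) ∂(E.viewLaw i ρ s) : ℝ≥0∞) : EReal)
    - ((∫⁻ z, ENNReal.ofReal (-(winValue i d z - E.costPaid i d z)) ∂(E.viewLaw i ρ s) : ℝ≥0∞)
      : EReal) := by
  have hm := (measurable_winValue i d).sub (E.measurable_costPaid i d)
  unfold expUtility
  simp only [utility_update]
  rw [lintegral_law_eq_viewLaw E i ρ s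
      (g := fun z => ENNReal.ofReal (winValue i d z - E.costPaid i d z)) hm.ennreal_ofReal
      (fun y a π x => by rw [winValue_update, costPaid_update]),
    lintegral_law_eq_viewLaw E i ρ s
      (g := fun z => ENNReal.ofReal (-(winValue i d z - E.costPaid i d z)))
      hm.neg.ennreal_ofReal (fun y a π x => by rw [winValue_update, costPaid_update])]

/-- The interim expected gain of the claim of strategy `d`. -/
noncomputable def stratGain (y : (Θ i × I) × ℝ) : ℝ :=
  E.gain ρ s i y.1.1 (d.claimAt y) (E.coveredCall i y.1.1 y.2)

theorem measurable_stratGain : Measurable (E.stratGain i d ρ s) := by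
  unfold stratGain
  refine (E.measurable_gain ρ s i).comp (f := fun y : (Θ i × I) × ℝ =>
    ((y.1.1, d.claimAt y), E.coveredCall i y.1.1 y.2)) ?_
  exact ((by fun_prop : Measurable fun y : (Θ i × I) × ℝ => y.1.1).prodMk
    d.claimAt_measurable).prodMk ((E.measurable_coveredCall i).comp
      (f := fun y : (Θ i × I) × ℝ => (y.1.1, y.2)) (by fun_prop))

theorem integral_coveredWinValue_section (y : (Θ i × I) × ℝ) :
    ∫ q, E.coveredWinValue i d (y, q) ∂(E.rivalKernel ρ s i y.1.1) = E.stratGain i d ρ s y := by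
  have : ∀ q, E.coveredWinValue i d (y, q) =
      {q : (Fin n → EReal) × Equiv.Perm (Fin n) | Reaches q.1 q.2 i (d.claimAt y)}.indicator
        (fun _ => E.coveredCall i y.1.1 y.2 - (d.claimAt y).toReal) q := fun q => rfl
  simp only [this]
  rw [integral_indicator_const _ (measurableSet_reaches_section i _)]
  rfl

/-- Given the private information, the covered win value is constant on the winning event and zero
elsewhere. Averaging over the rivals' claims therefore involves no cancellation, and the integrals
of the absolute values agree. -/
theorem integrable_coveredWinValue_iff :
    Integrable (E.coveredWinValue i d) (E.viewLaw i ρ s) ↔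
      Integrable (E.stratGain i d ρ s) (E.interimLaw i) := by
  have hm := E.measurable_coveredWinValue i d
  have key : ∫⁻ z, ‖E.coveredWinValue i d z‖ₑ ∂(E.viewLaw i ρ s) =
      ∫⁻ y, ‖E.stratGain i d ρ s y‖ₑ ∂(E.interimLaw i) := by
    rw [lintegral_viewLaw E i ρ s hm.enorm]
    refine lintegral_congr fun y => ?_
    have : ∀ q, ‖E.coveredWinValue i d (y, q)‖ₑ =
        {q : (Fin n → EReal) × Equiv.Perm (Fin n) | Reaches q.1 q.2 i (d.claimAt y)}.indicator
          (fun _ => ‖E.coveredCall i y.1.1 y.2 - (d.claimAt y).toReal‖ₑ) q := fun q =>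
      enorm_indicator_eq_indicator_enorm _ _
    simp only [this]
    rw [lintegral_indicator_const (measurableSet_reaches_section i _), ← ofReal_reachProb]
    unfold stratGain gain
    rw [enorm_mul, Real.enorm_of_nonneg (E.reachProb_nonneg ρ s i _ _), mul_comm]
  constructor
  · refine fun h => ⟨(E.measurable_stratGain i d ρ s).aestronglyMeasurable, ?_⟩
    unfold HasFiniteIntegral
    rw [← key]
    exact h.2
  · refine fun h => ⟨hm.aestronglyMeasurable, ?_⟩
    unfold HasFiniteIntegral
    rw [key]
    exact h.2

theorem integral_coveredWinValue (h : Integrable (E.coveredWinValue i d) (E.viewLaw i ρ s)) :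
    ∫ z, E.coveredWinValue i d z ∂(E.viewLaw i ρ s) =
      ∫ y, E.stratGain i d ρ s y ∂(E.interimLaw i) := by
  unfold viewLaw at h ⊢
  rw [Measure.integral_compProd h]
  exact integral_congr_ae (Filter.Eventually.of_forall fun y =>
    E.integral_coveredWinValue_section i d ρ s y)

/-- The value of bidder `i` has a finite expected positive part. -/
def FiniteValue : Prop := ∫⁻ y, ENNReal.ofReal y.2 ∂(E.interimLaw i) ≠ ∞

variable {E i} (hfin : E.FiniteValue i)
include hfin

theorem FiniteValue.integrable_max :
    Integrable (fun z : View Θ i => max z.1.2 0) (E.viewLaw i ρ s) := by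
  refine ⟨Measurable.aestronglyMeasurable (by fun_prop), ?_⟩
  unfold HasFiniteIntegral
  rw [lintegral_viewLaw E i ρ s (by fun_prop)]
  refine lt_of_eq_of_lt ?_ (lt_top_iff_ne_top.2 hfin)
  refine lintegral_congr fun y => ?_
  simp only [lintegral_const, measure_univ, mul_one]
  rw [← ofReal_norm, Real.norm_of_nonneg (le_max_right _ _)]
  simp

theorem FiniteValue.ae_type :
    ∀ᵐ t ∂(E.prior.map fun θ => θ i), ∫⁻ v, ENNReal.ofReal v ∂(E.value i t) < ∞ := by
  unfold FiniteValue at hfin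
  rw [lintegral_interimLaw E i (by fun_prop)] at hfin
  simp only [lintegral_const, measure_univ, mul_one] at hfin
  exact ae_lt_top (by fun_prop) hfin

theorem FiniteValue.ae_interimLaw :
    ∀ᵐ y ∂(E.interimLaw i), ∫⁻ v, ENNReal.ofReal v ∂(E.value i y.1.1) < ∞ := by
  have h1 : (E.interimLaw i).map (fun y => y.1.1) = E.prior.map fun θ => θ i := by
    unfold interimLaw
    have h2 := Measure.fst_compProd ((E.prior.map fun θ => θ i).prod (volume : Measure I))
      (Kernel.prodMkRight I (E.value i))
    have h3 : ((E.prior.map fun θ => θ i).prod (volume : Measure I)).map Prod.fst =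
      E.prior.map fun θ => θ i := Measure.fst_prod
    rw [Measure.fst] at h2
    rw [show (fun y : (Θ i × I) × ℝ => y.1.1) = Prod.fst ∘ Prod.fst from rfl,
      ← Measure.map_map measurable_fst measurable_fst, h2, h3]
  have h4 := hfin.ae_type
  rw [← h1] at h4
  exact ae_of_ae_map (f := fun y : (Θ i × I) × ℝ => y.1.1) (by fun_prop) h4

/-- The expected inspection cost equals the expected excess of the value over the covered call
value on the event of inspection. -/
theorem FiniteValue.lintegral_costPaid :
    ∫⁻ z, ENNReal.ofReal (E.costPaid i d z) ∂(E.viewLaw i ρ s) =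
      ∫⁻ z, ENNReal.ofReal ((inspectSet i d).indicator (E.excess i) z) ∂(E.viewLaw i ρ s) := by
  have hm1 := (E.measurable_costPaid i d).ennreal_ofReal
  have hm2 := ((E.measurable_excess i).indicator (measurableSet_inspectSet i d)).ennreal_ofReal
  -- The inspection event involves the type, the random number and the rivals' claims, but not the
  -- value. The integral over it therefore factors, given type and random number, into the
  -- probability of inspecting and the conditional mean of `f`. This is applied to the cost and to
  -- the excess, whose conditional means coincide.
  have aux : ∀ (f : (Θ i × I) × ℝ → ℝ), Measurable f →
      ∫⁻ z, ENNReal.ofReal ((inspectSet i d).indicator (fun z => f z.1) z) ∂(E.viewLaw i ρ s) =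
      ∫⁻ t, ∫⁻ r, ENNReal.ofReal (E.reachProb ρ s i t (d.inspectAt (t, r))) *
        ∫⁻ v, ENNReal.ofReal (f ((t, r), v)) ∂(E.value i t) ∂(volume : Measure I)
        ∂(E.prior.map fun θ => θ i) := by
    intro f hf
    have hR : Measurable fun y : (Θ i × I) × ℝ =>
        ENNReal.ofReal (E.reachProb ρ s i y.1.1 (d.inspectAt y.1)) :=
      ((E.measurable_reachProb ρ s i).comp (f := fun y : (Θ i × I) × ℝ =>
        (y.1.1, d.inspectAt y.1)) ((by fun_prop : Measurable fun y : (Θ i × I) × ℝ => y.1.1).prodMk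
          (d.inspectAt_measurable.comp measurable_fst))).ennreal_ofReal
    rw [lintegral_viewLaw E i ρ s
      (g := fun z => ENNReal.ofReal ((inspectSet i d).indicator (fun z => f z.1) z))
      ((hf.comp measurable_fst).indicator (measurableSet_inspectSet i d)).ennreal_ofReal]
    have : ∀ y : (Θ i × I) × ℝ, ∫⁻ q, ENNReal.ofReal ((inspectSet i d).indicator
        (fun z => f z.1) (y, q)) ∂(E.rivalKernel ρ s i y.1.1) =
        ENNReal.ofReal (E.reachProb ρ s i y.1.1 (d.inspectAt y.1)) * ENNReal.ofReal (f y) := by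
      intro y
      have h1 : ∀ q, ENNReal.ofReal ((inspectSet i d).indicator (fun z => f z.1) (y, q)) =
          {q : (Fin n → EReal) × Equiv.Perm (Fin n) | Reaches q.1 q.2 i (d.inspectAt y.1)}.indicator
            (fun _ => ENNReal.ofReal (f y)) q := by
        intro q
        by_cases hq : Reaches q.1 q.2 i (d.inspectAt y.1)
        · rw [Set.indicator_of_mem (by exact hq), Set.indicator_of_mem (by exact hq)]
        · rw [Set.indicator_of_notMem (by exact hq), Set.indicator_of_notMem (by exact hq)]
          simp
      simp only [h1]
      rw [lintegral_indicator_const (measurableSet_reaches_section i _), ← ofReal_reachProb,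
        mul_comm]
    simp only [this]
    rw [lintegral_interimLaw E i (f := fun y => ENNReal.ofReal
      (E.reachProb ρ s i y.1.1 (d.inspectAt y.1)) * ENNReal.ofReal (f y))
      (hR.mul hf.ennreal_ofReal)]
    refine lintegral_congr fun t => lintegral_congr fun r => ?_
    exact lintegral_const_mul (ENNReal.ofReal (E.reachProb ρ s i t (d.inspectAt (t, r))))
      (f := fun v => ENNReal.ofReal (f ((t, r), v)))
      (by fun_prop)
  have hc : Measurable fun y : (Θ i × I) × ℝ => (E.cost i y.1.1 : ℝ) :=
    (E.cost_measurable i).coe_nnreal_real.comp (by fun_prop)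
  have he : Measurable fun y : (Θ i × I) × ℝ => y.2 - E.coveredCall i y.1.1 y.2 :=
    measurable_snd.sub ((E.measurable_coveredCall i).comp
      (f := fun y : (Θ i × I) × ℝ => (y.1.1, y.2)) (by fun_prop))
  refine (aux _ hc).trans (Eq.trans ?_ (aux _ he).symm)
  refine lintegral_congr_ae ?_
  filter_upwards [hfin.ae_type] with t ht
  refine lintegral_congr fun r => ?_
  rw [E.lintegral_sub_coveredCall i ht]
  simp

/-- The loss from inspecting an item of a value above the strike price without obtaining it. -/
theorem FiniteValue.integral_utility
    (hu : Integrable (fun z => winValue i d z - E.costPaid i d z) (E.viewLaw i ρ s)) :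
    Integrable (E.coveredWinValue i d) (E.viewLaw i ρ s) ∧
    Integrable ((inspectSet i d \ winSet i d).indicator (E.excess i)) (E.viewLaw i ρ s) ∧
    ∫ z, (winValue i d z - E.costPaid i d z) ∂(E.viewLaw i ρ s) =
      ∫ z, E.coveredWinValue i d z ∂(E.viewLaw i ρ s) -
      ∫ z, (inspectSet i d \ winSet i d).indicator (E.excess i) z ∂(E.viewLaw i ρ s) := by
  have hmax := hfin.integrable_max ρ s
  have hmN := (E.measurable_excess i).indicator (measurableSet_inspectSet i d)
  have hmW := (E.measurable_excess i).indicator (measurableSet_winSet i d)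
  have hN0 : ∀ z, 0 ≤ (inspectSet i d).indicator (E.excess i) z :=
    fun z => Set.indicator_nonneg (fun z _ => E.excess_nonneg i z) z
  have hW0 : ∀ z, 0 ≤ (winSet i d).indicator (E.excess i) z :=
    fun z => Set.indicator_nonneg (fun z _ => E.excess_nonneg i z) z
  -- The cost is the win value minus the utility, hence at most `v⁺` plus the absolute utility.
  have hc : Integrable (E.costPaid i d) (E.viewLaw i ρ s) := by
    refine (hmax.add hu.norm).mono' (E.measurable_costPaid i d).aestronglyMeasurable
      (Filter.Eventually.of_forall fun z => ?_)
    rw [Real.norm_of_nonneg (E.costPaid_nonneg i d z)]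
    have h1 := winValue_le i d z
    have h2 := neg_abs_le (winValue i d z - E.costPaid i d z)
    simp only [Pi.add_apply, Real.norm_eq_abs]
    linarith
  have hw : Integrable (winValue i d) (E.viewLaw i ρ s) := by
    refine (hu.add hc).congr (Filter.Eventually.of_forall fun z => ?_)
    simp
  have hNe : Integrable ((inspectSet i d).indicator (E.excess i)) (E.viewLaw i ρ s) := by
    refine (lintegral_ofReal_ne_top_iff_integrable hmN.aestronglyMeasurable
      (Filter.Eventually.of_forall hN0)).1 ?_
    rw [← hfin.lintegral_costPaid d ρ s]
    exact hc.lintegral_lt_top.ne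
  have hWe : Integrable ((winSet i d).indicator (E.excess i)) (E.viewLaw i ρ s) := by
    refine hNe.mono' hmW.aestronglyMeasurable (Filter.Eventually.of_forall fun z => ?_)
    rw [Real.norm_of_nonneg (hW0 z)]
    exact Set.indicator_le_indicator_of_subset (winSet_subset_inspectSet i d)
      (fun z => E.excess_nonneg i z) z
  have heq : ∫ z, E.costPaid i d z ∂(E.viewLaw i ρ s) =
      ∫ z, (inspectSet i d).indicator (E.excess i) z ∂(E.viewLaw i ρ s) := by
    rw [integral_eq_lintegral_of_nonneg_ae (Filter.Eventually.of_forall (E.costPaid_nonneg i d))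
        (E.measurable_costPaid i d).aestronglyMeasurable,
      integral_eq_lintegral_of_nonneg_ae (Filter.Eventually.of_forall hN0)
        hmN.aestronglyMeasurable, hfin.lintegral_costPaid d ρ s]
  -- Once the expected cost is replaced by the expected excess on the inspection event, the part of
  -- it on the winning event turns values into covered call values, and the rest is the exposure
  -- term.
  have h1 : E.coveredWinValue i d =
      fun z => winValue i d z - (winSet i d).indicator (E.excess i) z := by
    funext z
    unfold coveredWinValue winValue Set.indicator excess
    split_ifs <;> ring
  have h2 : (inspectSet i d \ winSet i d).indicator (E.excess i) =
      fun z => (inspectSet i d).indicator (E.excess i) z -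
        (winSet i d).indicator (E.excess i) z := by
    rw [Set.indicator_sdiff (winSet_subset_inspectSet i d)]
    rfl
  rw [h1, h2]
  refine ⟨hw.sub hWe, hNe.sub hWe, ?_⟩
  rw [integral_sub hw hc, integral_sub hw hWe, integral_sub hNe hWe, heq]
  ring

/-- On the winning event the excess is at most `v⁺` plus the absolute covered win value. Without
exposure this is almost everywhere all the excess at inspections, and the latter has the same
integral as the cost. -/
theorem FiniteValue.integrable_utility
    (hx : ∀ᵐ z ∂(E.viewLaw i ρ s), (inspectSet i d \ winSet i d).indicator (E.excess i) z = 0)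
    (hw : Integrable (E.coveredWinValue i d) (E.viewLaw i ρ s)) :
    Integrable (fun z => winValue i d z - E.costPaid i d z) (E.viewLaw i ρ s) := by
  have hmax := hfin.integrable_max ρ s
  have hmN := (E.measurable_excess i).indicator (measurableSet_inspectSet i d)
  have hmW := (E.measurable_excess i).indicator (measurableSet_winSet i d)
  have hW0 : ∀ z, 0 ≤ (winSet i d).indicator (E.excess i) z :=
    fun z => Set.indicator_nonneg (fun z _ => E.excess_nonneg i z) z
  have h1 : winValue i d =
      fun z => E.coveredWinValue i d z + (winSet i d).indicator (E.excess i) z := by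
    funext z
    unfold coveredWinValue winValue Set.indicator excess
    split_ifs <;> ring
  have hWe : Integrable ((winSet i d).indicator (E.excess i)) (E.viewLaw i ρ s) := by
    refine (hmax.add hw.norm).mono' hmW.aestronglyMeasurable
      (Filter.Eventually.of_forall fun z => ?_)
    rw [Real.norm_of_nonneg (hW0 z)]
    have h2 := winValue_le i d z
    rw [h1] at h2
    have h3 := neg_abs_le (E.coveredWinValue i d z)
    simp only [Pi.add_apply, Real.norm_eq_abs] at h2 ⊢
    linarith
  have hNe : Integrable ((inspectSet i d).indicator (E.excess i)) (E.viewLaw i ρ s) := by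
    refine hWe.congr ?_
    filter_upwards [hx] with z hz
    rw [Set.indicator_sdiff (winSet_subset_inspectSet i d), Pi.sub_apply] at hz
    linarith
  have hc : Integrable (E.costPaid i d) (E.viewLaw i ρ s) := by
    refine (lintegral_ofReal_ne_top_iff_integrable
      (E.measurable_costPaid i d).aestronglyMeasurable
      (Filter.Eventually.of_forall (E.costPaid_nonneg i d))).1 ?_
    rw [hfin.lintegral_costPaid d ρ s]
    exact hNe.lintegral_lt_top.ne
  rw [h1]
  exact (hw.add hWe).sub hc

theorem FiniteValue.lintegral_utility_ne_top :
    ∫⁻ z, ENNReal.ofReal (winValue i d z - E.costPaid i d z) ∂(E.viewLaw i ρ s) ≠ ∞ := by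
  refine ne_top_of_le_ne_top (hfin.integrable_max ρ s).lintegral_lt_top.ne
    (lintegral_mono fun z => ENNReal.ofReal_le_ofReal ?_)
  have := winValue_le i d z
  have := E.costPaid_nonneg i d z
  linarith

end deviations

end Environment

namespace Environment

variable {n : ℕ} {Θ : Fin n → Type*} [∀ i, MeasurableSpace (Θ i)]

/-! ### Equilibria and interim optimality -/

section equilibrium

variable (E : Environment Θ) (ρ : Measure (Equiv.Perm (Fin n))) [IsProbabilityMeasure ρ]
  (s : Profile Θ) (i : Fin n)

/-- The claims of bidder `i` are optimal given her type and her covered call value. -/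
def InterimOptimal : Prop :=
  ∀ᵐ y ∂(E.interimLaw i), 0 ≤ E.stratGain i (s i) ρ s y ∧ ∀ q : ℚ≥0,
    E.gain ρ s i y.1.1 (((q : ℚ) : ℝ) : EReal) (E.coveredCall i y.1.1 y.2) ≤
      E.stratGain i (s i) ρ s y

/-- After an inspection, bidder `i` obtains the item if its value exceeds the strike price. -/
def Unexposed (d : DutchStrategy (Θ i)) : Prop :=
  ∀ᵐ z ∂(E.viewLaw i ρ s), (inspectSet i d \ winSet i d).indicator (E.excess i) z = 0

variable {s i}

/-- Raising a claim slightly to a rational price does not lower the probability of being reached and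
costs arbitrarily little. Countably many prices therefore suffice to express optimality, which makes
it a measurable almost everywhere condition. -/
theorem gain_le_of_forall_rat {t : Θ i} {k M : ℝ} (hM : 0 ≤ M)
    (h : ∀ q : ℚ≥0, E.gain ρ s i t (((q : ℚ) : ℝ) : EReal) k ≤ M) {x : EReal}
    (hx : x = ⊥ ∨ 0 ≤ x) (hx' : x ≠ ⊤) : E.gain ρ s i t x k ≤ M := by
  rcases hx with rfl | hx
  · simpa using hM
  lift x to ℝ using ⟨hx', (EReal.bot_lt_zero.trans_le hx).ne'⟩
  have hx0 : 0 ≤ x := by exact_mod_cast hx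
  have hp := E.reachProb_nonneg ρ s i t x
  have hg : E.gain ρ s i t x k = E.reachProb ρ s i t x * (k - x) := by simp [gain]
  by_contra! hlt
  rw [hg] at hlt
  set p := E.reachProb ρ s i t x with hpdef
  have hp0 : 0 < p := by
    rcases hp.lt_or_eq with h0 | h0
    · exact h0
    · rw [← h0, zero_mul] at hlt; exact absurd hlt (not_lt.2 hM)
  -- At the probability `p`, a price earns more than `M` exactly when it is below `k - M / p`, which
  -- leaves room for a rational price above `x`.
  have h1 : x < k - M / p := by
    have : M / p < k - x := by rw [div_lt_iff₀ hp0]; linarith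
    linarith
  obtain ⟨q, hq1, hq2⟩ := exists_rat_btwn h1
  have hq0 : (0 : ℝ) ≤ q := hx0.trans hq1.le
  lift q to ℚ≥0 using (by exact_mod_cast hq0)
  have h2 := h q
  have h3 : p ≤ E.reachProb ρ s i t (((q : ℚ) : ℝ) : EReal) :=
    E.reachProb_mono ρ s i t (EReal.coe_le_coe_iff.2 hq1.le)
  have h4 : E.gain ρ s i t (((q : ℚ) : ℝ) : EReal) k =
      E.reachProb ρ s i t (((q : ℚ) : ℝ) : EReal) * (k - (q : ℚ)) := by simp [gain]
  rw [h4] at h2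
  have h5 : M / p < k - (q : ℚ) := by linarith
  rw [div_lt_iff₀ hp0] at h5
  have h6 : 0 ≤ k - (q : ℚ) := by
    by_contra! hneg
    nlinarith
  nlinarith [mul_le_mul_of_nonneg_right h3 h6]

theorem gain_le_max {t : Θ i} {x : EReal} (hx : x = ⊥ ∨ 0 ≤ x) (k : ℝ) :
    E.gain ρ s i t x k ≤ max k 0 := by
  have hp := E.reachProb_nonneg ρ s i t x
  have hp1 := E.reachProb_le_one ρ s i t x
  have hx0 : 0 ≤ x.toReal := by
    rcases hx with rfl | hx
    · simp
    · exact EReal.toReal_nonneg hx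
  have h0 : (0 : ℝ) ≤ max k 0 := le_max_right _ _
  calc E.gain ρ s i t x k ≤ E.reachProb ρ s i t x * max k 0 :=
        mul_le_mul_of_nonneg_left ((sub_le_self _ hx0).trans (le_max_left _ _)) hp
    _ ≤ max k 0 := mul_le_of_le_one_left h0 hp1

variable (s i) in
/-- Claims of a bidder with a higher covered call value win at least as often. -/
theorem reachProb_le_of_optimal {t : Θ i} {x z : EReal} {k l : ℝ} (hkl : k < l)
    (hx : E.gain ρ s i t z k ≤ E.gain ρ s i t x k) (hz : E.gain ρ s i t x l ≤ E.gain ρ s i t z l) :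
    E.reachProb ρ s i t x ≤ E.reachProb ρ s i t z := by
  unfold gain at hx hz
  -- In the sum of the two inequalities the payments cancel, leaving `(p x - p z) * (l - k) ≤ 0` for
  -- the reach probabilities `p`.
  by_contra! h
  nlinarith

variable (s i) in
-- The claim `z` of the higher value `l` is reached at least as often as `x` by optimality, and at
-- most as often because `z ≤ x`. At equal probabilities the lower price is no worse for `k`. This
-- justifies cutting off claims at the clock value of inspection.
theorem gain_eq_of_le {t : Θ i} {x z : EReal} (hz : z = ⊥ ∨ 0 ≤ z)
    (hx' : x ≠ ⊤) {k l : ℝ} (hkl : k ≤ l) (hzx : z ≤ x)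
    (hxo : E.gain ρ s i t z k ≤ E.gain ρ s i t x k)
    (hzo : E.gain ρ s i t x l ≤ E.gain ρ s i t z l) :
    E.gain ρ s i t z k = E.gain ρ s i t x k := by
  rcases hkl.lt_or_eq with hlt | rfl
  · have h1 := E.reachProb_le_of_optimal ρ s i hlt hxo hzo
    have h2 := E.reachProb_mono ρ s i t hzx
    have h3 : E.reachProb ρ s i t z = E.reachProb ρ s i t x := le_antisymm h2 h1
    refine le_antisymm hxo ?_
    unfold gain
    rw [h3]
    rcases hz with rfl | hz
    · rw [reachProb_bot] at h3
      rw [← h3]; simp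
    · refine mul_le_mul_of_nonneg_left ?_ (E.reachProb_nonneg ρ s i t x)
      have := EReal.toReal_le_toReal hzx (EReal.bot_lt_zero.trans_le hz).ne' hx'
      linarith
  · exact le_antisymm hxo hzo

/-- An enumeration of the nonnegative rational prices. -/
noncomputable def rationalPrice : ℕ → ℚ≥0 := Classical.choose (exists_surjective_nat ℚ≥0)

theorem rationalPrice_surjective : Function.Surjective rationalPrice :=
  Classical.choose_spec (exists_surjective_nat ℚ≥0)

variable (s i)

open Classical in
/-- An optimal claim among "never" and the first `m` rational prices. -/
noncomputable def menuBid : ℕ → Θ i × ℝ → EReal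
  | 0, _ => ⊥
  | m + 1, y =>
    if E.gain ρ s i y.1 (menuBid m y) y.2 <
      E.gain ρ s i y.1 (((rationalPrice m : ℚ) : ℝ) : EReal) y.2
    then (((rationalPrice m : ℚ) : ℝ) : EReal) else menuBid m y

theorem measurable_menuBid (m : ℕ) : Measurable (E.menuBid ρ s i m) := by
  induction m with
  | zero => exact measurable_const
  | succ m ih =>
    have h := E.measurable_gain ρ s i
    refine Measurable.ite (measurableSet_lt ?_ ?_) measurable_const ih
    · exact h.comp (f := fun y : Θ i × ℝ => ((y.1, E.menuBid ρ s i m y), y.2)) (by fun_prop)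
    · exact h.comp (f := fun y : Θ i × ℝ =>
        ((y.1, (((rationalPrice m : ℚ) : ℝ) : EReal)), y.2)) (by fun_prop)

theorem menuBid_range (m : ℕ) (y : Θ i × ℝ) :
    (E.menuBid ρ s i m y = ⊥ ∨ 0 ≤ E.menuBid ρ s i m y) ∧ E.menuBid ρ s i m y ≠ ⊤ := by
  induction m with
  | zero => exact ⟨Or.inl rfl, bot_ne_top⟩
  | succ m ih =>
    unfold menuBid
    split_ifs
    · exact ⟨Or.inr (EReal.coe_nonneg.2 (by exact_mod_cast (rationalPrice m).2)), EReal.coe_ne_top _⟩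
    · exact ih

theorem gain_menuBid_succ (m : ℕ) (t : Θ i) (k : ℝ) :
    E.gain ρ s i t (E.menuBid ρ s i (m + 1) (t, k)) k =
      max (E.gain ρ s i t (E.menuBid ρ s i m (t, k)) k)
        (E.gain ρ s i t (((rationalPrice m : ℚ) : ℝ) : EReal) k) := by
  conv_lhs => unfold menuBid
  simp only
  split_ifs with h
  · exact (max_eq_right h.le).symm
  · exact (max_eq_left (not_lt.1 h)).symm

theorem gain_menuBid_monotone (t : Θ i) (k : ℝ) :
    Monotone fun m => E.gain ρ s i t (E.menuBid ρ s i m (t, k)) k :=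
  monotone_nat_of_le_succ fun m => by
    rw [gain_menuBid_succ]; exact le_max_left _ _

theorem gain_menuBid_nonneg (m : ℕ) (t : Θ i) (k : ℝ) :
    0 ≤ E.gain ρ s i t (E.menuBid ρ s i m (t, k)) k := by
  refine le_trans (le_of_eq ?_) (E.gain_menuBid_monotone ρ s i t k (Nat.zero_le m))
  simp [menuBid]

theorem gain_rationalPrice_le (m : ℕ) (t : Θ i) (k : ℝ) :
    E.gain ρ s i t (((rationalPrice m : ℚ) : ℝ) : EReal) k ≤
      E.gain ρ s i t (E.menuBid ρ s i (m + 1) (t, k)) k := by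
  rw [gain_menuBid_succ]; exact le_max_right _ _

/-- The claim made for `l` comes from the same finite menu from which the claim for `k` is chosen
optimally. -/
theorem gain_menuBid_le (m : ℕ) (t : Θ i) (k l : ℝ) :
    E.gain ρ s i t (E.menuBid ρ s i m (t, l)) k ≤
      E.gain ρ s i t (E.menuBid ρ s i m (t, k)) k := by
  induction m with
  | zero => exact le_rfl
  | succ m ih =>
    rw [gain_menuBid_succ]
    conv_lhs => unfold menuBid
    split_ifs
    · exact le_max_right _ _
    · exact ih.trans (le_max_left _ _)

open Classical in
/-- The clock value of inspection when claims are made from the menu of rational prices: the claim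
at the strike price. -/
noncomputable def menuInspect (m : ℕ) (x : Θ i × I) : EReal :=
  if E.cost i x.1 = 0 then ⊤ else E.menuBid ρ s i m (x.1, (E.strike i x.1).toReal)

theorem measurable_menuInspect (m : ℕ) : Measurable (E.menuInspect ρ s i m) := by
  refine Measurable.ite ?_ measurable_const ?_
  · exact (measurableSet_singleton (0 : ℝ≥0)).preimage
      ((E.cost_measurable i).comp measurable_fst)
  · exact (E.measurable_menuBid ρ s i m).comp (measurable_fst.prodMk
      ((E.measurable_strike i).comp measurable_fst).ereal_toReal)

theorem menuInspect_range (m : ℕ) (x : Θ i × I) :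
    E.menuInspect ρ s i m x = ⊥ ∨ 0 ≤ E.menuInspect ρ s i m x := by
  unfold menuInspect
  split_ifs
  · exact Or.inr le_top
  · exact (E.menuBid_range ρ s i m _).1

/-- The strategy that makes claims from the menu of rational prices. -/
noncomputable def menuStrategy (m : ℕ) : DutchStrategy (Θ i) where
  inspectAt := E.menuInspect ρ s i m
  -- The minimum ensures that no claim precedes the inspection; by `stratGain_menuStrategy` it is
  -- harmless.
  claimAt y := min (E.menuBid ρ s i m (y.1.1, E.coveredCall i y.1.1 y.2))
    (E.menuInspect ρ s i m y.1)
  inspectAt_measurable := E.measurable_menuInspect ρ s i m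
  claimAt_measurable := by
    refine Measurable.min ?_ ((E.measurable_menuInspect ρ s i m).comp measurable_fst)
    refine (E.measurable_menuBid ρ s i m).comp (Measurable.prodMk (by fun_prop) ?_)
    exact (E.measurable_coveredCall i).comp (f := fun y : (Θ i × I) × ℝ => (y.1.1, y.2))
      (by fun_prop)
  inspectAt_range := E.menuInspect_range ρ s i m
  claimAt_range x v := by
    rcases min_choice (E.menuBid ρ s i m (x.1, E.coveredCall i x.1 v))
      (E.menuInspect ρ s i m x) with h | h
    · simp only [h]; exact (E.menuBid_range ρ s i m _).1
    · simp only [h]; exact E.menuInspect_range ρ s i m x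
  claimAt_ne_top x v := ((min_le_left _ _).trans_lt
    (lt_top_iff_ne_top.2 (E.menuBid_range ρ s i m _).2)).ne
  claimAt_le x v := min_le_right _ _

variable {i}

/-- Covered call values never exceed the strike price, so `gain_eq_of_le` applies with the claim
made at the strike price in the role of `z`. -/
theorem stratGain_menuStrategy (m : ℕ) {y : (Θ i × I) × ℝ}
    (hv : ∫⁻ v, ENNReal.ofReal v ∂(E.value i y.1.1) < ∞) :
    E.stratGain i (E.menuStrategy ρ s i m) ρ s y =
      E.gain ρ s i y.1.1 (E.menuBid ρ s i m (y.1.1, E.coveredCall i y.1.1 y.2))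
        (E.coveredCall i y.1.1 y.2) := by
  unfold stratGain menuStrategy menuInspect
  simp only
  split_ifs with hc
  · rw [min_eq_left le_top]
  · obtain ⟨w, hw, -⟩ := E.exists_strike_eq_coe i (pos_iff_ne_zero.2 hc) hv
    rw [hw, EReal.toReal_coe]
    have hk : E.coveredCall i y.1.1 y.2 ≤ w := by
      rw [← EReal.coe_le_coe_iff, E.coe_coveredCall, hw]; exact min_le_left _ _
    rcases le_total (E.menuBid ρ s i m (y.1.1, E.coveredCall i y.1.1 y.2))
      (E.menuBid ρ s i m (y.1.1, w)) with h | h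
    · rw [min_eq_left h]
    · rw [min_eq_right h]
      exact E.gain_eq_of_le ρ s i (E.menuBid_range ρ s i m _).1
        (E.menuBid_range ρ s i m _).2 hk h (E.gain_menuBid_le ρ s i m _ _ _)
        (E.gain_menuBid_le ρ s i m _ _ _)

theorem excess_eq_zero_of_cost_eq_zero {z : View Θ i} (h : E.cost i z.1.1.1 = 0) :
    E.excess i z = 0 := by
  unfold excess; rw [E.coveredCall_of_cost_eq_zero i h, sub_self]

theorem map_fst_viewLaw : (E.viewLaw i ρ s).map Prod.fst = E.interimLaw i :=
  Measure.fst_compProd _ _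

variable {E}

/-- If the value exceeds the strike price, the covered call value is the strike price, so the claim
is made at the very clock value of inspection: whoever gets to inspect also wins. -/
theorem FiniteValue.unexposed_menuStrategy (hfin : E.FiniteValue i) (m : ℕ) :
    E.Unexposed ρ s i (E.menuStrategy ρ s i m) := by
  have h1 : ∀ᵐ z ∂(E.viewLaw i ρ s), ∫⁻ v, ENNReal.ofReal v ∂(E.value i z.1.1.1) < ∞ := by
    have := hfin.ae_interimLaw
    rw [← E.map_fst_viewLaw ρ s] at this
    exact ae_of_ae_map (f := Prod.fst) measurable_fst.aemeasurable this
  unfold Unexposed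
  filter_upwards [h1] with z hv
  by_cases hz : z ∈ inspectSet i (E.menuStrategy ρ s i m) \ winSet i (E.menuStrategy ρ s i m)
  · rw [Set.indicator_of_mem hz]
    by_cases hc : E.cost i z.1.1.1 = 0
    · exact E.excess_eq_zero_of_cost_eq_zero hc
    by_contra hne
    have hlt : E.coveredCall i z.1.1.1 z.1.2 < z.1.2 := by
      have h2 := E.excess_nonneg i z
      have h3 := lt_of_le_of_ne h2 (Ne.symm hne)
      unfold excess at h3
      linarith
    rw [coveredCall_lt_iff] at hlt
    refine hz.2 ?_
    have h4 : (E.menuStrategy ρ s i m).claimAt z.1 =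
        (E.menuStrategy ρ s i m).inspectAt z.1.1 := by
      have hk : E.coveredCall i z.1.1.1 z.1.2 = (E.strike i z.1.1.1).toReal := by
        unfold coveredCall; rw [min_eq_left hlt.le]
      unfold menuStrategy menuInspect
      simp only [if_neg hc, hk, min_self]
    unfold winSet
    simp only [Set.mem_ofPred_eq, h4]
    exact hz.1
  · rw [Set.indicator_of_notMem hz]

theorem FiniteValue.expUtility_update_of_unexposed (hfin : E.FiniteValue i)
    {d : DutchStrategy (Θ i)} (hd : E.Unexposed ρ s i d)
    (hg : Integrable (E.stratGain i d ρ s) (E.interimLaw i)) :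
    E.expUtility ρ (Function.update s i d) i =
      ((∫ y, E.stratGain i d ρ s y ∂(E.interimLaw i) : ℝ) : EReal) := by
  have hw := (E.integrable_coveredWinValue_iff i d ρ s).2 hg
  have hu := hfin.integrable_utility d ρ s hd hw
  rw [expUtility_update, lintegral_sub_lintegral_eq_integral hu,
    (hfin.integral_utility d ρ s hu).2.2, E.integral_coveredWinValue i d ρ s hw,
    integral_congr_ae hd]
  simp

theorem FiniteValue.expUtility_update_of_ne_bot (hfin : E.FiniteValue i)
    {d : DutchStrategy (Θ i)} (h : E.expUtility ρ (Function.update s i d) i ≠ ⊥) :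
    Integrable (E.stratGain i d ρ s) (E.interimLaw i) ∧
    Integrable ((inspectSet i d \ winSet i d).indicator (E.excess i)) (E.viewLaw i ρ s) ∧
    E.expUtility ρ (Function.update s i d) i =
      ((∫ y, E.stratGain i d ρ s y ∂(E.interimLaw i) -
        ∫ z, (inspectSet i d \ winSet i d).indicator (E.excess i) z ∂(E.viewLaw i ρ s) : ℝ)
          : EReal) := by
  rw [expUtility_update] at h ⊢
  have hu := integrable_of_lintegral_sub_lintegral_ne_bot
    (f := fun z => winValue i d z - E.costPaid i d z)
    ((measurable_winValue i d).sub (E.measurable_costPaid i d))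
    (hfin.lintegral_utility_ne_top d ρ s) h
  obtain ⟨h1, h2, h3⟩ := hfin.integral_utility d ρ s hu
  refine ⟨(E.integrable_coveredWinValue_iff i d ρ s).1 h1, h2, ?_⟩
  rw [lintegral_sub_lintegral_eq_integral hu, h3, E.integral_coveredWinValue i d ρ s h1]

theorem FiniteValue.integrable_interimLaw_max (hfin : E.FiniteValue i) :
    Integrable (fun y : (Θ i × I) × ℝ => max y.2 0) (E.interimLaw i) := by
  refine (lintegral_ofReal_ne_top_iff_integrable
    (Measurable.aestronglyMeasurable (by fun_prop))
    (Filter.Eventually.of_forall fun y => le_max_right _ _)).1 ?_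
  simpa [FiniteValue] using hfin

theorem FiniteValue.integrable_of_nonneg (hfin : E.FiniteValue i) {f : (Θ i × I) × ℝ → ℝ}
    (hm : Measurable f) (h0 : ∀ᵐ y ∂(E.interimLaw i), 0 ≤ f y)
    (h1 : ∀ᵐ y ∂(E.interimLaw i), f y ≤ max (E.coveredCall i y.1.1 y.2) 0) :
    Integrable f (E.interimLaw i) := by
  refine hfin.integrable_interimLaw_max.mono' hm.aestronglyMeasurable ?_
  filter_upwards [h0, h1] with y h0 h1
  rw [Real.norm_of_nonneg h0]
  exact h1.trans (max_le_max (E.coveredCall_le i _ _) le_rfl)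

/-- In equilibrium, bidders claim optimally given their covered call values, and after an
inspection they obtain every item of a value above the strike price. -/
theorem IsEquilibrium.interimOptimal_and_unexposed (hs : E.IsEquilibrium ρ s)
    (hfin : E.FiniteValue i) : E.InterimOptimal ρ s i ∧ E.Unexposed ρ s i (s i) := by
  set G : ℕ → (Θ i × I) × ℝ → ℝ := fun m y =>
    E.gain ρ s i y.1.1 (E.menuBid ρ s i m (y.1.1, E.coveredCall i y.1.1 y.2))
      (E.coveredCall i y.1.1 y.2) with hG
  -- The supremum of the gains over all claims need not be attained. It is approached through the
  -- finite menus, each of which yields an admissible unexposed deviation.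
  set B : (Θ i × I) × ℝ → ℝ := fun y => ⨆ m, G m y with hB
  have hGmax : ∀ m y, G m y ≤ max (E.coveredCall i y.1.1 y.2) 0 := fun m y =>
    E.gain_le_max ρ (E.menuBid_range ρ s i m _).1 _
  have hbdd : ∀ y, BddAbove (Set.range fun m => G m y) := fun y =>
    ⟨_, by rintro _ ⟨m, rfl⟩; exact hGmax m y⟩
  have hGB : ∀ m y, G m y ≤ B y := fun m y => le_ciSup (hbdd y) m
  have hG0 : ∀ m y, 0 ≤ G m y := fun m y => E.gain_menuBid_nonneg ρ s i m _ _
  have hB0 : ∀ y, 0 ≤ B y := fun y => (hG0 0 y).trans (hGB 0 y)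
  have hκ : Measurable fun y : (Θ i × I) × ℝ => E.coveredCall i y.1.1 y.2 :=
    (E.measurable_coveredCall i).comp (f := fun y : (Θ i × I) × ℝ => (y.1.1, y.2)) (by fun_prop)
  have hGm : ∀ m, Measurable (G m) := by
    intro m
    refine (E.measurable_gain ρ s i).comp (f := fun y : (Θ i × I) × ℝ =>
      ((y.1.1, E.menuBid ρ s i m (y.1.1, E.coveredCall i y.1.1 y.2)),
        E.coveredCall i y.1.1 y.2)) ?_
    exact ((by fun_prop : Measurable fun y : (Θ i × I) × ℝ => y.1.1).prodMk
      ((E.measurable_menuBid ρ s i m).comp ((by fun_prop :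
        Measurable fun y : (Θ i × I) × ℝ => y.1.1).prodMk hκ))).prodMk hκ
  have hBm : Measurable B := Measurable.iSup hGm
  have hGi : ∀ m, Integrable (G m) (E.interimLaw i) := fun m =>
    hfin.integrable_of_nonneg (hGm m) (Filter.Eventually.of_forall (hG0 m))
      (Filter.Eventually.of_forall (hGmax m))
  have hBi : Integrable B (E.interimLaw i) :=
    hfin.integrable_of_nonneg hBm (Filter.Eventually.of_forall hB0)
      (Filter.Eventually.of_forall fun y => ciSup_le fun m => hGmax m y)
  have hBrat : ∀ (y : (Θ i × I) × ℝ) (q : ℚ≥0), E.gain ρ s i y.1.1 (((q : ℚ) : ℝ) : EReal)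
      (E.coveredCall i y.1.1 y.2) ≤ B y := by
    intro y q
    obtain ⟨m, rfl⟩ := rationalPrice_surjective q
    exact (E.gain_rationalPrice_le ρ s i m _ _).trans (hGB (m + 1) y)
  have hdev : ∀ m, E.expUtility ρ (Function.update s i (E.menuStrategy ρ s i m)) i =
      ((∫ y, G m y ∂(E.interimLaw i) : ℝ) : EReal) := by
    intro m
    have hae : E.stratGain i (E.menuStrategy ρ s i m) ρ s =ᵐ[E.interimLaw i] G m := by
      filter_upwards [hfin.ae_interimLaw] with y hy
      exact E.stratGain_menuStrategy ρ s m hy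
    rw [hfin.expUtility_update_of_unexposed ρ s (hfin.unexposed_menuStrategy ρ s m)
      ((hGi m).congr hae.symm), integral_congr_ae hae]
  have hle : ∀ m, ((∫ y, G m y ∂(E.interimLaw i) : ℝ) : EReal) ≤
      E.expUtility ρ (Function.update s i (s i)) i := by
    intro m
    rw [← hdev m, Function.update_eq_self]
    exact hs i _
  obtain ⟨hFi, hXi, hU⟩ := hfin.expUtility_update_of_ne_bot ρ s (d := s i) fun h => by
    have := hle 0
    rw [h, le_bot_iff] at this
    exact EReal.coe_ne_bot _ this
  simp only [hU, EReal.coe_le_coe_iff] at hle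
  have hlim : Filter.Tendsto (fun m => ∫ y, G m y ∂(E.interimLaw i)) Filter.atTop
      (nhds (∫ y, B y ∂(E.interimLaw i))) :=
    integral_tendsto_of_tendsto_of_monotone hGi hBi
      (Filter.Eventually.of_forall fun y => E.gain_menuBid_monotone ρ s i _ _)
      (Filter.Eventually.of_forall fun y =>
        tendsto_atTop_ciSup (E.gain_menuBid_monotone ρ s i _ _) (hbdd y))
  -- This says that the integral of `B` is at most the integral of the equilibrium gain minus that
  -- of the exposure loss. As the gain is at most `B` and the loss is nonnegative, the loss and the
  -- gap between `B` and the gain both vanish almost everywhere.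
  have hBle := le_of_tendsto' hlim hle
  have hFB : ∀ y, E.stratGain i (s i) ρ s y ≤ B y := fun y =>
    E.gain_le_of_forall_rat ρ (hB0 y) (hBrat y) ((s i).claimAt_range y.1 y.2)
      ((s i).claimAt_ne_top y.1 y.2)
  have hX0 : ∀ z, 0 ≤ (inspectSet i (s i) \ winSet i (s i)).indicator (E.excess i) z :=
    fun z => Set.indicator_nonneg (fun z _ => E.excess_nonneg i z) z
  have hXint := integral_nonneg (μ := E.viewLaw i ρ s)
    (f := (inspectSet i (s i) \ winSet i (s i)).indicator (E.excess i)) hX0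
  have hFint := integral_mono hFi hBi hFB
  have hXzero : ∫ z, (inspectSet i (s i) \ winSet i (s i)).indicator (E.excess i) z
      ∂(E.viewLaw i ρ s) = 0 := by linarith
  have hBF : ∫ y, (B y - E.stratGain i (s i) ρ s y) ∂(E.interimLaw i) = 0 := by
    rw [integral_sub hBi hFi]; linarith
  refine ⟨?_, (integral_eq_zero_iff_of_nonneg hX0 hXi).1 hXzero⟩
  have h0 := (integral_eq_zero_iff_of_nonneg (fun y => sub_nonneg.2 (hFB y))
    (hBi.sub hFi)).1 hBF
  filter_upwards [h0] with y hy
  have hy' : B y = E.stratGain i (s i) ρ s y := by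
    simp only [Pi.zero_apply] at hy; linarith
  rw [← hy']
  exact ⟨hB0 y, hBrat y⟩

variable {s}

theorem InterimOptimal.integrable (hfin : E.FiniteValue i) (ho : E.InterimOptimal ρ s i) :
    Integrable (E.stratGain i (s i) ρ s) (E.interimLaw i) :=
  hfin.integrable_of_nonneg (E.measurable_stratGain i (s i) ρ s) (ho.mono fun _ h => h.1)
    (Filter.Eventually.of_forall fun y => E.gain_le_max ρ ((s i).claimAt_range y.1 y.2) _)

theorem InterimOptimal.expUtility (hfin : E.FiniteValue i) (ho : E.InterimOptimal ρ s i)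
    (hx : E.Unexposed ρ s i (s i)) : E.expUtility ρ s i =
      ((∫ y, E.stratGain i (s i) ρ s y ∂(E.interimLaw i) : ℝ) : EReal) := by
  have := hfin.expUtility_update_of_unexposed ρ s hx (InterimOptimal.integrable ρ hfin ho)
  rwa [Function.update_eq_self] at this

/-- The covered gain of a deviation is pointwise at most the optimal one, and exposure can only
lower its utility further. A deviation with utility `⊥` needs no argument. -/
theorem isEquilibrium_of_interimOptimal (hfin : ∀ i, E.FiniteValue i)
    (ho : ∀ i, E.InterimOptimal ρ s i) (hx : ∀ i, E.Unexposed ρ s i (s i)) :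
    E.IsEquilibrium ρ s := by
  intro i d
  rw [InterimOptimal.expUtility ρ (hfin i) (ho i) (hx i)]
  by_cases hbot : E.expUtility ρ (Function.update s i d) i = ⊥
  · rw [hbot]; exact bot_le
  obtain ⟨h1, h2, h3⟩ := (hfin i).expUtility_update_of_ne_bot ρ s hbot
  rw [h3, EReal.coe_le_coe_iff]
  have hX := integral_nonneg (μ := E.viewLaw i ρ s)
    (f := (inspectSet i d \ winSet i d).indicator (E.excess i))
    (fun z => Set.indicator_nonneg (fun z _ => E.excess_nonneg i z) z)
  have hF := integral_mono_ae h1 (InterimOptimal.integrable ρ (hfin i) (ho i)) (by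
    filter_upwards [ho i] with y hy
    exact E.gain_le_of_forall_rat ρ hy.1 hy.2 (d.claimAt_range y.1 y.2)
      (d.claimAt_ne_top y.1 y.2))
  linarith

end equilibrium

end Environment

/-! ### Conditional quantiles -/

section Quantile

theorem continuous_volume_Iic_inter (N : Set I) :
    Continuous fun r : I => (volume : Measure I).real (Set.Iic r ∩ N) := by
  refine (LipschitzWith.of_le_add fun a b => ?_ : LipschitzWith 1 _).continuous
  rcases le_total a b with h | h
  · exact (measureReal_mono (Set.inter_subset_inter_left _ (Set.Iic_subset_Iic.2 h))).trans
      (le_add_of_nonneg_right dist_nonneg)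
  · have hsub : Set.Iic a ∩ N ⊆ (Set.Iic b ∩ N) ∪ Set.Ioc b a := by
      rintro x ⟨hx, hxN⟩
      rcases le_or_gt x b with hb | hb
      · exact Or.inl ⟨hb, hxN⟩
      · exact Or.inr ⟨hb, hx⟩
    refine (measureReal_mono hsub).trans ((measureReal_union_le _ _).trans ?_)
    gcongr
    rw [Measure.real, unitInterval.volume_Ioc, Subtype.dist_eq, Real.dist_eq]
    rw [ENNReal.toReal_ofReal (by simpa using h)]
    exact le_abs_self _

/-- The probability integral transform for the uniform law on a set. -/
theorem volume_setOf_volume_Iic_le (N : Set I) {g : ℝ≥0∞} (hg : g ≤ (volume : Measure I) N) :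
    (volume : Measure I) {r | r ∈ N ∧ (volume : Measure I) (Set.Iic r ∩ N) ≤ g} = g := by
  set h : I → ℝ := fun r => (volume : Measure I).real (Set.Iic r ∩ N) with hh
  have hgtop : g ≠ ∞ := (hg.trans_lt (measure_lt_top _ _)).ne
  have hmono : Monotone h := fun a b hab =>
    measureReal_mono (Set.inter_subset_inter_left _ (Set.Iic_subset_Iic.2 hab))
  have hle : ∀ r, (volume : Measure I) (Set.Iic r ∩ N) ≤ g ↔ h r ≤ g.toReal := fun r =>
    (ENNReal.toReal_le_toReal (measure_ne_top _ _) hgtop).symm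
  have h0 : h 0 ≤ g.toReal := by
    have : h 0 = 0 := by
      rw [hh]
      refine (measureReal_eq_zero_iff (measure_ne_top _ _)).2
        (measure_mono_null (t := {(0 : I)}) (fun x hx => ?_) (measure_singleton (0 : I)))
      exact le_antisymm hx.1 (unitInterval.nonneg x)
    rw [this]; exact ENNReal.toReal_nonneg
  have h1 : g.toReal ≤ h 1 := by
    have : Set.Iic (1 : I) ∩ N = N := by
      ext x; simp [unitInterval.le_one']
    simp only [hh, this]
    exact ENNReal.toReal_mono (measure_ne_top _ _) hg
  -- As `h` is continuous and nondecreasing, its sublevel set at `g` is an initial interval whose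
  -- right endpoint is the largest point with `h r = g`.
  obtain ⟨r₀, hr₀⟩ := mem_range_of_exists_le_of_exists_ge
    (continuous_volume_Iic_inter N) ⟨0, h0⟩ ⟨1, h1⟩
  have hclosed : IsClosed {r | h r ≤ g.toReal} :=
    isClosed_le (continuous_volume_Iic_inter N) continuous_const
  have hmem : sSup {r | h r ≤ g.toReal} ∈ {r | h r ≤ g.toReal} :=
    hclosed.isCompact.sSup_mem ⟨0, h0⟩
  have hset : {r | r ∈ N ∧ (volume : Measure I) (Set.Iic r ∩ N) ≤ g} =
      Set.Iic (sSup {r | h r ≤ g.toReal}) ∩ N := by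
    ext r
    simp only [Set.mem_ofPred_eq, hle, Set.mem_inter_iff, Set.mem_Iic]
    constructor
    · exact fun hr => ⟨le_sSup hr.2, hr.1⟩
    · exact fun hr => ⟨hr.2, (hmono hr.1).trans hmem⟩
  rw [hset]
  have hle₀ : g.toReal ≤ h (sSup {r | h r ≤ g.toReal}) := by
    rw [← hr₀]
    exact hmono (le_sSup (show h r₀ ≤ h r₀ from le_rfl))
  exact (ENNReal.toReal_eq_toReal_iff' (measure_ne_top _ _) hgtop).1 (le_antisymm hmem hle₀)

/-- Right continuity of the distribution function makes the infimum a minimum. This is the defining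
adjunction of the quantile function. -/
theorem sInf_le_iff_le_measure_Iic (ν : Measure EReal) [IsFiniteMeasure ν] {a : ℝ≥0∞}
    (ha : a ≤ ν Set.univ) (y : EReal) : sInf {y | a ≤ ν (Set.Iic y)} ≤ y ↔ a ≤ ν (Set.Iic y) := by
  refine ⟨fun h => ?_, fun h => sInf_le h⟩
  suffices hs : a ≤ ν (Set.Iic (sInf {y | a ≤ ν (Set.Iic y)})) from
    hs.trans (measure_mono (Set.Iic_subset_Iic.2 h))
  set z := sInf {y | a ≤ ν (Set.Iic y)} with hz
  rcases eq_or_ne z ⊤ with htop | htop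
  · rw [htop]; simpa using ha
  obtain ⟨u, hu, huz, hlim⟩ := exists_seq_strictAnti_tendsto' (lt_top_iff_ne_top.2 htop)
  have hI : Set.Iic z = ⋂ m, Set.Iic (u m) := by
    ext x
    simp only [Set.mem_Iic, Set.mem_iInter]
    exact ⟨fun hx m => hx.trans (huz m).1.le, fun hx => ge_of_tendsto' hlim hx⟩
  rw [hI]
  refine ge_of_tendsto' (tendsto_measure_iInter_atTop (fun m => measurableSet_Iic.nullMeasurableSet)
    (fun m k hmk => Set.Iic_subset_Iic.2 (hu.antitone hmk)) ⟨0, measure_ne_top _ _⟩) fun m => ?_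
  obtain ⟨y, hy, hyu⟩ := sInf_lt_iff.1 (huz m).1
  exact le_trans (show a ≤ ν (Set.Iic y) from hy) (measure_mono (Set.Iic_subset_Iic.2 hyu.le))

/-- Claims that depend on the value can be replaced by claims with the same law given the type that
depend on the random number only. -/
theorem exists_quantile {T : Type*} [MeasurableSpace T] (F : Kernel T ℝ) [IsMarkovKernel F]
    {N : Set (T × I)} (hN : MeasurableSet N) {c : (T × I) × ℝ → EReal} (hc : Measurable c)
    (hrange : ∀ y, (c y = ⊥ ∨ 0 ≤ c y) ∧ c y ≠ ⊤) :
    ∃ z : T × I → EReal, Measurable z ∧ (∀ x, (z x = ⊥ ∨ 0 ≤ z x) ∧ z x ≠ ⊤) ∧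
      ∀ t S, MeasurableSet S → (volume : Measure I) {r | (t, r) ∈ N ∧ z (t, r) ∈ S} =
        ((volume : Measure I).prod (F t)) {y | (t, y.1) ∈ N ∧ c ((t, y.1), y.2) ∈ S} := by
  have hNt : ∀ t, MeasurableSet {y : I × ℝ | (t, y.1) ∈ N} := fun t =>
    hN.preimage (f := fun y : I × ℝ => (t, y.1)) (by fun_prop)
  have hct : ∀ t, Measurable fun y : I × ℝ => c ((t, y.1), y.2) := fun t => by fun_prop
  -- The law to be reproduced: that of the claim given the type, restricted to `N`.
  set ν : T → Measure EReal := fun t =>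
    (((volume : Measure I).prod (F t)).restrict {y | (t, y.1) ∈ N}).map
      fun y => c ((t, y.1), y.2) with hν
  have hνapply : ∀ t S, MeasurableSet S → ν t S =
      ((volume : Measure I).prod (F t)) {y | (t, y.1) ∈ N ∧ c ((t, y.1), y.2) ∈ S} := by
    intro t S hS
    rw [hν]
    simp only
    rw [Measure.map_apply (hct t) hS, Measure.restrict_apply ((hct t) hS), Set.inter_comm]
    rfl
  have hνuniv : ∀ t, ν t Set.univ = (volume : Measure I) {r | (t, r) ∈ N} := by
    intro t
    rw [hνapply t _ MeasurableSet.univ]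
    have : {y : I × ℝ | (t, y.1) ∈ N ∧ c ((t, y.1), y.2) ∈ Set.univ} =
        {r | (t, r) ∈ N} ×ˢ (Set.univ : Set ℝ) := by
      ext y; simp
    rw [this, Measure.prod_prod, measure_univ, mul_one]
  -- The rank of the random number within the section of `N`. The new claim is the quantile of `ν`
  -- at this rank.
  set H : T × I → ℝ≥0∞ := fun x => (volume : Measure I) (Set.Iic x.2 ∩ {r | (x.1, r) ∈ N}) with hH
  have hHm : Measurable H := by
    have hS : MeasurableSet {p : (T × I) × I | p.2 ≤ p.1.2 ∧ (p.1.1, p.2) ∈ N} :=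
      (measurableSet_le (by fun_prop) (by fun_prop)).inter
        (hN.preimage (f := fun p : (T × I) × I => (p.1.1, p.2)) (by fun_prop))
    exact measurable_measure_prodMk_left hS
  have hHle : ∀ x, H x ≤ ν x.1 Set.univ := fun x => by
    rw [hνuniv]; exact measure_mono Set.inter_subset_right
  set z₀ : T × I → EReal := fun x => sInf {y | H x ≤ ν x.1 (Set.Iic y)} with hz₀
  have hz₀le : ∀ x y, z₀ x ≤ y ↔ H x ≤ ν x.1 (Set.Iic y) := fun x y =>
    sInf_le_iff_le_measure_Iic (ν x.1) (hHle x) y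
  have hνm : ∀ y, Measurable fun t => ν t (Set.Iic y) := by
    intro y
    simp only [hνapply _ _ measurableSet_Iic]
    have hS : MeasurableSet {p : T × (I × ℝ) | (p.1, p.2.1) ∈ N ∧
        c ((p.1, p.2.1), p.2.2) ∈ Set.Iic y} :=
      (hN.preimage (f := fun p : T × (I × ℝ) => (p.1, p.2.1)) (by fun_prop)).inter
        (measurableSet_Iic.preimage (hc.comp (by fun_prop)))
    have := Kernel.measurable_kernel_prodMk_left
      (κ := (Kernel.const T (volume : Measure I)) ×ₖ F) hS
    simpa [Kernel.prod_apply] using this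
  have hz₀m : Measurable z₀ := by
    refine measurable_of_Iic fun y => ?_
    have : z₀ ⁻¹' Set.Iic y = {x | H x ≤ ν x.1 (Set.Iic y)} := by
      ext x; exact hz₀le x y
    rw [this]
    exact measurableSet_le hHm ((hνm y).comp measurable_fst)
  have hNr : ∀ t, MeasurableSet {r : I | (t, r) ∈ N} := fun t => hN.preimage (by fun_prop)
  have hz₀t : ∀ t, Measurable fun r => z₀ (t, r) := fun t => hz₀m.comp (by fun_prop)
  have hlaw : ∀ t, ((volume : Measure I).restrict {r | (t, r) ∈ N}).map (fun r => z₀ (t, r))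
      = ν t := by
    intro t
    refine Measure.ext_of_Iic _ _ fun y => ?_
    rw [Measure.map_apply (hz₀t t) measurableSet_Iic,
      Measure.restrict_apply ((hz₀t t) measurableSet_Iic)]
    have : (fun r => z₀ (t, r)) ⁻¹' Set.Iic y ∩ {r | (t, r) ∈ N} =
        {r | r ∈ {r | (t, r) ∈ N} ∧
          (volume : Measure I) (Set.Iic r ∩ {r | (t, r) ∈ N}) ≤ ν t (Set.Iic y)} := by
      ext r
      simp only [Set.mem_inter_iff, Set.mem_preimage, Set.mem_Iic, hz₀le, Set.mem_ofPred_eq, hH]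
      exact and_comm
    rw [this]
    exact volume_setOf_volume_Iic_le _ ((measure_mono (Set.subset_univ _)).trans_eq (hνuniv t))
  classical
  -- Quantiles may leave the admissible range, for instance outside `N`. Clipping repairs this and
  -- fixes all values of `c`, so the law is not affected.
  set clip : EReal → EReal := fun x => if 0 ≤ x ∧ x ≠ ⊤ then x else ⊥ with hclip
  have hclipm : Measurable clip := by
    refine Measurable.ite ?_ measurable_id measurable_const
    exact measurableSet_Ici.inter (measurableSet_singleton _).compl
  have hclipc : ∀ y, clip (c y) = c y := by
    intro y
    rcases (hrange y).1 with h | h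
    · simp [hclip, h]
    · simp [hclip, h, (hrange y).2]
  refine ⟨fun x => clip (z₀ x), hclipm.comp hz₀m, fun x => ?_, fun t S hS => ?_⟩
  · simp only [hclip]
    split_ifs with h
    · exact ⟨Or.inr h.1, h.2⟩
    · exact ⟨Or.inl rfl, bot_ne_top⟩
  · have h1 : (volume : Measure I) {r | (t, r) ∈ N ∧ clip (z₀ (t, r)) ∈ S} = ν t (clip ⁻¹' S) := by
      rw [← hlaw t, Measure.map_apply (hz₀t t) (hclipm hS),
        Measure.restrict_apply ((hz₀t t) (hclipm hS)), Set.inter_comm]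
      rfl
    rw [h1, hνapply t _ (hclipm hS)]
    simp only [Set.mem_preimage, hclipc]

end Quantile

namespace Environment

variable {n : ℕ} {Θ : Fin n → Type*} [∀ i, MeasurableSpace (Θ i)]

/-! ### Claims that depend on the covered call value only -/

section regularization

variable (E : Environment Θ) (ρ : Measure (Equiv.Perm (Fin n)))

theorem ae_privateLaw_of_ae_interimLaw {i : Fin n} {P : (Θ i × I) × ℝ → Prop}
    (hP : MeasurableSet {y | P y}) (h : ∀ᵐ y ∂(E.interimLaw i), P y) :
    ∀ᵐ t ∂(E.prior.map fun θ => θ i), ∀ᵐ w ∂(E.privateLaw i t), P ((t, w.1), w.2) := by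
  have hind : Measurable ({y | P y}ᶜ.indicator fun _ => (1 : ℝ≥0∞)) :=
    measurable_const.indicator hP.compl
  have h0 : ∫⁻ y, {y | P y}ᶜ.indicator (fun _ => (1 : ℝ≥0∞)) y ∂(E.interimLaw i) = 0 := by
    rw [lintegral_indicator_const hP.compl, one_mul]
    exact ae_iff.1 h
  have hm : Measurable fun x : Θ i × I => ∫⁻ v, {y | P y}ᶜ.indicator (fun _ => (1 : ℝ≥0∞)) (x, v)
      ∂(E.value i x.1) :=
    hind.lintegral_kernel_prod_right' (κ := Kernel.prodMkRight I (E.value i))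
  rw [lintegral_interimLaw E i hind, lintegral_eq_zero_iff hm.lintegral_prod_right'] at h0
  filter_upwards [h0] with t ht
  have hPt : MeasurableSet {w : I × ℝ | ¬ P ((t, w.1), w.2)} :=
    hP.compl.preimage (f := fun w : I × ℝ => ((t, w.1), w.2)) (by fun_prop)
  rw [ae_iff, ← one_mul (E.privateLaw i t _), ← lintegral_indicator_const hPt]
  unfold privateLaw
  rw [lintegral_prod _ (measurable_const.indicator hPt).aemeasurable]
  exact ht

theorem ae_interimLaw_of_ae_ae {i : Fin n} {P : (Θ i × I) × ℝ → Prop}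
    (hP : MeasurableSet {y | P y})
    (h : ∀ᵐ x ∂((E.prior.map fun θ => θ i).prod (volume : Measure I)),
      ∀ᵐ v ∂(E.value i x.1), P (x, v)) : ∀ᵐ y ∂(E.interimLaw i), P y :=
  Measure.ae_compProd_of_ae_ae hP h

theorem ae_ae_of_ae_interimLaw {i : Fin n} {P : (Θ i × I) × ℝ → Prop}
    (h : ∀ᵐ y ∂(E.interimLaw i), P y) :
    ∀ᵐ x ∂((E.prior.map fun θ => θ i).prod (volume : Measure I)),
      ∀ᵐ v ∂(E.value i x.1), P (x, v) := by
  unfold interimLaw at h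
  have h' := Measure.ae_ae_of_ae_compProd (μ := (E.prior.map fun θ => θ i).prod (volume : Measure I))
    (κ := Kernel.prodMkRight I (E.value i)) (p := P) h
  simpa only [Kernel.prodMkRight_apply] using h'

theorem ae_prod_of_ae_type {i : Fin n} {P : Θ i → Prop}
    (h : ∀ᵐ t ∂(E.prior.map fun θ => θ i), P t) :
    ∀ᵐ x ∂((E.prior.map fun θ => θ i).prod (volume : Measure I)), P x.1 :=
  Measure.quasiMeasurePreserving_fst.ae h

/-- Data for replacing the claims of a bidder by claims that depend on her covered call value
only: a set of types and random numbers at which her claims lose, claims to be made there, and the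
claim to be made elsewhere if the value exceeds the strike price. -/
structure Regularization (i : Fin n) where
  losing : Set (Θ i × I)
  losing_measurable : MeasurableSet losing
  losingBid : Θ i × I → EReal
  losingBid_measurable : Measurable losingBid
  losingBid_range : ∀ x, (losingBid x = ⊥ ∨ 0 ≤ losingBid x) ∧ losingBid x ≠ ⊤
  strikeBid : Θ i × I → EReal
  strikeBid_measurable : Measurable strikeBid
  strikeBid_range : ∀ x, (strikeBid x = ⊥ ∨ 0 ≤ strikeBid x) ∧ strikeBid x ≠ ⊤

namespace Regularization

variable {E} {i : Fin n} (R : Regularization (Θ := Θ) i) (d : DutchStrategy (Θ i))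

variable (E) in
open Classical in
/-- The regularized claim as a function of the covered call value. -/
noncomputable def bid (y : (Θ i × I) × ℝ) : EReal :=
  if y.1 ∈ R.losing then R.losingBid y.1
  else if E.cost i y.1.1 = 0 then d.claimAt y
  -- The minimum guarantees that no claim precedes the inspection; for optimal claims it is almost
  -- surely inactive (`Regularizes.bid_eq_claimAt`).
  else if (y.2 : EReal) < E.strike i y.1.1 then min (d.claimAt y) (R.strikeBid y.1)
  else R.strikeBid y.1

variable (E) in
open Classical in
/-- The clock value of inspection for the regularized claims. -/
noncomputable def inspect (x : Θ i × I) : EReal :=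
  if x ∈ R.losing then R.losingBid x else if E.cost i x.1 = 0 then ⊤ else R.strikeBid x

theorem measurableSet_cost_eq_zero : MeasurableSet {x : Θ i × I | E.cost i x.1 = 0} :=
  (measurableSet_singleton (0 : ℝ≥0)).preimage ((E.cost_measurable i).comp measurable_fst)

theorem measurable_bid : Measurable (R.bid E d) := by
  unfold bid
  refine Measurable.ite (R.losing_measurable.preimage measurable_fst)
    (R.losingBid_measurable.comp measurable_fst) ?_
  refine Measurable.ite (measurableSet_cost_eq_zero.preimage measurable_fst)
    d.claimAt_measurable ?_
  refine Measurable.ite (measurableSet_lt measurable_snd.coe_real_ereal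
    ((E.measurable_strike i).comp (measurable_fst.comp measurable_fst))) ?_ ?_
  · exact d.claimAt_measurable.min (R.strikeBid_measurable.comp measurable_fst)
  · exact R.strikeBid_measurable.comp measurable_fst

theorem measurable_inspect : Measurable (R.inspect E) := by
  unfold inspect
  exact Measurable.ite R.losing_measurable R.losingBid_measurable
    (Measurable.ite measurableSet_cost_eq_zero measurable_const R.strikeBid_measurable)

theorem bid_range (y : (Θ i × I) × ℝ) :
    (R.bid E d y = ⊥ ∨ 0 ≤ R.bid E d y) ∧ R.bid E d y ≠ ⊤ := by
  unfold bid
  split_ifs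
  · exact R.losingBid_range _
  · exact ⟨d.claimAt_range y.1 y.2, d.claimAt_ne_top y.1 y.2⟩
  · rcases min_choice (d.claimAt y) (R.strikeBid y.1) with h | h <;> rw [h]
    · exact ⟨d.claimAt_range y.1 y.2, d.claimAt_ne_top y.1 y.2⟩
    · exact R.strikeBid_range _
  · exact R.strikeBid_range _

theorem inspect_range (x : Θ i × I) : R.inspect E x = ⊥ ∨ 0 ≤ R.inspect E x := by
  unfold inspect
  split_ifs
  · exact (R.losingBid_range _).1
  · exact Or.inr le_top
  · exact (R.strikeBid_range _).1

theorem bid_le_inspect (x : Θ i × I) (k : ℝ) : R.bid E d (x, k) ≤ R.inspect E x := by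
  unfold bid inspect
  simp only
  split_ifs
  · exact le_rfl
  · exact le_top
  · exact min_le_right _ _
  · exact le_rfl

variable (E) in
theorem measurable_withCoveredCall :
    Measurable fun y : (Θ i × I) × ℝ => (y.1, E.coveredCall i y.1.1 y.2) :=
  measurable_fst.prodMk ((E.measurable_coveredCall i).comp
    (f := fun y : (Θ i × I) × ℝ => (y.1.1, y.2)) (by fun_prop))

variable (E) in
/-- The regularized strategy. -/
noncomputable def strategy : DutchStrategy (Θ i) where
  inspectAt := R.inspect E
  claimAt y := R.bid E d (y.1, E.coveredCall i y.1.1 y.2)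
  inspectAt_measurable := R.measurable_inspect
  claimAt_measurable := (R.measurable_bid d).comp (measurable_withCoveredCall E)
  inspectAt_range := R.inspect_range
  claimAt_range _ _ := (R.bid_range d _).1
  claimAt_ne_top _ _ := (R.bid_range d _).2
  claimAt_le _ _ := R.bid_le_inspect d _ _

variable (E) in
/-- The regularized strategy in the auction with covered counterparts. -/
noncomputable def coveredStrategy : DutchStrategy (Θ i) where
  inspectAt _ := ⊤
  claimAt := R.bid E d
  inspectAt_measurable := measurable_const
  claimAt_measurable := R.measurable_bid d
  inspectAt_range _ := Or.inr le_top
  claimAt_range _ _ := (R.bid_range d _).1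
  claimAt_ne_top _ _ := (R.bid_range d _).2
  claimAt_le _ _ := le_top

/-- At values above the strike price the regularized claim equals the clock value of inspection, on
the losing set as well as off it. -/
theorem unexposed_strategy [IsProbabilityMeasure ρ] (s : Profile Θ) :
    E.Unexposed ρ s i (R.strategy E d) := by
  refine Filter.Eventually.of_forall fun z => ?_
  by_cases hz : z ∈ inspectSet i (R.strategy E d) \ winSet i (R.strategy E d)
  · rw [Set.indicator_of_mem hz]
    by_contra hne
    have hlt : E.coveredCall i z.1.1.1 z.1.2 < z.1.2 := by
      have h2 := E.excess_nonneg i z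
      have h3 := lt_of_le_of_ne h2 (Ne.symm hne)
      unfold excess at h3
      linarith
    have hc : E.cost i z.1.1.1 ≠ 0 := fun hc => hne (E.excess_eq_zero_of_cost_eq_zero hc)
    rw [coveredCall_lt_iff] at hlt
    have hk : ((E.coveredCall i z.1.1.1 z.1.2 : ℝ) : EReal) = E.strike i z.1.1.1 := by
      rw [coe_coveredCall, min_eq_left hlt.le]
    refine hz.2 ?_
    have h4 : (R.strategy E d).claimAt z.1 = (R.strategy E d).inspectAt z.1.1 := by
      simp only [strategy, bid, inspect, hk, lt_self_iff_false, if_false, hc]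
    unfold winSet
    simp only [Set.mem_ofPred_eq, h4]
    exact hz.1
  · rw [Set.indicator_of_notMem hz]

end Regularization

variable [IsProbabilityMeasure ρ] (s : Profile Θ) (i : Fin n)

/-- The types and random numbers at which the claims of bidder `i` lose almost surely. -/
def losingSet : Set (Θ i × I) :=
  {x | ∫⁻ v, ENNReal.ofReal (E.reachProb ρ s i x.1 ((s i).claimAt (x, v))) ∂(E.value i x.1) = 0}

theorem measurable_reachProb_claimAt :
    Measurable fun y : (Θ i × I) × ℝ => E.reachProb ρ s i y.1.1 ((s i).claimAt y) :=
  (E.measurable_reachProb ρ s i).comp (f := fun y : (Θ i × I) × ℝ => (y.1.1, (s i).claimAt y))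
    ((by fun_prop : Measurable fun y : (Θ i × I) × ℝ => y.1.1).prodMk (s i).claimAt_measurable)

theorem measurableSet_losingSet : MeasurableSet (E.losingSet ρ s i) := by
  have h := (E.measurable_reachProb_claimAt ρ s i).ennreal_ofReal.lintegral_kernel_prod_right'
    (κ := Kernel.prodMkRight I (E.value i))
  exact h (measurableSet_singleton 0)

variable {s i} in
theorem mem_losingSet_iff (x : Θ i × I) : x ∈ E.losingSet ρ s i ↔
    ∀ᵐ v ∂(E.value i x.1), E.reachProb ρ s i x.1 ((s i).claimAt (x, v)) = 0 := by
  unfold losingSet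
  have hm : Measurable fun v => ENNReal.ofReal (E.reachProb ρ s i x.1 ((s i).claimAt (x, v))) :=
    ((E.measurable_reachProb_claimAt ρ s i).comp measurable_prodMk_left).ennreal_ofReal
  rw [Set.mem_ofPred_eq, lintegral_eq_zero_iff hm]
  refine Filter.eventually_congr (Filter.Eventually.of_forall fun v => ?_)
  simp only [Pi.zero_apply, ENNReal.ofReal_eq_zero]
  exact ⟨fun h => le_antisymm h (E.reachProb_nonneg ρ s i _ _), fun h => h.le⟩

/-- The claims of bidder `i` at values above the strike price are given by `γ`. -/
def ConstantAboveStrike (γ : Θ i × I → EReal) : Prop :=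
  ∀ᵐ x ∂((E.prior.map fun θ => θ i).prod (volume : Measure I)), x ∉ E.losingSet ρ s i →
    E.cost i x.1 ≠ 0 → ∀ᵐ (v : ℝ) ∂(E.value i x.1), E.strike i x.1 < (v : EReal) →
      (s i).claimAt (x, v) = γ x

variable {i} in
/-- The conditions under which a regularization does not affect the auction. -/
structure Regularizes (R : Regularization (Θ := Θ) i) : Prop where
  losing_eq : R.losing = E.losingSet ρ s i
  law_eq : ∀ t S, MeasurableSet S →
    (volume : Measure I) {r | (t, r) ∈ R.losing ∧ R.losingBid (t, r) ∈ S} =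
      (E.privateLaw i t) {y | (t, y.1) ∈ R.losing ∧ (s i).claimAt ((t, y.1), y.2) ∈ S}
  constantAboveStrike : E.ConstantAboveStrike ρ s i R.strikeBid

/-- Quantiles on the losing set preserve the law of the losing claims given the type, so rivals who
deviate face the same competition as before. -/
theorem exists_regularizes {γ : Θ i × I → EReal} (hγ : Measurable γ)
    (hγr : ∀ x, (γ x = ⊥ ∨ 0 ≤ γ x) ∧ γ x ≠ ⊤) (h : E.ConstantAboveStrike ρ s i γ) :
    ∃ R : Regularization (Θ := Θ) i, E.Regularizes ρ s R := by
  obtain ⟨z, hz, hzr, hlaw⟩ := exists_quantile (E.value i) (E.measurableSet_losingSet ρ s i)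
    (s i).claimAt_measurable (fun y => ⟨(s i).claimAt_range y.1 y.2, (s i).claimAt_ne_top y.1 y.2⟩)
  exact ⟨⟨_, E.measurableSet_losingSet ρ s i, z, hz, hzr, γ, hγ, hγr⟩, rfl, hlaw, h⟩

variable {E ρ s i} {R : Regularization (Θ := Θ) i}

/-- Above the strike price this is the constancy of the claims, and the strike price itself is null.
Below it, optimal claims are reached no more often than `strikeBid`; a higher claim would then pay
more for the same positive probability. -/
theorem Regularizes.bid_eq_claimAt (hR : E.Regularizes ρ s R) (hfin : E.FiniteValue i)
    (hatom : ∀ᵐ t ∂(E.prior.map fun θ => θ i),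
      E.value i t {v : ℝ | (v : EReal) = E.strike i t} = 0)
    (ho : E.InterimOptimal ρ s i) :
    ∀ᵐ y ∂(E.interimLaw i), y.1 ∉ R.losing →
      (R.strategy E (s i)).claimAt y = (s i).claimAt y := by
  refine E.ae_interimLaw_of_ae_ae ?_ ?_
  · exact (R.losing_measurable.preimage measurable_fst).compl.himp
      (measurableSet_eq_fun (R.strategy E (s i)).claimAt_measurable (s i).claimAt_measurable)
  filter_upwards [E.ae_prod_of_ae_type hfin.ae_type, E.ae_prod_of_ae_type hatom,
    hR.constantAboveStrike, E.ae_ae_of_ae_interimLaw ho] with x hv hat hconst hopt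
  by_cases hx : x ∈ R.losing
  · exact Filter.Eventually.of_forall fun v h => absurd hx h
  by_cases hc : E.cost i x.1 = 0
  · refine Filter.Eventually.of_forall fun v _ => ?_
    simp only [Regularization.strategy, Regularization.bid, if_neg hx, if_pos hc,
      E.coveredCall_of_cost_eq_zero i hc]
  have hx' : x ∉ E.losingSet ρ s i := hR.losing_eq ▸ hx
  have hconst := hconst hx' hc
  obtain ⟨w, hw, -⟩ := E.exists_strike_eq_coe i (pos_iff_ne_zero.2 hc) hv
  have hpos := E.value_strike_lt_ne_zero i hc hv
  rw [hw] at hconst hpos hat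
  simp only [EReal.coe_lt_coe_iff, EReal.coe_eq_coe_iff] at hconst hpos hat
  have hκle : ∀ v, v ≤ w → E.coveredCall i x.1 v = v := fun v hvw =>
    E.coveredCall_of_le i (by rw [hw]; exact EReal.coe_le_coe_iff.2 hvw)
  have hκgt : ∀ v, w ≤ v → E.coveredCall i x.1 v = w := fun v hvw => by
    rw [← EReal.coe_eq_coe_iff, E.coe_coveredCall, hw,
      min_eq_left (EReal.coe_le_coe_iff.2 hvw)]
  have hat' : ∀ᵐ v ∂(E.value i x.1), v ≠ w := by
    rw [ae_iff]; simpa using hat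
  -- The strike price is exceeded with positive probability, so the almost sure properties hold at
  -- some such `v₀`. They show that `strikeBid` is optimal for the covered call value `w`.
  obtain ⟨v₀, hv₀, hγ, hγo⟩ : ∃ v, w < v ∧ (s i).claimAt (x, v) = R.strikeBid x ∧
      (0 ≤ E.stratGain i (s i) ρ s (x, v) ∧ ∀ q : ℚ≥0, E.gain ρ s i x.1 (((q : ℚ) : ℝ) : EReal)
        (E.coveredCall i x.1 v) ≤ E.stratGain i (s i) ρ s (x, v)) := by
    by_contra! hcon
    refine hpos (measure_mono_null (fun v hv => ?_) (ae_iff.1 (hconst.and hopt)))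
    intro hbad
    obtain ⟨q, hq⟩ := hcon v hv (hbad.1 hv) hbad.2.1
    exact absurd (hbad.2.2 q) (not_le.2 hq)
  have hgain₀ : E.stratGain i (s i) ρ s (x, v₀) = E.gain ρ s i x.1 (R.strikeBid x) w := by
    unfold stratGain; rw [hγ, hκgt v₀ hv₀.le]
  rw [hgain₀] at hγo
  simp only [hκgt v₀ hv₀.le] at hγo
  have hrange : ∀ v, ((s i).claimAt (x, v) = ⊥ ∨ 0 ≤ (s i).claimAt (x, v)) ∧
      (s i).claimAt (x, v) ≠ ⊤ := fun v => ⟨(s i).claimAt_range x v, (s i).claimAt_ne_top x v⟩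
  have hγopt : ∀ v, E.gain ρ s i x.1 ((s i).claimAt (x, v)) w ≤
      E.gain ρ s i x.1 (R.strikeBid x) w := fun v =>
    E.gain_le_of_forall_rat ρ hγo.1 hγo.2 (hrange v).1 (hrange v).2
  have hlow : ∀ᵐ v ∂(E.value i x.1), v < w →
      E.gain ρ s i x.1 (R.strikeBid x) v ≤ E.gain ρ s i x.1 ((s i).claimAt (x, v)) v ∧
      E.reachProb ρ s i x.1 ((s i).claimAt (x, v)) ≤ E.reachProb ρ s i x.1 (R.strikeBid x) := by
    filter_upwards [hopt] with v hov hvw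
    have h1 : E.gain ρ s i x.1 (R.strikeBid x) v ≤
        E.gain ρ s i x.1 ((s i).claimAt (x, v)) v := by
      unfold stratGain at hov
      simp only [hκle v hvw.le] at hov
      exact E.gain_le_of_forall_rat ρ hov.1 hov.2 (R.strikeBid_range x).1 (R.strikeBid_range x).2
    exact ⟨h1, E.reachProb_le_of_optimal ρ s i hvw h1 (hγopt v)⟩
  -- Otherwise the claims at lower values, which are reached no more often, would lose as well, and
  -- `x` would belong to the losing set.
  have hγpos : E.reachProb ρ s i x.1 (R.strikeBid x) ≠ 0 := by
    intro h0
    refine hx' ((E.mem_losingSet_iff ρ x).2 ?_)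
    filter_upwards [hlow, hconst, hat'] with v h1 h2 h3
    rcases lt_or_gt_of_ne h3 with h | h
    · exact le_antisymm ((h1 h).2.trans h0.le) (E.reachProb_nonneg ρ s i _ _)
    · rw [h2 h, h0]
  filter_upwards [hlow, hconst, hat'] with v h1 h2 h3 _
  simp only [Regularization.strategy, Regularization.bid, if_neg hx, if_neg hc, hw,
    EReal.coe_lt_coe_iff]
  rcases lt_or_gt_of_ne h3 with h | h
  · rw [hκle v h.le, if_pos h]
    refine min_eq_left ?_
    -- A claim above `strikeBid` is reached at least as often, hence by `h5` equally often, but at a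
    -- higher price.
    by_contra! hlt
    obtain ⟨h4, h5⟩ := h1 h
    have h6 := le_antisymm h5 (E.reachProb_mono ρ s i x.1 hlt.le)
    have hγbot : R.strikeBid x ≠ ⊥ := by
      intro hb
      rw [hb, reachProb_bot] at hγpos
      exact hγpos rfl
    have h7 : (R.strikeBid x).toReal < ((s i).claimAt (x, v)).toReal := by
      rw [← EReal.coe_lt_coe_iff, EReal.coe_toReal (R.strikeBid_range x).2 hγbot,
        EReal.coe_toReal (hrange v).2 (bot_le.trans_lt hlt).ne']
      exact hlt
    have h8 : 0 < E.reachProb ρ s i x.1 (R.strikeBid x) :=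
      lt_of_le_of_ne (E.reachProb_nonneg ρ s i _ _) (Ne.symm hγpos)
    unfold gain at h4
    rw [h6] at h4
    nlinarith
  · rw [hκgt v h.le, if_neg (lt_irrefl _), h2 h]

/-- The regularized claims at losing types and random numbers lose, as do the original ones. -/
theorem Regularizes.reachProb_eq_zero (hR : E.Regularizes ρ s R) :
    ∀ᵐ y ∂(E.interimLaw i), y.1 ∈ R.losing →
      E.reachProb ρ s i y.1.1 ((s i).claimAt y) = 0 ∧
      E.reachProb ρ s i y.1.1 ((R.strategy E (s i)).claimAt y) = 0 := by
  have hmz : Measurable fun x : Θ i × I => E.reachProb ρ s i x.1 (R.losingBid x) :=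
    (E.measurable_reachProb ρ s i).comp (measurable_fst.prodMk R.losingBid_measurable)
  have h1 : ∀ᵐ y ∂(E.interimLaw i), y.1 ∈ R.losing →
      E.reachProb ρ s i y.1.1 ((s i).claimAt y) = 0 := by
    refine E.ae_interimLaw_of_ae_ae ?_ (Filter.Eventually.of_forall fun x => ?_)
    · exact (R.losing_measurable.preimage measurable_fst).himp
        (measurableSet_eq_fun (E.measurable_reachProb_claimAt ρ s i) measurable_const)
    by_cases hx : x ∈ R.losing
    · have := (E.mem_losingSet_iff ρ x).1 (hR.losing_eq ▸ hx)
      filter_upwards [this] with v hv _ using hv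
    · exact Filter.Eventually.of_forall fun v h => absurd h hx
  have hS : ∀ t, MeasurableSet {a | E.reachProb ρ s i t a ≠ 0} := fun t =>
    ((measurableSet_singleton (0 : ℝ)).preimage
      ((E.measurable_reachProb ρ s i).comp (measurable_prodMk_left (x := t)))).compl
  have h2 : ∀ᵐ x ∂((E.prior.map fun θ => θ i).prod (volume : Measure I)), x ∈ R.losing →
      E.reachProb ρ s i x.1 (R.losingBid x) = 0 := by
    have hms : MeasurableSet {x : Θ i × I | x ∈ R.losing →
        E.reachProb ρ s i x.1 (R.losingBid x) = 0} :=
      R.losing_measurable.himp (measurableSet_eq_fun hmz measurable_const)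
    refine Measure.ae_prod_iff_ae_ae hms |>.2 ?_
    have h1' := E.ae_privateLaw_of_ae_interimLaw
      ((R.losing_measurable.preimage measurable_fst).himp
        (measurableSet_eq_fun (E.measurable_reachProb_claimAt ρ s i) measurable_const)) h1
    filter_upwards [h1'] with t ht
    rw [ae_iff]
    -- Being reached with probability zero is a property of type and claim, so it passes from the
    -- old losing claims to the new ones, which have the same law.
    have h3 := hR.law_eq t _ (hS t)
    have h4 : {r | ¬ ((t, r) ∈ R.losing → E.reachProb ρ s i t (R.losingBid (t, r)) = 0)} =
        {r | (t, r) ∈ R.losing ∧ R.losingBid (t, r) ∈ {a | E.reachProb ρ s i t a ≠ 0}} := by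
      ext r; simp
    rw [h4, h3]
    refine measure_mono_null (fun w hw => ?_) (ae_iff.1 ht)
    exact fun hcon => hw.2 (hcon hw.1)
  have h2' : ∀ᵐ y ∂(E.interimLaw i), y.1 ∈ R.losing →
      E.reachProb ρ s i y.1.1 (R.losingBid y.1) = 0 := by
    refine E.ae_interimLaw_of_ae_ae ?_ ?_
    · exact (R.losing_measurable.himp (measurableSet_eq_fun hmz measurable_const)).preimage
        measurable_fst
    filter_upwards [h2] with x hx
    exact Filter.Eventually.of_forall fun v => hx
  filter_upwards [h1, h2'] with y hy1 hy2 hy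
  refine ⟨hy1 hy, ?_⟩
  have : (R.strategy E (s i)).claimAt y = R.losingBid y.1 := by
    simp only [Regularization.strategy, Regularization.bid, if_pos hy]
  rw [this]
  exact hy2 hy

/-- On the losing set the laws match by construction; elsewhere the claims themselves agree almost
surely. -/
theorem Regularizes.bidLaw_eq (hR : E.Regularizes ρ s R) (hfin : E.FiniteValue i)
    (hatom : ∀ᵐ t ∂(E.prior.map fun θ => θ i),
      E.value i t {v : ℝ | (v : EReal) = E.strike i t} = 0)
    (ho : E.InterimOptimal ρ s i) :
    ∀ᵐ t ∂(E.prior.map fun θ => θ i),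
      E.bidLaw i (R.strategy E (s i)) t = E.bidLaw i (s i) t := by
  have h1 := E.ae_privateLaw_of_ae_interimLaw
    ((R.losing_measurable.preimage measurable_fst).compl.himp
      (measurableSet_eq_fun (R.strategy E (s i)).claimAt_measurable (s i).claimAt_measurable))
    (hR.bid_eq_claimAt hfin hatom ho)
  filter_upwards [h1] with t ht
  refine Measure.ext fun S hS => ?_
  have hNt : MeasurableSet {y : I × ℝ | (t, y.1) ∈ R.losing} :=
    R.losing_measurable.preimage (f := fun y : I × ℝ => (t, y.1)) (by fun_prop)
  unfold bidLaw
  rw [Measure.map_apply (measurable_claimAt_section _ t) hS,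
    Measure.map_apply (measurable_claimAt_section _ t) hS,
    ← measure_inter_add_sdiff
      ((fun y : I × ℝ => (R.strategy E (s i)).claimAt ((t, y.1), y.2)) ⁻¹' S) hNt,
    ← measure_inter_add_sdiff ((fun y : I × ℝ => (s i).claimAt ((t, y.1), y.2)) ⁻¹' S) hNt]
  congr 1
  · have h2 : (fun y : I × ℝ => (R.strategy E (s i)).claimAt ((t, y.1), y.2)) ⁻¹' S ∩
        {y | (t, y.1) ∈ R.losing} =
        {r | (t, r) ∈ R.losing ∧ R.losingBid (t, r) ∈ S} ×ˢ (Set.univ : Set ℝ) := by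
      ext y
      simp only [Set.mem_inter_iff, Set.mem_preimage, Set.mem_ofPred_eq, Set.mem_prod,
        Set.mem_univ, and_true]
      refine and_comm.trans (and_congr_right fun hy => ?_)
      simp only [Regularization.strategy, Regularization.bid, if_pos hy]
    rw [h2]
    conv_lhs => unfold privateLaw
    rw [Measure.prod_prod, measure_univ, mul_one, hR.law_eq t S hS, Set.inter_comm]
    rfl
  · refine measure_congr ?_
    filter_upwards [ht] with w hw
    refine propext (and_congr_left fun hN => ?_)
    simp only [Set.mem_preimage]
    rw [hw hN]

/-- Clock values that are reached with probability zero are almost surely not reached. -/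
theorem ae_not_reaches (E : Environment Θ) (s : Profile Θ) {M : Set ((Θ i × I) × ℝ)}
    (hM : MeasurableSet M) {f : (Θ i × I) × ℝ → EReal} (hf : Measurable f)
    (h : ∀ᵐ y ∂(E.interimLaw i), y ∈ M → E.reachProb ρ s i y.1.1 (f y) = 0) :
    ∀ᵐ ω ∂(E.law ρ), privateInfo i ω ∈ M →
      ¬ Reaches (claims s ω) ω.2.2 i (f (privateInfo i ω)) := by
  set S : Set (View Θ i) := {z | z.1 ∈ M ∧ Reaches z.2.1 z.2.2 i (f z.1)} with hSdef
  have hS : MeasurableSet S := (hM.preimage measurable_fst).inter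
    ((measurableSet_reaches i).preimage (f := fun z : View Θ i => (z.2, f z.1))
      (measurable_snd.prodMk (hf.comp measurable_fst)))
  have hSω : MeasurableSet {ω : Sample Θ | (privateInfo i ω, claimsOrder s ω) ∈ S} :=
    hS.preimage ((measurable_privateInfo i).prodMk (measurable_claimsOrder s))
  have h1 : ∫⁻ ω, S.indicator (fun _ => (1 : ℝ≥0∞)) (privateInfo i ω, claimsOrder s ω)
      ∂(E.law ρ) = 0 := by
    rw [lintegral_law_eq E ρ s i (measurable_const.indicator hS)]
    · refine (lintegral_congr_ae (g := fun _ => 0) ?_).trans lintegral_zero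
      filter_upwards [h] with y hy
      by_cases hyM : y ∈ M
      · have h2 : ∀ q, S.indicator (fun _ => (1 : ℝ≥0∞)) (y, q) =
            {q : (Fin n → EReal) × Equiv.Perm (Fin n) | Reaches q.1 q.2 i (f y)}.indicator
              (fun _ => 1) q := fun q => by
          by_cases hq : Reaches q.1 q.2 i (f y)
          · rw [Set.indicator_of_mem (by exact ⟨hyM, hq⟩), Set.indicator_of_mem (by exact hq)]
          · rw [Set.indicator_of_notMem (fun h => hq h.2), Set.indicator_of_notMem (by exact hq)]
        simp only [h2]
        rw [lintegral_indicator_const (measurableSet_reaches_section i _), ← ofReal_reachProb,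
          hy hyM]
        simp
      · have h2 : ∀ q, S.indicator (fun _ => (1 : ℝ≥0∞)) (y, q) = 0 := fun q =>
          Set.indicator_of_notMem (fun h => hyM h.1) _
        simp [h2]
    · intro y a π x
      have h2 : (y, (Function.update a i x, π)) ∈ S ↔ (y, (a, π)) ∈ S :=
        and_congr_right fun _ => reaches_update
      by_cases hz : (y, (a, π)) ∈ S
      · rw [Set.indicator_of_mem hz, Set.indicator_of_mem (h2.2 hz)]
      · rw [Set.indicator_of_notMem hz, Set.indicator_of_notMem (h2.not.2 hz)]
  have h3 : (E.law ρ) {ω | (privateInfo i ω, claimsOrder s ω) ∈ S} = 0 := by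
    rw [← lintegral_indicator_one hSω]
    exact h1
  filter_upwards [measure_eq_zero_iff_ae_notMem.1 h3] with ω hω hωM hreach
  exact hω ⟨hωM, hreach⟩

end regularization

end Environment

theorem map_pi_of_measurable {ι : Type*} [Fintype ι] {X Y : ι → Type*}
    [∀ i, MeasurableSpace (X i)] [∀ i, MeasurableSpace (Y i)] (μ : ∀ i, Measure (X i))
    [∀ i, IsProbabilityMeasure (μ i)] {f : ∀ i, X i → Y i} (hf : ∀ i, Measurable (f i)) :
    (Measure.pi μ).map (fun x i => f i (x i)) = Measure.pi fun i => (μ i).map (f i) := by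
  have : ∀ i, IsProbabilityMeasure ((μ i).map (f i)) := fun i =>
    Measure.isProbabilityMeasure_map (hf i).aemeasurable
  exact Measure.pi_map_pi fun i => (hf i).aemeasurable

namespace Environment

variable {n : ℕ} {Θ : Fin n → Type*} [∀ i, MeasurableSpace (Θ i)]

/-! ### Regularized profiles -/

section regularizedProfile

/-- The same bidder (if any) gets the item, at the same price. -/
def SameWinner (s s' : Profile Θ) (ω : Sample Θ) : Prop :=
  ∀ i, (Wins s ω i ↔ Wins s' ω i) ∧ payment s ω i = payment s' ω i

theorem SameWinner.symm {s s' : Profile Θ} {ω : Sample Θ} (h : SameWinner s s' ω) :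
    SameWinner s' s ω := fun i => ⟨(h i).1.symm, (h i).2.symm⟩

theorem sameWinner_of_reaches {s s' : Profile Θ} {ω : Sample Θ}
    (h : ∀ i, (Wins s ω i ↔ Wins s' ω i) ∧ (Wins s ω i → claims s ω i = claims s' ω i)) :
    SameWinner s s' ω := by
  intro i
  refine ⟨(h i).1, ?_⟩
  unfold payment
  by_cases hW : Wins s ω i
  · rw [if_pos hW, if_pos ((h i).1.1 hW), (h i).2 hW]
  · rw [if_neg hW, if_neg ((h i).1.not.1 hW)]

variable {E : Environment Θ} {ρ : Measure (Equiv.Perm (Fin n))} [IsProbabilityMeasure ρ]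
  {s : Profile Θ}

variable (E) in
/-- No value distribution has an atom at the strike price. -/
def NoAtomAtStrike (i : Fin n) : Prop :=
  ∀ᵐ t ∂(E.prior.map fun θ => θ i), E.value i t {v : ℝ | (v : EReal) = E.strike i t} = 0

variable {R : ∀ i, Regularization (Θ := Θ) i} (hR : ∀ i, E.Regularizes ρ s (R i))
  (hfin : ∀ i, E.FiniteValue i) (hatom : ∀ i, E.NoAtomAtStrike i)
  (ho : ∀ i, E.InterimOptimal ρ s i)
include hR hfin hatom ho

/-- All strategies are replaced simultaneously, yet every bidder faces the same reach probabilities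
as before, also at prices that she does not claim. -/
theorem claimLaw_regularized :
    E.claimLaw ρ (fun i => (R i).strategy E (s i)) = E.claimLaw ρ s :=
  claimLaw_congr E ρ rfl fun i => (hR i).bidLaw_eq (hfin i) (hatom i) (ho i)

theorem stratGain_regularized (i : Fin n) :
    E.stratGain i ((R i).strategy E (s i)) ρ (fun i => (R i).strategy E (s i))
      =ᵐ[E.interimLaw i] E.stratGain i (s i) ρ s := by
  filter_upwards [(hR i).bid_eq_claimAt (hfin i) (hatom i) (ho i), (hR i).reachProb_eq_zero]
    with y h1 h2
  unfold stratGain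
  rw [gain_congr E ρ (claimLaw_regularized hR hfin hatom ho)]
  by_cases hy : y.1 ∈ (R i).losing
  · unfold gain
    rw [(h2 hy).1, (h2 hy).2, zero_mul, zero_mul]
  · rw [h1 hy]

theorem interimOptimal_regularized (i : Fin n) :
    E.InterimOptimal ρ (fun i => (R i).strategy E (s i)) i := by
  unfold InterimOptimal
  filter_upwards [ho i, stratGain_regularized hR hfin hatom ho i] with y h1 h2
  rw [h2, gain_congr E ρ (claimLaw_regularized hR hfin hatom ho)]
  exact h1

/-- A claim is either unchanged or, almost surely, both its old and its new version lose against the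
original claims. This is the situation of `reaches_self_congr`. -/
theorem ae_sameWinner_regularized :
    ∀ᵐ ω ∂(E.law ρ), SameWinner s (fun i => (R i).strategy E (s i)) ω := by
  have h1 : ∀ᵐ ω ∂(E.law ρ), ∀ i, claims s ω i = claims (fun i => (R i).strategy E (s i)) ω i ∨
      (¬ Reaches (claims s ω) ω.2.2 i (claims s ω i) ∧
        ¬ Reaches (claims s ω) ω.2.2 i (claims (fun i => (R i).strategy E (s i)) ω i)) := by
    refine ae_all_iff.2 fun i => ?_
    have hM : MeasurableSet {y : (Θ i × I) × ℝ | y.1 ∈ (R i).losing} :=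
      (R i).losing_measurable.preimage measurable_fst
    have h2 := ae_not_reaches E s hM (s i).claimAt_measurable
      ((hR i).reachProb_eq_zero.mono fun y hy h => (hy h).1)
    have h3 := ae_not_reaches E s hM ((R i).strategy E (s i)).claimAt_measurable
      ((hR i).reachProb_eq_zero.mono fun y hy h => (hy h).2)
    have h4 := (hR i).bid_eq_claimAt (hfin i) (hatom i) (ho i)
    rw [← map_privateInfo_law E ρ i] at h4
    have h5 := ae_of_ae_map (measurable_privateInfo i).aemeasurable h4
    filter_upwards [h2, h3, h5] with ω h2 h3 h5
    by_cases hx : (privateInfo i ω).1 ∈ (R i).losing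
    · exact Or.inr ⟨h2 hx, h3 hx⟩
    · exact Or.inl (h5 hx).symm
  filter_upwards [h1] with ω hω
  exact sameWinner_of_reaches fun i => reaches_self_congr hω i

end regularizedProfile

/-! ### The environment of the covered counterparts -/

section coveredEnvironment

variable (E : Environment Θ) (ρ : Measure (Equiv.Perm (Fin n)))

/-- The sample point of the covered counterparts. -/
noncomputable def coverSample (ω : Sample Θ) : Sample Θ :=
  ((ω.1.1, fun i => E.coveredCall i (ω.1.1 i) (ω.1.2 i)), ω.2)

theorem measurable_coverSample : Measurable E.coverSample := by
  unfold coverSample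
  refine Measurable.prodMk (Measurable.prodMk (by fun_prop) ?_) (by fun_prop)
  exact measurable_pi_lambda _ fun i => (E.measurable_coveredCall i).comp
    (f := fun ω : Sample Θ => (ω.1.1 i, ω.1.2 i)) (by fun_prop)

theorem measurable_coveredCall_section (i : Fin n) (t : Θ i) : Measurable (E.coveredCall i t) :=
  (E.measurable_coveredCall i).comp (f := fun v : ℝ => (t, v)) (by fun_prop)

theorem privateLaw_covered (i : Fin n) (t : Θ i) : E.covered.privateLaw i t =
    (E.privateLaw i t).map fun y => (y.1, E.coveredCall i t y.2) := by
  unfold privateLaw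
  rw [covered_value_apply]
  have := Measure.map_prod_map (volume : Measure I) (E.value i t) measurable_id
    (E.measurable_coveredCall_section i t)
  rw [Measure.map_id] at this
  exact this

/-- Given the types, taking covered call values acts on each bidder's value separately and so maps
the product law to the product law. -/
theorem law_covered : E.covered.law ρ = (E.law ρ).map E.coverSample := by
  refine Measure.ext_of_lintegral _ fun f hf => ?_
  rw [lintegral_map hf E.measurable_coverSample, lintegral_law E.covered ρ hf,
    lintegral_law E ρ (h := fun ω => f (E.coverSample ω)) (hf.comp E.measurable_coverSample)]
  refine lintegral_congr fun θ => lintegral_congr fun π => ?_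
  set g : ∀ _ : Fin n, I × ℝ → I × ℝ := fun j y => (y.1, E.coveredCall j (θ j) y.2) with hg
  have hm : ∀ j, Measurable (g j) := fun j =>
    measurable_fst.prodMk ((E.measurable_coveredCall_section j (θ j)).comp measurable_snd)
  have hpi : (Measure.pi fun j => E.privateLaw j (θ j)).map (fun x j => g j (x j)) =
      Measure.pi fun j => (E.privateLaw j (θ j)).map (g j) :=
    map_pi_of_measurable (X := fun _ => I × ℝ) (Y := fun _ => I × ℝ)
      (fun j => E.privateLaw j (θ j)) hm
  simp only [privateLaw_covered]
  rw [← hpi, lintegral_map (by unfold toSample; fun_prop : Measurable fun y => f (toSample θ y π))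
    (by exact measurable_pi_lambda _ fun j => (hm j).comp (measurable_pi_apply j))]
  rfl

theorem interimLaw_covered (i : Fin n) : E.covered.interimLaw i =
    (E.interimLaw i).map fun y => (y.1, E.coveredCall i y.1.1 y.2) := by
  refine Measure.ext_of_lintegral _ fun f hf => ?_
  have hm := Regularization.measurable_withCoveredCall (i := i) E
  rw [lintegral_map hf hm, lintegral_interimLaw E.covered i hf,
    lintegral_interimLaw E i (f := fun y => f (y.1, E.coveredCall i y.1.1 y.2)) (hf.comp hm)]
  refine lintegral_congr fun t => lintegral_congr fun r => ?_
  rw [covered_value_apply, lintegral_map (by fun_prop) (E.measurable_coveredCall_section i t)]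

variable {E}

theorem FiniteValue.covered {i : Fin n} (hfin : E.FiniteValue i) : E.covered.FiniteValue i := by
  unfold FiniteValue at hfin ⊢
  rw [interimLaw_covered, lintegral_map (by fun_prop)
    (Regularization.measurable_withCoveredCall (i := i) E)]
  exact ne_top_of_le_ne_top hfin
    (lintegral_mono fun y => ENNReal.ofReal_le_ofReal (E.coveredCall_le i _ _))

/-- The claims of the profile `s` are obtained from those of the profile `s'` in the auction with
covered counterparts. -/
def Lifts (E : Environment Θ) (s s' : Profile Θ) : Prop :=
  ∀ i y, (s i).claimAt y = (s' i).claimAt (y.1, E.coveredCall i y.1.1 y.2)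

variable {s s' : Profile Θ} (hl : E.Lifts s s')
include hl

theorem Lifts.claims_eq (ω : Sample Θ) : claims s' (E.coverSample ω) = claims s ω :=
  funext fun i => (hl i (privateInfo i ω)).symm

theorem Lifts.wins_iff (ω : Sample Θ) (i : Fin n) : Wins s' (E.coverSample ω) i ↔ Wins s ω i := by
  unfold Wins
  rw [hl.claims_eq]
  rfl

theorem Lifts.payment_eq (ω : Sample Θ) (i : Fin n) :
    payment s' (E.coverSample ω) i = payment s ω i := by
  have h := hl.wins_iff ω i
  unfold payment
  rw [hl.claims_eq]
  by_cases hW : Wins s ω i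
  · rw [if_pos (h.2 hW), if_pos hW]
  · rw [if_neg (h.not.2 hW), if_neg hW]

theorem Lifts.claimLaw_eq : E.covered.claimLaw ρ s' = E.claimLaw ρ s := by
  unfold claimLaw
  rw [law_covered, Measure.map_map (measurable_types_claimsOrder s') E.measurable_coverSample]
  congr 1
  funext ω
  simp only [Function.comp_apply, claimsOrder, hl.claims_eq]
  rfl

variable [IsProbabilityMeasure ρ]

theorem Lifts.stratGain_eq (i : Fin n) (y : (Θ i × I) × ℝ) :
    E.covered.stratGain i (s' i) ρ s' (y.1, E.coveredCall i y.1.1 y.2) =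
      E.stratGain i (s i) ρ s y := by
  unfold stratGain
  rw [gain_congr E ρ (hl.claimLaw_eq ρ), hl i y]
  simp only [covered_coveredCall]

/-- With free inspection the covered call value is the value itself, and the two profiles have the
same claim law. At corresponding points the optimization problems are therefore identical. -/
theorem Lifts.interimOptimal_iff (i : Fin n) :
    E.covered.InterimOptimal ρ s' i ↔ E.InterimOptimal ρ s i := by
  unfold InterimOptimal
  rw [interimLaw_covered, ae_map_iff
    (Regularization.measurable_withCoveredCall (i := i) E).aemeasurable]
  · simp only [hl.stratGain_eq ρ i, covered_coveredCall, gain_congr E ρ (hl.claimLaw_eq ρ)]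
  · have hF := E.covered.measurable_stratGain i (s' i) ρ s'
    simp only [Set.ofPred_and, Set.ofPred_forall]
    refine (measurableSet_le measurable_const hF).inter (MeasurableSet.iInter fun q =>
      measurableSet_le ?_ hF)
    simp only [covered_coveredCall]
    exact (E.covered.measurable_gain ρ s' i).comp (f := fun y : (Θ i × I) × ℝ =>
      ((y.1.1, (((q : ℚ) : ℝ) : EReal)), y.2)) (by fun_prop)

theorem Lifts.integral_stratGain (i : Fin n) :
    ∫ y, E.covered.stratGain i (s' i) ρ s' y ∂(E.covered.interimLaw i) =
      ∫ y, E.stratGain i (s i) ρ s y ∂(E.interimLaw i) := by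
  rw [interimLaw_covered, integral_map
    (Regularization.measurable_withCoveredCall (i := i) E).aemeasurable
    (E.covered.measurable_stratGain i (s' i) ρ s').aestronglyMeasurable]
  simp only [hl.stratGain_eq ρ i]

end coveredEnvironment

/-! ### From equilibria with covered counterparts back to the original auction -/

section covered

variable (E : Environment Θ) (ρ : Measure (Equiv.Perm (Fin n)))

theorem unexposed_covered [IsProbabilityMeasure ρ] (s : Profile Θ) (i : Fin n)
    (d : DutchStrategy (Θ i)) : E.covered.Unexposed ρ s i d :=
  Filter.Eventually.of_forall fun z => by
    by_cases hz : z ∈ inspectSet i d \ winSet i d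
    · rw [Set.indicator_of_mem hz]
      exact E.covered.excess_eq_zero_of_cost_eq_zero rfl
    · rw [Set.indicator_of_notMem hz]

/-- The strategies in which everybody inspects at the start and claims as in the auction with
covered counterparts. -/
noncomputable def uncover (s : Profile Θ) : Profile Θ := fun i =>
  { inspectAt := fun _ => ⊤
    claimAt := fun y => (s i).claimAt (y.1, E.coveredCall i y.1.1 y.2)
    inspectAt_measurable := measurable_const
    claimAt_measurable := (s i).claimAt_measurable.comp
      (Regularization.measurable_withCoveredCall (i := i) E)
    inspectAt_range := fun _ => Or.inr le_top
    claimAt_range := fun x _ => (s i).claimAt_range x _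
    claimAt_ne_top := fun x _ => (s i).claimAt_ne_top x _
    claimAt_le := fun _ _ => le_top }

theorem lifts_uncover (s : Profile Θ) : E.Lifts (E.uncover s) s := fun _ _ => rfl

variable {E ρ} [IsProbabilityMeasure ρ]

/-- Optimal claims that are constant above the strike price arise, up to the outcome, from
equilibria of both auctions. -/
theorem exists_equilibria (hfin : ∀ i, E.FiniteValue i) (hatom : ∀ i, E.NoAtomAtStrike i)
    {s : Profile Θ} (ho : ∀ i, E.InterimOptimal ρ s i)
    (hc : ∀ i, ∃ γ : Θ i × I → EReal, Measurable γ ∧ (∀ x, (γ x = ⊥ ∨ 0 ≤ γ x) ∧ γ x ≠ ⊤) ∧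
      E.ConstantAboveStrike ρ s i γ) :
    ∃ s₁ s₂ : Profile Θ, E.IsEquilibrium ρ s₁ ∧ E.covered.IsEquilibrium ρ s₂ ∧ E.Lifts s₁ s₂ ∧
      (∀ᵐ ω ∂(E.law ρ), SameWinner s s₁ ω) ∧
      ∀ i, E.covered.expUtility ρ s₂ i =
        ((∫ y, E.stratGain i (s i) ρ s y ∂(E.interimLaw i) : ℝ) : EReal) := by
  have h1 : ∀ i, ∃ R : Regularization (Θ := Θ) i, E.Regularizes ρ s R := fun i => by
    obtain ⟨γ, hγ, hγr, hγc⟩ := hc i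
    exact E.exists_regularizes ρ s i hγ hγr hγc
  choose R hR using h1
  have hl : E.Lifts (fun i => (R i).strategy E (s i)) (fun i => (R i).coveredStrategy E (s i)) :=
    fun i y => rfl
  have ho₁ := interimOptimal_regularized hR hfin hatom ho
  have ho₂ := fun i => (hl.interimOptimal_iff ρ i).2 (ho₁ i)
  have hfin₂ := fun i => (hfin i).covered
  refine ⟨_, _, isEquilibrium_of_interimOptimal ρ hfin ho₁
    fun i => (R i).unexposed_strategy ρ (s i) _,
    isEquilibrium_of_interimOptimal ρ hfin₂ ho₂ fun i => E.unexposed_covered ρ _ i _, hl,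
    ae_sameWinner_regularized hR hfin hatom ho, fun i => ?_⟩
  rw [InterimOptimal.expUtility ρ (hfin₂ i) (ho₂ i) (E.unexposed_covered ρ _ i _),
    hl.integral_stratGain ρ i, integral_congr_ae (stratGain_regularized hR hfin hatom ho i)]

/-- The profile `uncover` may waste inspection costs and need not be an equilibrium. Its claims are
nevertheless optimal, and above the strike price they are constant because they depend on the
covered call value only. Regularizing them supplies suitable clock values of inspection. -/
theorem exists_equilibrium_of_covered (hfin : ∀ i, E.FiniteValue i)
    (hatom : ∀ i, E.NoAtomAtStrike i) {s : Profile Θ} (hs : E.covered.IsEquilibrium ρ s) :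
    ∃ s₁ : Profile Θ, E.IsEquilibrium ρ s₁ ∧
      ∀ᵐ ω ∂(E.law ρ), SameWinner (E.uncover s) s₁ ω := by
  have hl := E.lifts_uncover s
  have ho : ∀ i, E.InterimOptimal ρ (E.uncover s) i := fun i =>
    (hl.interimOptimal_iff ρ i).1 (hs.interimOptimal_and_unexposed ρ s (hfin i).covered).1
  obtain ⟨s₁, -, h1, -, -, h2, -⟩ := exists_equilibria hfin hatom ho fun i => by
    refine ⟨fun x => (s i).claimAt (x, (E.strike i x.1).toReal), ?_, fun x =>
      ⟨(s i).claimAt_range x _, (s i).claimAt_ne_top x _⟩, ?_⟩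
    · exact (s i).claimAt_measurable.comp (measurable_id.prodMk
        ((E.measurable_strike i).comp measurable_fst).ereal_toReal)
    · refine Filter.Eventually.of_forall fun x _ _ => Filter.Eventually.of_forall fun v hv => ?_
      have : E.coveredCall i x.1 v = (E.strike i x.1).toReal := by
        unfold coveredCall; rw [min_eq_left hv.le]
      simp only [uncover, this]
  exact ⟨s₁, h1, h2⟩

end covered

end Environment

namespace Environment

variable {n : ℕ} {Θ : Fin n → Type*} [∀ i, MeasurableSpace (Θ i)]

/-! ### Equilibrium claims above the strike price -/

section aboveStrike

variable (E : Environment Θ) (ρ : Measure (Equiv.Perm (Fin n))) [IsProbabilityMeasure ρ]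
  (s : Profile Θ) (i : Fin n)

variable {i} in
theorem excess_ne_zero_iff {z : View Θ i} :
    E.excess i z ≠ 0 ↔ E.strike i z.1.1.1 < (z.1.2 : EReal) := by
  rw [← coveredCall_lt_iff, ← sub_pos]
  exact (E.excess_nonneg i z).lt_iff_ne'.symm

variable {E ρ s i}

/-- At values above the strike price the excess is nonzero, so inspecting without winning must be a
null event given the private information. -/
theorem Unexposed.reachProb_eq {d : DutchStrategy (Θ i)} (h : E.Unexposed ρ s i d) :
    ∀ᵐ y ∂(E.interimLaw i), E.strike i y.1.1 < (y.2 : EReal) →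
      E.reachProb ρ s i y.1.1 (d.inspectAt y.1) = E.reachProb ρ s i y.1.1 (d.claimAt y) := by
  unfold Unexposed viewLaw at h
  filter_upwards [Measure.ae_ae_of_ae_compProd h] with y hy hlt
  refine le_antisymm ?_ (E.reachProb_mono ρ s i _ (d.claimAt_le y.1 y.2))
  unfold reachProb Measure.real
  refine ENNReal.toReal_mono (measure_ne_top _ _) (measure_mono_ae ?_)
  rw [Kernel.comap_apply] at hy
  filter_upwards [hy] with q hq hI
  by_contra hW
  rw [Set.indicator_of_mem (by exact ⟨hI, hW⟩)] at hq
  exact E.excess_ne_zero_iff.2 hlt hq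

variable (E s i) in
/-- The average of the claims of bidder `i` at values above the strike price. -/
noncomputable def averageClaim (x : Θ i × I) : EReal :=
  (((∫⁻ v, {v : ℝ | E.strike i x.1 < (v : EReal)}.indicator
    (fun v => ENNReal.ofReal ((s i).claimAt (x, v)).toReal) v ∂(E.value i x.1)) /
      E.value i x.1 {v : ℝ | E.strike i x.1 < (v : EReal)}).toReal : ℝ)

theorem measurableSet_strike_lt :
    MeasurableSet {y : (Θ i × I) × ℝ | E.strike i y.1.1 < (y.2 : EReal)} :=
  measurableSet_lt ((E.measurable_strike i).comp (measurable_fst.comp measurable_fst))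
    measurable_snd.coe_real_ereal

theorem measurable_averageClaim : Measurable (E.averageClaim s i) := by
  have hS := measurableSet_strike_lt (E := E) (i := i)
  have h1 : Measurable fun x : Θ i × I => ∫⁻ v, {v : ℝ | E.strike i x.1 < (v : EReal)}.indicator
      (fun v => ENNReal.ofReal ((s i).claimAt (x, v)).toReal) v ∂(E.value i x.1) :=
    ((s i).claimAt_measurable.ereal_toReal.ennreal_ofReal.indicator
      hS).lintegral_kernel_prod_right' (κ := Kernel.prodMkRight I (E.value i))
  have h2 : Measurable fun x : Θ i × I =>
      E.value i x.1 {v : ℝ | E.strike i x.1 < (v : EReal)} :=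
    Kernel.measurable_kernel_prodMk_left (κ := Kernel.prodMkRight I (E.value i)) hS
  exact (h1.div h2).ennreal_toReal.coe_real_ereal

/-- The average recovers the common claim and, unlike the choice of a particular value, is visibly
measurable in the type and the random number. -/
theorem averageClaim_eq {x : Θ i × I} {a : ℝ} (ha : 0 ≤ a)
    (hpos : E.value i x.1 {v : ℝ | E.strike i x.1 < (v : EReal)} ≠ 0)
    (h : ∀ᵐ (v : ℝ) ∂(E.value i x.1), E.strike i x.1 < (v : EReal) → (s i).claimAt (x, v) = a) :
    E.averageClaim s i x = a := by
  have hS : MeasurableSet {v : ℝ | E.strike i x.1 < (v : EReal)} :=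
    measurableSet_strike_lt.preimage (f := fun v : ℝ => (x, v)) (by fun_prop)
  have h1 : ∫⁻ v, {v : ℝ | E.strike i x.1 < (v : EReal)}.indicator
      (fun v => ENNReal.ofReal ((s i).claimAt (x, v)).toReal) v ∂(E.value i x.1) =
      ENNReal.ofReal a * E.value i x.1 {v : ℝ | E.strike i x.1 < (v : EReal)} := by
    rw [← lintegral_indicator_const hS]
    refine lintegral_congr_ae ?_
    filter_upwards [h] with v hv
    by_cases hlt : v ∈ {v : ℝ | E.strike i x.1 < (v : EReal)}
    · rw [Set.indicator_of_mem hlt, Set.indicator_of_mem hlt, hv hlt, EReal.toReal_coe]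
    · rw [Set.indicator_of_notMem hlt, Set.indicator_of_notMem hlt]
  unfold averageClaim
  rw [h1, ENNReal.mul_div_cancel_right hpos (measure_ne_top _ _), ENNReal.toReal_ofReal ha]

/-- Above the strike price all claims are reached with the probability `P` of getting to inspect and
are optimal for the same covered call value. Equal gains at equal positive probability force equal
prices. -/
theorem InterimOptimal.constantAboveStrike (hfin : E.FiniteValue i)
    (ho : E.InterimOptimal ρ s i) (hx : E.Unexposed ρ s i (s i)) :
    E.ConstantAboveStrike ρ s i (E.averageClaim s i) := by
  unfold ConstantAboveStrike
  filter_upwards [E.ae_prod_of_ae_type hfin.ae_type, E.ae_ae_of_ae_interimLaw ho,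
    E.ae_ae_of_ae_interimLaw hx.reachProb_eq] with x hv hopt hreach hxl hc
  obtain ⟨w, hw, -⟩ := E.exists_strike_eq_coe i (pos_iff_ne_zero.2 hc) hv
  have hpos := E.value_strike_lt_ne_zero i hc hv
  have hκ : ∀ v : ℝ, E.strike i x.1 < (v : EReal) → E.coveredCall i x.1 v = w := fun v hlt => by
    rw [← EReal.coe_eq_coe_iff, E.coe_coveredCall, min_eq_left hlt.le, hw]
  set P := E.reachProb ρ s i x.1 ((s i).inspectAt x) with hP
  -- Claims are never above the clock value of inspection, so `P = 0` would make all of them lose.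
  have hP0 : 0 < P := by
    refine lt_of_le_of_ne (E.reachProb_nonneg ρ s i _ _) fun h0 => hxl ?_
    refine (E.mem_losingSet_iff ρ x).2 (Filter.Eventually.of_forall fun v => ?_)
    exact le_antisymm ((E.reachProb_mono ρ s i _ ((s i).claimAt_le x v)).trans h0.ge)
      (E.reachProb_nonneg ρ s i _ _)
  have hgood : ∀ᵐ (v : ℝ) ∂(E.value i x.1), E.strike i x.1 < (v : EReal) →
      E.reachProb ρ s i x.1 ((s i).claimAt (x, v)) = P ∧
      ∀ a : EReal, (a = ⊥ ∨ 0 ≤ a) → a ≠ ⊤ →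
        E.gain ρ s i x.1 a w ≤ E.gain ρ s i x.1 ((s i).claimAt (x, v)) w := by
    filter_upwards [hopt, hreach] with v h1 h2 hlt
    refine ⟨(h2 hlt).symm, fun a ha ha' => ?_⟩
    unfold stratGain at h1
    simp only [hκ v hlt] at h1
    exact E.gain_le_of_forall_rat ρ h1.1 h1.2 ha ha'
  obtain ⟨v₀, hv₀, hv₀'⟩ : ∃ v : ℝ, E.strike i x.1 < (v : EReal) ∧
      (E.reachProb ρ s i x.1 ((s i).claimAt (x, v)) = P ∧
      ∀ a : EReal, (a = ⊥ ∨ 0 ≤ a) → a ≠ ⊤ →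
        E.gain ρ s i x.1 a w ≤ E.gain ρ s i x.1 ((s i).claimAt (x, v)) w) := by
    by_contra hcon
    refine hpos (measure_mono_null ?_ (ae_iff.1 hgood))
    exact fun v hlt hv => hcon ⟨v, hlt, hv hlt⟩
  have hne : ∀ v, E.reachProb ρ s i x.1 ((s i).claimAt (x, v)) = P →
      (s i).claimAt (x, v) ≠ ⊥ := fun v hvP hb => by
    rw [hb, reachProb_bot] at hvP
    exact hP0.ne hvP
  have hconst : ∀ᵐ (v : ℝ) ∂(E.value i x.1), E.strike i x.1 < (v : EReal) →
      (s i).claimAt (x, v) = (((s i).claimAt (x, v₀)).toReal : ℝ) := by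
    filter_upwards [hgood] with v hv hlt
    obtain ⟨h1, h2⟩ := hv hlt
    have h3 := h2 _ ((s i).claimAt_range x v₀) ((s i).claimAt_ne_top x v₀)
    have h4 := hv₀'.2 _ ((s i).claimAt_range x v) ((s i).claimAt_ne_top x v)
    have h5 := le_antisymm h3 h4
    unfold gain at h5
    rw [h1, hv₀'.1] at h5
    have h6 := mul_left_cancel₀ hP0.ne' h5
    rw [← EReal.coe_toReal ((s i).claimAt_ne_top x v) (hne v h1)]
    congr 1
    linarith
  have h0 : 0 ≤ ((s i).claimAt (x, v₀)).toReal := claimAt_toReal_nonneg i (s i) (x, v₀)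
  filter_upwards [hconst] with v hv hlt
  rw [hv hlt, averageClaim_eq h0 hpos hconst]

theorem IsEquilibrium.exists_covered (hfin : ∀ i, E.FiniteValue i)
    (hatom : ∀ i, E.NoAtomAtStrike i) (hs : E.IsEquilibrium ρ s) :
    ∃ s₁ s₂ : Profile Θ, E.IsEquilibrium ρ s₁ ∧ E.covered.IsEquilibrium ρ s₂ ∧ E.Lifts s₁ s₂ ∧
      (∀ᵐ ω ∂(E.law ρ), SameWinner s s₁ ω) ∧
      ∀ i, E.covered.expUtility ρ s₂ i = E.expUtility ρ s i := by
  have h := fun i => hs.interimOptimal_and_unexposed ρ s (hfin i)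
  obtain ⟨s₁, s₂, h1, h2, h3, h4, h5⟩ := exists_equilibria hfin hatom (fun i => (h i).1)
    fun i => ⟨E.averageClaim s i, measurable_averageClaim,
      fun x => ⟨Or.inr (EReal.coe_nonneg.2 ENNReal.toReal_nonneg), EReal.coe_ne_top _⟩,
      (h i).1.constantAboveStrike (hfin i) (h i).2⟩
  refine ⟨s₁, s₂, h1, h2, h3, h4, fun i => ?_⟩
  rw [h5, InterimOptimal.expUtility ρ (hfin i) (h i).1 (h i).2]

end aboveStrike

end Environment

namespace Environment

variable {n : ℕ} {Θ : Fin n → Type*} [∀ i, MeasurableSpace (Θ i)]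

/-! ### Functional equivalence of equilibria -/

section functionalEquivalence

theorem SameWinner.trans {s s' s'' : Profile Θ} {ω : Sample Θ} (h : SameWinner s s' ω)
    (h' : SameWinner s' s'' ω) : SameWinner s s'' ω :=
  fun i => ⟨(h i).1.trans (h' i).1, (h i).2.trans (h' i).2⟩

theorem measurableSet_wins (s : Profile Θ) (i : Fin n) :
    MeasurableSet {ω : Sample Θ | Wins s ω i} :=
  (measurableSet_reaches i).preimage (f := fun ω : Sample Θ => (claimsOrder s ω, claims s ω i))
    ((measurable_claimsOrder s).prodMk ((measurable_pi_apply i).comp (measurable_claims s)))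

theorem measurableSet_inspects (s : Profile Θ) (i : Fin n) :
    MeasurableSet {ω : Sample Θ | Inspects s ω i} :=
  (measurableSet_reaches i).preimage (f := fun ω : Sample Θ =>
      (claimsOrder s ω, (s i).inspectAt (privateInfo i ω).1))
    ((measurable_claimsOrder s).prodMk ((s i).inspectAt_measurable.comp
      (measurable_fst.comp (measurable_privateInfo i))))

theorem measurable_payment (s : Profile Θ) (i : Fin n) :
    Measurable fun ω : Sample Θ => payment s ω i := by
  unfold payment
  exact Measurable.ite (measurableSet_wins s i)
    ((measurable_pi_apply i).comp (measurable_claims s)).ereal_toReal measurable_const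

theorem measurableSet_sameWinner (s s' : Profile Θ) :
    MeasurableSet {ω : Sample Θ | SameWinner s s' ω} := by
  simp only [SameWinner, Set.ofPred_forall, Set.ofPred_and]
  refine MeasurableSet.iInter fun i => MeasurableSet.inter ?_
    (measurableSet_eq_fun (measurable_payment s i) (measurable_payment s' i))
  exact (measurableSet_wins s i).iff (measurableSet_wins s' i)

variable {E : Environment Θ} {ρ : Measure (Equiv.Perm (Fin n))}

theorem Lifts.ae_sameWinner_iff {s₁ s₂ s₁' s₂' : Profile Θ} (hl : E.Lifts s₁ s₂)
    (hl' : E.Lifts s₁' s₂') : (∀ᵐ ω ∂(E.covered.law ρ), SameWinner s₂ s₂' ω) ↔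
      ∀ᵐ ω ∂(E.law ρ), SameWinner s₁ s₁' ω := by
  rw [law_covered, ae_map_iff E.measurable_coverSample.aemeasurable
    (measurableSet_sameWinner s₂ s₂')]
  simp only [SameWinner, hl.wins_iff, hl'.wins_iff, hl.payment_eq, hl'.payment_eq]

theorem Lifts.expRevenue_eq {s₁ s₂ : Profile Θ} (hl : E.Lifts s₁ s₂) :
    E.covered.expRevenue ρ s₂ = E.expRevenue ρ s₁ := by
  unfold expRevenue
  rw [law_covered, lintegral_map (Finset.measurable_sum _ fun i _ =>
    measurable_payment s₂ i).ennreal_ofReal E.measurable_coverSample]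
  simp only [hl.payment_eq]

theorem expRevenue_congr {s s' : Profile Θ} (h : ∀ᵐ ω ∂(E.law ρ), SameWinner s s' ω) :
    E.expRevenue ρ s = E.expRevenue ρ s' := by
  refine lintegral_congr_ae ?_
  filter_upwards [h] with ω hω
  simp only [fun i => (hω i).2]

theorem sameOutcome_covered_iff {s s' : Profile Θ} {ω : Sample Θ} :
    E.covered.SameOutcome s s' ω ↔ SameWinner s s' ω := by
  have hc : ∀ i, E.covered.cost i (ω.1.1 i) = 0 := fun _ => rfl
  simp [SameOutcome, SameWinner, hc]

theorem functionalEquivalence_covered_iff {s s' : E.covered.Equilibrium ρ} :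
    (E.covered.functionalEquivalence ρ) s s' ↔
      ∀ᵐ ω ∂(E.covered.law ρ), SameWinner s.1 s'.1 ω :=
  Filter.eventually_congr (Filter.Eventually.of_forall fun _ => sameOutcome_covered_iff)

variable [IsProbabilityMeasure ρ] {s s' : Profile Θ} {i : Fin n}

theorem Unexposed.ae_wins (hx : E.Unexposed ρ s i (s i)) :
    ∀ᵐ ω ∂(E.law ρ), Inspects s ω i → E.strike i (ω.1.1 i) < (ω.1.2 i : EReal) →
      Wins s ω i := by
  set g : View Θ i → ℝ≥0∞ := fun z =>
    ENNReal.ofReal ((inspectSet i (s i) \ winSet i (s i)).indicator (E.excess i) z) with hg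
  have hgm : Measurable g := ((E.measurable_excess i).indicator
    ((measurableSet_inspectSet i (s i)).diff (measurableSet_winSet i (s i)))).ennreal_ofReal
  have h0 : ∫⁻ ω, g (privateInfo i ω, claimsOrder s ω) ∂(E.law ρ) = 0 := by
    rw [lintegral_law_eq_viewLaw E i ρ s hgm]
    · rw [lintegral_eq_zero_iff hgm]
      filter_upwards [hx] with z hz
      simp [hg, hz]
    · intro y a π x
      simp only [hg]
      congr 1
      have h1 : (y, (Function.update a i x, π)) ∈ inspectSet i (s i) \ winSet i (s i) ↔
          (y, (a, π)) ∈ inspectSet i (s i) \ winSet i (s i) :=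
        and_congr (inspectSet_update_iff i (s i) y a π x)
          (winSet_update_iff i (s i) y a π x).not
      by_cases hz : (y, (a, π)) ∈ inspectSet i (s i) \ winSet i (s i)
      · rw [Set.indicator_of_mem hz, Set.indicator_of_mem (h1.2 hz)]
        rfl
      · rw [Set.indicator_of_notMem hz, Set.indicator_of_notMem (h1.not.2 hz)]
  have hgω : Measurable fun ω => g (privateInfo i ω, claimsOrder s ω) :=
    hgm.comp ((measurable_privateInfo i).prodMk (measurable_claimsOrder s))
  rw [lintegral_eq_zero_iff hgω] at h0
  filter_upwards [h0] with ω hω hI hlt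
  have hI' := inspects_update_iff i (s i) s ω
  have hW' := wins_update_iff i (s i) s ω
  rw [Function.update_eq_self] at hI' hW'
  rw [hW']
  by_contra hW
  simp only [hg, Pi.zero_apply, ENNReal.ofReal_eq_zero] at hω
  rw [Set.indicator_of_mem (by exact ⟨hI'.1 hI, hW⟩)] at hω
  exact E.excess_ne_zero_iff (z := (privateInfo i ω, claimsOrder s ω)).2 hlt
    (le_antisymm hω (E.excess_nonneg i _))

/-- The inspection is planned without knowledge of the value, and the rivals' claims do not involve
it. -/
theorem inspects_update_value_iff (ω : Sample Θ) (v : ℝ) :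
    Inspects s ((ω.1.1, Function.update ω.1.2 i v), ω.2) i ↔ Inspects s ω i := by
  refine reaches_congr fun j hj => ?_
  simp [claims, Function.update_of_ne hj]

/-- Up to null events, the winners determine the payments of non-zero inspection costs. -/
theorem Unexposed.ae_inspects_of_sameWinner (hx : E.Unexposed ρ s i (s i))
    (hfin : E.FiniteValue i) (h : ∀ᵐ ω ∂(E.law ρ), SameWinner s s' ω) :
    ∀ᵐ ω ∂(E.law ρ), Inspects s ω i → E.cost i (ω.1.1 i) ≠ 0 → Inspects s' ω i := by
  set A : Set (Sample Θ) := {ω | Inspects s ω i} \ {ω | Inspects s' ω i} with hA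
  have hAm : MeasurableSet A := (measurableSet_inspects s i).diff (measurableSet_inspects s' i)
  have hSm : MeasurableSet {y : Θ i × ℝ | E.strike i y.1 < (y.2 : EReal)} :=
    measurableSet_lt ((E.measurable_strike i).comp measurable_fst) measurable_snd.coe_real_ereal
  have hSt : ∀ t, MeasurableSet {v : ℝ | E.strike i t < (v : EReal)} := fun t =>
    hSm.preimage (f := fun v : ℝ => (t, v)) (by fun_prop)
  set B : Set (Sample Θ) := {ω | E.strike i (ω.1.1 i) < (ω.1.2 i : EReal)} with hB
  have hBm : MeasurableSet B :=
    hSm.preimage (f := fun ω : Sample Θ => (ω.1.1 i, ω.1.2 i)) (by fun_prop)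
  have hAup : ∀ (ω : Sample Θ) v, ((ω.1.1, Function.update ω.1.2 i v), ω.2) ∈ A ↔ ω ∈ A :=
    fun ω v => and_congr (inspects_update_value_iff ω v) (inspects_update_value_iff ω v).not
  have hFm : Measurable fun ω : Sample Θ =>
      E.value i (ω.1.1 i) {v : ℝ | E.strike i (ω.1.1 i) < (v : EReal)} := by
    have hm := Kernel.measurable_kernel_prodMk_left (κ := E.value i) hSm
    exact hm.comp (by fun_prop : Measurable fun ω : Sample Θ => ω.1.1 i)
  -- On `A`, the event `B` is replaced by its probability given the type. Membership in `A` does not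
  -- depend on the value, so redrawing the value shows that `f` has the same integral as the
  -- indicator of `A ∩ B`.
  set f : Sample Θ → ℝ≥0∞ := A.indicator fun ω =>
    E.value i (ω.1.1 i) {v : ℝ | E.strike i (ω.1.1 i) < (v : EReal)} with hf
  have hfm : Measurable f := hFm.indicator hAm
  have hsample : ∀ (ω : Sample Θ) (r : I),
      ∫⁻ v, f ((ω.1.1, Function.update ω.1.2 i v), (Function.update ω.2.1 i r, ω.2.2))
          ∂(E.value i (ω.1.1 i)) =
        ∫⁻ v, (A ∩ B).indicator (fun _ => 1)
          ((ω.1.1, Function.update ω.1.2 i v), (Function.update ω.2.1 i r, ω.2.2))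
          ∂(E.value i (ω.1.1 i)) := by
    intro ω r
    have hup := hAup (ω.1, (Function.update ω.2.1 i r, ω.2.2))
    by_cases hω : ((ω.1, (Function.update ω.2.1 i r, ω.2.2)) : Sample Θ) ∈ A
    · have h1 : ∀ v, f ((ω.1.1, Function.update ω.1.2 i v), (Function.update ω.2.1 i r, ω.2.2)) =
          E.value i (ω.1.1 i) {v : ℝ | E.strike i (ω.1.1 i) < (v : EReal)} := fun v =>
        Set.indicator_of_mem ((hup v).2 hω) _
      have h2 : ∀ v, (A ∩ B).indicator (fun _ => (1 : ℝ≥0∞))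
          ((ω.1.1, Function.update ω.1.2 i v), (Function.update ω.2.1 i r, ω.2.2)) =
          {v : ℝ | E.strike i (ω.1.1 i) < (v : EReal)}.indicator (fun _ => 1) v := fun v => by
        have h3 : ((ω.1.1, Function.update ω.1.2 i v), (Function.update ω.2.1 i r, ω.2.2)) ∈ A ∩ B ↔
            v ∈ {v : ℝ | E.strike i (ω.1.1 i) < (v : EReal)} := by
          simp only [Set.mem_inter_iff, (hup v).2 hω, true_and, hB, Set.mem_ofPred_eq,
            Function.update_self]
        by_cases hv : v ∈ {v : ℝ | E.strike i (ω.1.1 i) < (v : EReal)}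
        · rw [Set.indicator_of_mem hv, Set.indicator_of_mem (h3.2 hv)]
        · rw [Set.indicator_of_notMem hv, Set.indicator_of_notMem (h3.not.2 hv)]
      simp only [h1, h2]
      rw [lintegral_indicator_const (hSt _), lintegral_const, measure_univ, one_mul, mul_one]
    · have h1 : ∀ v, f ((ω.1.1, Function.update ω.1.2 i v), (Function.update ω.2.1 i r, ω.2.2)) =
          0 := fun v => Set.indicator_of_notMem ((hup v).not.2 hω) _
      have h2 : ∀ v, (A ∩ B).indicator (fun _ => (1 : ℝ≥0∞))
          ((ω.1.1, Function.update ω.1.2 i v), (Function.update ω.2.1 i r, ω.2.2)) = 0 := fun v =>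
        Set.indicator_of_notMem (fun h => (hup v).not.2 hω h.1) _
      simp only [h1, h2]
  -- On `A ∩ B` the bidder inspects under `s` and her value exceeds the strike price, so she wins
  -- under `s`, hence under `s'`. A winner has inspected, contrary to the definition of `A`.
  have hAB : ∫⁻ ω, (A ∩ B).indicator (fun _ => (1 : ℝ≥0∞)) ω ∂(E.law ρ) = 0 := by
    rw [lintegral_indicator_const (hAm.inter hBm), one_mul, measure_eq_zero_iff_ae_notMem]
    filter_upwards [hx.ae_wins, h] with ω h1 h2 hω
    exact hω.1.2 (Reaches.mono (((h2 i).1).1 (h1 hω.1.1 hω.2))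
      ((s' i).claimAt_le (ω.1.1 i, ω.2.1 i) (ω.1.2 i)))
  have hf0 : ∫⁻ ω, f ω ∂(E.law ρ) = 0 := by
    rw [lintegral_law_resample E ρ i hfm]
    simp only [hsample]
    rw [← lintegral_law_resample E ρ i (measurable_const.indicator (hAm.inter hBm)), hAB]
  rw [lintegral_eq_zero_iff hfm] at hf0
  have hfin' := hfin.ae_interimLaw
  rw [← map_privateInfo_law E ρ i] at hfin'
  filter_upwards [hf0, ae_of_ae_map (measurable_privateInfo i).aemeasurable hfin'] with ω h1 h2 hI hc
  by_contra hI'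
  rw [hf, Set.indicator_of_mem (by exact ⟨hI, hI'⟩)] at h1
  exact E.value_strike_lt_ne_zero i hc h2 h1

/-- In equilibrium nobody is exposed, so the winners determine the inspection costs that are paid.
-/
theorem functionalEquivalence_iff (hfin : ∀ i, E.FiniteValue i) {s s' : E.Equilibrium ρ} :
    (E.functionalEquivalence ρ) s s' ↔ ∀ᵐ ω ∂(E.law ρ), SameWinner s.1 s'.1 ω := by
  refine ⟨fun h => ?_, fun h => ?_⟩
  · change ∀ᵐ ω ∂(E.law ρ), E.SameOutcome s.1 s'.1 ω at h
    filter_upwards [h] with ω hω i using ⟨(hω i).1, (hω i).2.1⟩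
  · change ∀ᵐ ω ∂(E.law ρ), E.SameOutcome s.1 s'.1 ω
    have h1 := ae_all_iff.2 fun i =>
      (s.2.interimOptimal_and_unexposed ρ s.1 (hfin i)).2.ae_inspects_of_sameWinner (hfin i) h
    have h2 := ae_all_iff.2 fun i =>
      (s'.2.interimOptimal_and_unexposed ρ s'.1 (hfin i)).2.ae_inspects_of_sameWinner (hfin i)
        (h.mono fun _ => SameWinner.symm)
    filter_upwards [h, h1, h2] with ω h h1 h2 i
    exact ⟨(h i).1, (h i).2, fun hi => ⟨h1 i hi.1 hi.2, hi.2⟩, fun hi => ⟨h2 i hi.1 hi.2, hi.2⟩⟩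

theorem finiteValue_of_lintegral
    (hv : ∫⁻ θ, ∫⁻ v, ENNReal.ofReal v ∂(E.value i (θ i)) ∂E.prior < ∞) :
    E.FiniteValue i := by
  have hm : Measurable fun t => ∫⁻ v, ENNReal.ofReal v ∂(E.value i t) :=
    Measurable.lintegral_kernel (by fun_prop)
  unfold FiniteValue
  rw [lintegral_interimLaw E i (by fun_prop), lintegral_map _ (measurable_pi_apply i)]
  · simp only [lintegral_const, measure_univ, mul_one]
    exact hv.ne
  · simpa only [lintegral_const, measure_univ, mul_one] using hm

theorem noAtomAtStrike_of_ae
    (hatom : ∀ᵐ θ ∂E.prior, E.value i (θ i) {v : ℝ | (v : EReal) = E.strike i (θ i)} = 0) :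
    E.NoAtomAtStrike i := by
  have hS : MeasurableSet {y : Θ i × ℝ | (y.2 : EReal) = E.strike i y.1} :=
    measurableSet_eq_fun measurable_snd.coe_real_ereal
      ((E.measurable_strike i).comp measurable_fst)
  have hm := Kernel.measurable_kernel_prodMk_left (κ := E.value i) hS
  exact (ae_map_iff (measurable_pi_apply i).aemeasurable (hm (measurableSet_singleton 0))).2 hatom

end functionalEquivalence

end Environment

/-! ### The mapping of equilibria -/

theorem theorem2 {n : ℕ} {Θ : Fin n → Type*} [∀ i, MeasurableSpace (Θ i)] (E : Environment Θ)
    (ρ : Measure (Equiv.Perm (Fin n))) [IsProbabilityMeasure ρ]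
    (hv : ∀ i, ∫⁻ θ, ∫⁻ v, ENNReal.ofReal v ∂(E.value i (θ i)) ∂E.prior < ∞)
    (hatom : ∀ i, ∀ᵐ θ ∂E.prior, E.value i (θ i) {v : ℝ | (v : EReal) = E.strike i (θ i)} = 0) :
    ∃ Φ : E.Equilibrium ρ → E.covered.Equilibrium ρ,
      (∀ s i, E.covered.expUtility ρ (Φ s).1 i = E.expUtility ρ s.1 i) ∧
      (∀ s, E.covered.expRevenue ρ (Φ s).1 = E.expRevenue ρ s.1) ∧
      ∃ hΦ : ∀ s s', (E.functionalEquivalence ρ) s s' →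
          (E.covered.functionalEquivalence ρ) (Φ s) (Φ s'),
        Function.Bijective (Quotient.map Φ hΦ :
          Quotient (E.functionalEquivalence ρ) → Quotient (E.covered.functionalEquivalence ρ)) := by
  have hfin := fun i => Environment.finiteValue_of_lintegral (hv i)
  choose s₁ s₂ _ h2 hl hw hu using fun s : E.Equilibrium ρ =>
    s.2.exists_covered hfin fun i => Environment.noAtomAtStrike_of_ae (hatom i)
  -- In both auctions equivalence means the same winner and price, and each equilibrium agrees in
  -- these respects with its regularization. One direction makes the map on classes well defined,
  -- the other makes it injective.
  have hiff : ∀ s s', (E.covered.functionalEquivalence ρ) ⟨s₂ s, h2 s⟩ ⟨s₂ s', h2 s'⟩ ↔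
      (E.functionalEquivalence ρ) s s' := fun s s' => by
    rw [Environment.functionalEquivalence_covered_iff, Environment.functionalEquivalence_iff hfin,
      (hl s).ae_sameWinner_iff (hl s')]
    constructor
    · intro h
      filter_upwards [h, hw s, hw s'] with ω h h1 h2 using h1.trans (h.trans h2.symm)
    · intro h
      filter_upwards [h, hw s, hw s'] with ω h h1 h2 using h1.symm.trans (h.trans h2)
  refine ⟨fun s => ⟨s₂ s, h2 s⟩, hu, fun s => ?_, fun s s' => (hiff s s').2, ?_, ?_⟩
  · rw [(hl s).expRevenue_eq, Environment.expRevenue_congr (hw s)]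
  · rintro ⟨s⟩ ⟨s'⟩ h
    exact Quotient.sound ((hiff s s').1 (Quotient.exact h))
  -- A preimage of the class of `t` is the equilibrium that regularizes `uncover t`; it and the lift
  -- of its image both have the winners and prices of `uncover t`.
  · rintro ⟨t⟩
    obtain ⟨s, hs, h⟩ := Environment.exists_equilibrium_of_covered hfin
      (fun i => Environment.noAtomAtStrike_of_ae (hatom i)) t.2
    refine ⟨Quotient.mk _ ⟨s, hs⟩, Quotient.sound ?_⟩
    change (E.covered.functionalEquivalence ρ) _ t
    rw [Environment.functionalEquivalence_covered_iff,
      (hl ⟨s, hs⟩).ae_sameWinner_iff (E.lifts_uncover t.1)]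
    filter_upwards [h, hw ⟨s, hs⟩] with ω h h1 using (h.trans h1).symm
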